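/- Let $\Omega=[0,1[$ with its usual topology. For $\omega\subset\Omega$ open put $\mathcal H_1(\omega)=\{u\in C^2(\omega):(xu)''=0\}$, let $\mathcal H_2(\omega)$ be the set of continuous functions on $\omega$ that have the form $a/x^2+b$ ($a,b\in\mathbb R$) on each connected component of $\omega$ (so they are constant on the component of $0$ if $0\in\omega$), and put $\mathcal H(\omega)=\{(u,v)\in C^2(\omega)\times C^2(\omega):(xu)''=-v,\ v\in\mathcal H_2(\omega)\}$. With $1/0=+\infty$, put, for $x,y\in\Omega$, $$p_y(x)=\frac1{\max(x,y)}-1,\qquad q_y(x)=\frac1{\max(x,y)^2}-1 .$$ For a biharmonic space $(\Omega,\mathcal G)$ (in the sense of Smyrnelis) with associated harmonic spaces $\mathcal G_1,\mathcal G_2$, the pure hyperharmonic function of order 2 associated with a $\mathcal G_2$-hyperharmonic function $v\ge0$ is the lower semicontinuous regularization of the infimum of all $\mathcal G_1$-hyperharmonic $u\ge0$ such that $(u,v)$ is $\mathcal G$-hyperharmonic; a $\mathcal G$-potential $(u,v)$ is pure if $u$ is the pure function associated with $v$; $(\Omega,\mathcal G)$ is strong if it has a $\mathcal G$-potential $(p,q)$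 with $p,q>0$; it is a Green space if $\mathcal G_1,\mathcal G_2$ are Brelot harmonic spaces in each of which potentials with the same one-point harmonic support are proportional. A Green kernel of $\mathcal G_i$ is $G(x,y)=g_y(x)$, where $g_y$ is a $\mathcal G_i$-potential of harmonic support $\{y\}$ and $y\mapsto g_y$ is continuous for the topology of R.-M. Hervé on the nonnegative $\mathcal G_i$-superharmonic functions; the biharmonic Green kernel exists if, for some Green kernel $g_y(x)$ of $\mathcal G_2$, the pure function of order 2 associated with $g_y$ is $\mathcal G_1$-superharmonic for every $y$. Then: 1. $(\Omega,\mathcal H)$ is a Brelot biharmonic space with associated harmonic spaces $(\Omega,\mathcal H_1)$ and $(\Omega,\mathcal H_2)$. It is strong: with $p(x)=\frac{1-x}2$ and $q=\min(1,q_0)$, the pair $(p,q)$ is a continuous $\mathcal H$-potential $>0$. 2. $(\Omega,\mathcal H)$ is a Green biharmonic space and both $(\Omega,\mathcal H_1)$ and $(\Omega,\mathcal H_2)$ are symmetric Green spaces: $G_1(x,y)=p_y(x)$ and $G_2(x,y)=q_y(x)$ are Green kernels of $\mathcal H_1$ and $\mathcal H_2$; they are symmetric, and continuous on $\Omega\times\Omega$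 with values in $[0,+\infty]$. 3. For every $\mathcal H_2$-potential $v$ of harmonic support $\{0\}$, in particular for $v=q_0$, the pure hyperharmonic function of order 2 associated with $v$ is identically $+\infty$, hence is not $\mathcal H_1$-superharmonic. No pure $\mathcal H$-potential has biharmonic support $\{0\}$, and the biharmonic Green kernel of $(\Omega,\mathcal H)$ does not exist. 4. (Counterexample to the claim that in a strong Green biharmonic space in which $(1,1)$ is hyperharmonic the pure functions associated with the potentials of one-point harmonic support are superharmonic.) Let $(P,Q)$ be any finite continuous $\mathcal H$-potential with $Q>0$, and let $\mathcal H'(U)$ be the set of pairs $(h,k)$ of continuous functions on $U$ with $(Ph,Qk)\in\mathcal H(U)$. Then $(\Omega,\mathcal H')$ is a strong Green biharmonic space, $(1,1)$ is $\mathcal H'$-hyperharmonic on $\Omega$, and $\mathcal H'_2$ has a Green kernel; nevertheless, for every $\mathcal H'_2$-potential of harmonic support $\{0\}$ the associated pure function of order 2 is identically $+\infty$ (so it is not $\mathcal H_1'$-superharmonic), no pure $\mathcal H'$-potential has biharmonic support $\{0\}$, and the biharmonic Green kernel of $(\Omega,\mathcal H')$ does not exist. 5. Let $\mu(dy)=y\,dy$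 on $\Omega$. There is exactly one coupling kernel $V$ of $(\Omega,\mathcal H)$ (a Borel kernel such that $V\varphi$ is an $\mathcal H_1$-potential that is $\mathcal H_1$-harmonic outside the support of $\varphi$ for every $\varphi\in C_c^+(\Omega)$, and such that $Vv$ is the pure function of order 2 associated with $v$ for every $\mathcal H_2$-hyperharmonic $v\ge0$), and it is $Vf(x)=\int p_y(x)f(y)\,d\mu(y)$. The pure function associated with $1$ is $\frac{1-x}2$, and $\mu$ is the only Radon measure with $\frac{1-x}2=\int p_y(x)\,d\mu(y)$ for all $x\in\Omega$. For the adjoint kernel $V^*f(x)=\int q_x(y)f(y)\,d\mu(y)$ one has $V^*\varphi(0)=+\infty$ for every $\varphi\in C_c^+(\Omega)$ with $\varphi(0)>0$. In particular, it is not true that $V^*\varphi$ is finite and continuous on $\Omega$ for every $\varphi\in C_c^+(\Omega)$. -/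

import Mathlib

open Set Filter Topology MeasureTheory ProbabilityTheory TopologicalSpace

noncomputable section

namespace Biharmonic

/-! ### Lower semicontinuous regularization and upper integral -/

section General

variable {X : Type*} [TopologicalSpace X]

/-- The lower semicontinuous regularization `f̂ (x) = liminf_{y → x} f y`
(the point `x` itself is allowed). -/
def lscReg (f : X → EReal) (x : X) : EReal := liminf f (𝓝 x)

/-- The upper integral of an extended real function that is bounded below and measurable
on the support of the finite measure `ρ`, for instance of a lower semicontinuous function with
values in `]-∞, +∞]` on a compact set that carries `ρ`. -/
def upperIntegral [MeasurableSpace X] (ρ : Measure X) (u : X → EReal) : EReal :=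
  ((∫⁻ y, (u y).toENNReal ∂ρ : ENNReal) : EReal) - ((∫⁻ y, (-u y).toENNReal ∂ρ : ENNReal) : EReal)

/-- A real function regarded as an extended real function. -/
def toE (f : X → ℝ) : X → EReal := fun x => (f x : EReal)

/-! ### Harmonic spaces

A sheaf of real functions is given by the sets `𝓚 U` of the sections over the open sets `U`.
Sections are written as functions on the whole space of which only the values on `U` matter. -/

/-- `𝓚` is a sheaf of vector spaces of continuous real functions. -/
structure IsFunctionSheaf (𝓚 : Opens X → Set (X → ℝ)) : Prop where
  congr : ∀ (U : Opens X) (f g : X → ℝ), EqOn f g U → f ∈ 𝓚 U → g ∈ 𝓚 U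
  continuousOn : ∀ (U : Opens X), ∀ f ∈ 𝓚 U, ContinuousOn f U
  zero_mem : ∀ U : Opens X, (fun _ => 0) ∈ 𝓚 U
  add_mem : ∀ (U : Opens X), ∀ f ∈ 𝓚 U, ∀ g ∈ 𝓚 U, (fun x => f x + g x) ∈ 𝓚 U
  smul_mem : ∀ (U : Opens X) (c : ℝ), ∀ f ∈ 𝓚 U, (fun x => c * f x) ∈ 𝓚 U
  restrict : ∀ U V : Opens X, U ≤ V → 𝓚 V ⊆ 𝓚 U
  glue : ∀ (𝒮 : Set (Opens X)) (f : X → ℝ), (∀ U ∈ 𝒮, f ∈ 𝓚 U) → f ∈ 𝓚 (sSup 𝒮)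

/-- `h` solves the Dirichlet problem in `ω` for the boundary data `f`. -/
def IsDirichletSolution (𝓚 : Opens X → Set (X → ℝ)) (ω : Opens X) (f h : X → ℝ) : Prop :=
  h ∈ 𝓚 ω ∧ ∀ y ∈ frontier (ω : Set X), Tendsto h (𝓝[(ω : Set X)] y) (𝓝 (f y))

/-- Regular (relatively compact) open sets of a sheaf of functions. -/
def IsRegular (𝓚 : Opens X → Set (X → ℝ)) (ω : Opens X) : Prop :=
  IsCompact (closure (ω : Set X)) ∧
  ∀ f : X → ℝ, ContinuousOn f (frontier (ω : Set X)) →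
    ∃ h, IsDirichletSolution 𝓚 ω f h ∧
      ((∀ y ∈ frontier (ω : Set X), 0 ≤ f y) → ∀ x ∈ ω, 0 ≤ h x) ∧
      ∀ h', IsDirichletSolution 𝓚 ω f h' → EqOn h' h ω

/-- `ρ` is the harmonic measure of the regular open set `ω` at the point `x`. -/
def IsHarmonicMeasure [MeasurableSpace X] (𝓚 : Opens X → Set (X → ℝ)) (ω : Opens X) (x : X)
    (ρ : Measure X) : Prop :=
  IsFiniteMeasure ρ ∧ ρ (frontier (ω : Set X))ᶜ = 0 ∧
  ∀ f h : X → ℝ, ContinuousOn f (frontier (ω : Set X)) → IsDirichletSolution 𝓚 ω f h →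
    h x = ∫ y in frontier (ω : Set X), f y ∂ρ

/-- Hyperharmonic functions on the open set `U`. -/
structure IsHyperharmonic [MeasurableSpace X] (𝓚 : Opens X → Set (X → ℝ)) (U : Opens X)
    (u : X → EReal) : Prop where
  lsc : LowerSemicontinuousOn u U
  ne_bot : ∀ x ∈ U, u x ≠ ⊥
  mean_le : ∀ ω : Opens X, IsRegular 𝓚 ω → closure (ω : Set X) ⊆ U → ∀ x ∈ ω,
    ∀ ρ : Measure X, IsHarmonicMeasure 𝓚 ω x ρ → upperIntegral ρ u ≤ u x

/-- Superharmonic functions: hyperharmonic functions that are finite on a dense subset. -/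
def IsSuperharmonic [MeasurableSpace X] (𝓚 : Opens X → Set (X → ℝ)) (U : Opens X)
    (u : X → EReal) : Prop :=
  IsHyperharmonic 𝓚 U u ∧ (U : Set X) ⊆ closure {x | x ∈ U ∧ u x ≠ ⊤}

/-- Bauer harmonic spaces: a sheaf with a base of regular sets, the convergence property of Bauer,
positivity, and local linear separation of points by nonnegative hyperharmonic functions. -/
structure IsBauerHarmonicSpace [MeasurableSpace X] (𝓚 : Opens X → Set (X → ℝ)) : Prop where
  locallyCompact : LocallyCompactSpace X
  hausdorff : T2Space X
  countableBase : SecondCountableTopology X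
  sheaf : IsFunctionSheaf 𝓚
  base : IsTopologicalBasis {s : Set X | ∃ ω : Opens X, (ω : Set X) = s ∧ IsRegular 𝓚 ω}
  convergence : ∀ (U : Opens X) (h : ℕ → X → ℝ) (g : X → ℝ), (∀ n, h n ∈ 𝓚 U) →
    (∀ x ∈ U, Monotone fun n => h n x) →
    (∀ x ∈ U, ∃ W ∈ 𝓝 x, ∃ M : ℝ, ∀ y ∈ W, y ∈ U → ∀ n, h n y ≤ M) →
    (∀ x ∈ U, Tendsto (fun n => h n x) atTop (𝓝 (g x))) → g ∈ 𝓚 U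
  positivity : ∀ x : X, ∃ U : Opens X, x ∈ U ∧ ∃ h ∈ 𝓚 U, h x ≠ 0
  separation : ∀ x₀ : X, ∃ U : Opens X, x₀ ∈ U ∧ ∀ x ∈ U, ∀ y ∈ U, x ≠ y →
    ∃ u v : X → EReal, IsHyperharmonic 𝓚 U u ∧ (∀ z ∈ U, 0 ≤ u z) ∧
      IsHyperharmonic 𝓚 U v ∧ (∀ z ∈ U, 0 ≤ v z) ∧ u x * v y ≠ u y * v x

/-- Brelot harmonic spaces: a sheaf on a connected, locally connected, noncompact, locally compact
space with a base of regular domains, such that the upper envelope of an upward directed family of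
harmonic functions on a domain is harmonic or identically `+∞`. -/
structure IsBrelotHarmonicSpace (𝓚 : Opens X → Set (X → ℝ)) : Prop where
  locallyCompact : LocallyCompactSpace X
  hausdorff : T2Space X
  countableBase : SecondCountableTopology X
  connected : ConnectedSpace X
  locallyConnected : LocallyConnectedSpace X
  noncompact : NoncompactSpace X
  sheaf : IsFunctionSheaf 𝓚
  base : IsTopologicalBasis
    {s : Set X | ∃ ω : Opens X, (ω : Set X) = s ∧ IsRegular 𝓚 ω ∧ IsConnected (ω : Set X)}
  convergence : ∀ U : Opens X, IsConnected (U : Set X) → ∀ S : Set (X → ℝ), S ⊆ 𝓚 U → S.Nonempty →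
    DirectedOn (fun f g : X → ℝ => ∀ x ∈ U, f x ≤ g x) S →
    (∀ x ∈ U, ⨆ f ∈ S, (f x : EReal) = ⊤) ∨
      ∃ h ∈ 𝓚 U, ∀ x ∈ U, ⨆ f ∈ S, (f x : EReal) = (h x : EReal)

/-- The extended real function `u` is harmonic on `U`. -/
def IsHarmonicOn (𝓚 : Opens X → Set (X → ℝ)) (U : Opens X) (u : X → EReal) : Prop :=
  ∃ h ∈ 𝓚 U, ∀ x ∈ U, u x = (h x : EReal)

/-- The harmonic support: the complement of the greatest open set on which `u` is harmonic. -/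
def harmonicSupport (𝓚 : Opens X → Set (X → ℝ)) (u : X → EReal) : Set X :=
  {x | ∀ U : Opens X, x ∈ U → ¬ IsHarmonicOn 𝓚 U u}

/-- The cone of nonnegative superharmonic functions on the whole space. -/
def posSuperharmonic [MeasurableSpace X] (𝓚 : Opens X → Set (X → ℝ)) : Set (X → EReal) :=
  {u | IsSuperharmonic 𝓚 ⊤ u ∧ ∀ x, 0 ≤ u x}

/-- Potentials on the whole space. -/
def IsPotential [MeasurableSpace X] (𝓚 : Opens X → Set (X → ℝ)) (p : X → EReal) : Prop :=
  p ∈ posSuperharmonic 𝓚 ∧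
  ∀ h ∈ 𝓚 ⊤, (∀ x, 0 ≤ h x) → (∀ x, (h x : EReal) ≤ p x) → ∀ x, h x = 0

/-- Green harmonic spaces: Brelot spaces in which the potentials with the same one-point harmonic
support are proportional. -/
def IsGreenHarmonicSpace [MeasurableSpace X] (𝓚 : Opens X → Set (X → ℝ)) : Prop :=
  IsBrelotHarmonicSpace 𝓚 ∧
  ∀ (y : X) (p p' : X → EReal), IsPotential 𝓚 p → IsPotential 𝓚 p' →
    harmonicSupport 𝓚 p = {y} → harmonicSupport 𝓚 p' = {y} →
    ∃ c : ℝ, 0 < c ∧ ∀ x, p' x = (c : EReal) * p x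

/-- The swept-out function (regularized reduced function) of `v` on `A`. -/
def sweptOut [MeasurableSpace X] (𝓚 : Opens X → Set (X → ℝ)) (A : Set X) (v : X → EReal) :
    X → EReal :=
  lscReg fun x => ⨅ u ∈ {u : X → EReal | IsHyperharmonic 𝓚 ⊤ u ∧ (∀ z, 0 ≤ u z) ∧
    ∀ z ∈ A, v z ≤ u z}, u x

/-- Completely determining open sets: every potential that is harmonic on `ω` is swept out to
itself on the complement of `ω`. -/
def IsCompletelyDetermining [MeasurableSpace X] (𝓚 : Opens X → Set (X → ℝ)) (ω : Opens X) : Prop :=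
  ∀ p : X → EReal, IsPotential 𝓚 p → IsHarmonicOn 𝓚 ω p → sweptOut 𝓚 (ω : Set X)ᶜ p = p

/-- The topology of R.-M. Hervé on the cone of nonnegative superharmonic functions: the coarsest one
for which `u ↦ ∫ u dρ` is continuous for every harmonic measure `ρ` of a completely determining
regular domain. -/
@[reducible] def herveTopology [MeasurableSpace X] (𝓚 : Opens X → Set (X → ℝ)) :
    TopologicalSpace (posSuperharmonic 𝓚) :=
  ⨅ ρ ∈ {ρ : Measure X | ∃ (ω : Opens X) (x : X), IsRegular 𝓚 ω ∧ IsConnected (ω : Set X) ∧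
      IsCompletelyDetermining 𝓚 ω ∧ x ∈ ω ∧ IsHarmonicMeasure 𝓚 ω x ρ},
    TopologicalSpace.induced
      (fun u : posSuperharmonic 𝓚 => ∫⁻ y, ((u : X → EReal) y).toENNReal ∂ρ) inferInstance

/-- `y ↦ p y` is a continuous map into the cone of nonnegative superharmonic functions, with the
topology of R.-M. Hervé, and each `p y` is a potential of harmonic support `{y}`. The associated
Green kernel is `G (x, y) = p y x`. -/
def IsGreenFamily [MeasurableSpace X] (𝓚 : Opens X → Set (X → ℝ)) (p : X → X → EReal) : Prop :=
  (∀ y, IsPotential 𝓚 (p y) ∧ harmonicSupport 𝓚 (p y) = {y}) ∧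
  ∃ hp : ∀ y, p y ∈ posSuperharmonic 𝓚,
    Continuous[inferInstance, herveTopology 𝓚] fun y => (⟨p y, hp y⟩ : posSuperharmonic 𝓚)

/-- Symmetric Green harmonic spaces. -/
def IsSymmetricGreenHarmonicSpace [MeasurableSpace X] (𝓚 : Opens X → Set (X → ℝ)) : Prop :=
  IsGreenHarmonicSpace 𝓚 ∧ ∃ p : X → X → EReal, IsGreenFamily 𝓚 p ∧ ∀ x y, p y x = p x y

/-! ### Biharmonic spaces -/

/-- `𝓗` is a sheaf of vector spaces of pairs of continuous real functions that is compatible: if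
`(u, v)` is a section and `u` vanishes on an open set, so does `v`. -/
structure IsPairSheaf (𝓗 : Opens X → Set ((X → ℝ) × (X → ℝ))) : Prop where
  congr : ∀ (U : Opens X) (a b : (X → ℝ) × (X → ℝ)), EqOn a.1 b.1 U → EqOn a.2 b.2 U →
    a ∈ 𝓗 U → b ∈ 𝓗 U
  continuousOn : ∀ (U : Opens X), ∀ a ∈ 𝓗 U, ContinuousOn a.1 U ∧ ContinuousOn a.2 U
  zero_mem : ∀ U : Opens X, 0 ∈ 𝓗 U
  add_mem : ∀ (U : Opens X), ∀ a ∈ 𝓗 U, ∀ b ∈ 𝓗 U, a + b ∈ 𝓗 U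
  smul_mem : ∀ (U : Opens X) (c : ℝ), ∀ a ∈ 𝓗 U, c • a ∈ 𝓗 U
  restrict : ∀ U V : Opens X, U ≤ V → 𝓗 V ⊆ 𝓗 U
  glue : ∀ (𝒮 : Set (Opens X)) (a : (X → ℝ) × (X → ℝ)), (∀ U ∈ 𝒮, a ∈ 𝓗 U) → a ∈ 𝓗 (sSup 𝒮)
  compatible : ∀ (U ω : Opens X), ω ≤ U → ∀ a ∈ 𝓗 U, (∀ x ∈ ω, a.1 x = 0) → ∀ x ∈ ω, a.2 x = 0

/-- `(u, v)` solves the Riquier problem in `ω` for the boundary data `(f, g)`. -/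
def IsRiquierSolution (𝓗 : Opens X → Set ((X → ℝ) × (X → ℝ))) (ω : Opens X)
    (f g u v : X → ℝ) : Prop :=
  (u, v) ∈ 𝓗 ω ∧ ∀ y ∈ frontier (ω : Set X),
    Tendsto u (𝓝[(ω : Set X)] y) (𝓝 (f y)) ∧ Tendsto v (𝓝[(ω : Set X)] y) (𝓝 (g y))

/-- Regular (relatively compact) open sets of a sheaf of pairs. -/
def IsPairRegular (𝓗 : Opens X → Set ((X → ℝ) × (X → ℝ))) (ω : Opens X) : Prop :=
  IsCompact (closure (ω : Set X)) ∧
  ∀ f g : X → ℝ, ContinuousOn f (frontier (ω : Set X)) → ContinuousOn g (frontier (ω : Set X)) →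
    ∃ u v, IsRiquierSolution 𝓗 ω f g u v ∧
      ((∀ y ∈ frontier (ω : Set X), 0 ≤ f y ∧ 0 ≤ g y) → ∀ x ∈ ω, 0 ≤ u x ∧ 0 ≤ v x) ∧
      ∀ u' v', IsRiquierSolution 𝓗 ω f g u' v' → EqOn u' u ω ∧ EqOn v' v ω

variable [MeasurableSpace X]

/-- `(μ, ν, lam)` is the triple of biharmonic measures of the regular open set `ω` at `x`. -/
def IsBiharmonicMeasures (𝓗 : Opens X → Set ((X → ℝ) × (X → ℝ))) (ω : Opens X) (x : X)
    (μ ν lam : Measure X) : Prop :=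
  (IsFiniteMeasure μ ∧ IsFiniteMeasure ν ∧ IsFiniteMeasure lam) ∧
  (μ (frontier (ω : Set X))ᶜ = 0 ∧ ν (frontier (ω : Set X))ᶜ = 0 ∧
    lam (frontier (ω : Set X))ᶜ = 0) ∧
  ∀ f g u v : X → ℝ, ContinuousOn f (frontier (ω : Set X)) →
    ContinuousOn g (frontier (ω : Set X)) → IsRiquierSolution 𝓗 ω f g u v →
    u x = (∫ y in frontier (ω : Set X), f y ∂μ) + ∫ y in frontier (ω : Set X), g y ∂ν ∧
    v x = ∫ y in frontier (ω : Set X), g y ∂lam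

/-- Hyperharmonic pairs on the open set `U`. -/
structure IsHyperharmonicPair (𝓗 : Opens X → Set ((X → ℝ) × (X → ℝ))) (U : Opens X)
    (u v : X → EReal) : Prop where
  lsc_fst : LowerSemicontinuousOn u U
  lsc_snd : LowerSemicontinuousOn v U
  ne_bot_fst : ∀ x ∈ U, u x ≠ ⊥
  ne_bot_snd : ∀ x ∈ U, v x ≠ ⊥
  mean_le : ∀ ω : Opens X, IsPairRegular 𝓗 ω → closure (ω : Set X) ⊆ U → ∀ x ∈ ω,
    ∀ μ ν lam : Measure X, IsBiharmonicMeasures 𝓗 ω x μ ν lam →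
      upperIntegral μ u + upperIntegral ν v ≤ u x ∧ upperIntegral lam v ≤ v x

/-- The cone `𝓗₁* (U)`. -/
def hyper₁ (𝓗 : Opens X → Set ((X → ℝ) × (X → ℝ))) (U : Opens X) : Set (X → EReal) :=
  {u | IsHyperharmonicPair 𝓗 U u fun _ => 0}

/-- The cone `𝓗₂* (U)`. -/
def hyper₂ (𝓗 : Opens X → Set ((X → ℝ) × (X → ℝ))) (U : Opens X) : Set (X → EReal) :=
  {v | IsHyperharmonicPair 𝓗 U (fun _ => ⊤) v}

/-- The first associated sheaf `𝓗₁ (U) = 𝓗₁* (U) ∩ (-𝓗₁* (U))`. -/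
def assoc₁ (𝓗 : Opens X → Set ((X → ℝ) × (X → ℝ))) (U : Opens X) : Set (X → ℝ) :=
  {u | toE u ∈ hyper₁ 𝓗 U ∧ toE (-u) ∈ hyper₁ 𝓗 U}

/-- The second associated sheaf `𝓗₂ (U) = 𝓗₂* (U) ∩ (-𝓗₂* (U))`. -/
def assoc₂ (𝓗 : Opens X → Set ((X → ℝ) × (X → ℝ))) (U : Opens X) : Set (X → ℝ) :=
  {v | toE v ∈ hyper₂ 𝓗 U ∧ toE (-v) ∈ hyper₂ 𝓗 U}

/-- Biharmonic spaces. -/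
structure IsBiharmonicSpace (𝓗 : Opens X → Set ((X → ℝ) × (X → ℝ))) : Prop where
  locallyCompact : LocallyCompactSpace X
  hausdorff : T2Space X
  countableBase : SecondCountableTopology X
  sheaf : IsPairSheaf 𝓗
  base : IsTopologicalBasis {s : Set X | ∃ ω : Opens X, (ω : Set X) = s ∧ IsPairRegular 𝓗 ω}
  bauer₁ : IsBauerHarmonicSpace (assoc₁ 𝓗)
  bauer₂ : IsBauerHarmonicSpace (assoc₂ 𝓗)

/-- Brelot biharmonic spaces (the topological conditions on the space are part of
`IsBrelotHarmonicSpace`). -/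
def IsBrelotBiharmonicSpace (𝓗 : Opens X → Set ((X → ℝ) × (X → ℝ))) : Prop :=
  IsBiharmonicSpace 𝓗 ∧ IsBrelotHarmonicSpace (assoc₁ 𝓗) ∧ IsBrelotHarmonicSpace (assoc₂ 𝓗)

/-- Green biharmonic spaces. -/
def IsGreenBiharmonicSpace (𝓗 : Opens X → Set ((X → ℝ) × (X → ℝ))) : Prop :=
  IsBiharmonicSpace 𝓗 ∧ IsGreenHarmonicSpace (assoc₁ 𝓗) ∧ IsGreenHarmonicSpace (assoc₂ 𝓗)

/-- Nonnegative superharmonic pairs on the whole space. -/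
def IsPosSuperharmonicPair (𝓗 : Opens X → Set ((X → ℝ) × (X → ℝ))) (u v : X → EReal) : Prop :=
  IsHyperharmonicPair 𝓗 ⊤ u v ∧ Dense {x | u x ≠ ⊤} ∧ ∀ x, 0 ≤ u x ∧ 0 ≤ v x

/-- `𝓗`-potentials. -/
def IsPairPotential (𝓗 : Opens X → Set ((X → ℝ) × (X → ℝ))) (p q : X → EReal) : Prop :=
  IsPosSuperharmonicPair 𝓗 p q ∧
  ∀ h k : X → ℝ, (h, k) ∈ 𝓗 ⊤ → (∀ x, 0 ≤ h x ∧ 0 ≤ k x) →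
    (∀ x, (h x : EReal) ≤ p x ∧ (k x : EReal) ≤ q x) → ∀ x, h x = 0 ∧ k x = 0

/-- Strong biharmonic spaces: there is a potential `(p, q) > 0`. -/
def IsStrong (𝓗 : Opens X → Set ((X → ℝ) × (X → ℝ))) : Prop :=
  ∃ p q : X → EReal, IsPairPotential 𝓗 p q ∧ ∀ x, 0 < p x ∧ 0 < q x

/-- The biharmonic support: the complement of the greatest open set on which `(u, v)` is a
biharmonic pair. -/
def biharmonicSupport (𝓗 : Opens X → Set ((X → ℝ) × (X → ℝ))) (u v : X → EReal) : Set X :=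
  {x | ∀ U : Opens X, x ∈ U →
    ¬ ∃ a ∈ 𝓗 U, ∀ z ∈ U, u z = (a.1 z : EReal) ∧ v z = (a.2 z : EReal)}

/-- The pure hyperharmonic function of order 2 associated with `v`: the lower semicontinuous
regularization of the infimum of all `u ∈ 𝓗₁*⁺` such that `(u, v)` is hyperharmonic. -/
def pureFn (𝓗 : Opens X → Set ((X → ℝ) × (X → ℝ))) (v : X → EReal) : X → EReal :=
  lscReg fun x => ⨅ u ∈ {u : X → EReal | u ∈ hyper₁ 𝓗 ⊤ ∧ (∀ z, 0 ≤ u z) ∧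
    IsHyperharmonicPair 𝓗 ⊤ u v}, u x

/-- Pure (nonnegative hyperharmonic) pairs. -/
def IsPurePair (𝓗 : Opens X → Set ((X → ℝ) × (X → ℝ))) (u v : X → EReal) : Prop :=
  IsHyperharmonicPair 𝓗 ⊤ u v ∧ (∀ x, 0 ≤ u x ∧ 0 ≤ v x) ∧ u = pureFn 𝓗 v

/-- The biharmonic Green kernel `H (x, y) = pureFn 𝓗 (q y) x` exists: for a Green kernel
`(x, y) ↦ q y x` of the second harmonic space, all the pure functions of order 2 associated with
the `q y` are superharmonic in the first harmonic space. -/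
def HasBiharmonicGreenKernel (𝓗 : Opens X → Set ((X → ℝ) × (X → ℝ))) : Prop :=
  ∃ q : X → X → EReal, IsGreenFamily (assoc₂ 𝓗) q ∧
    ∀ y, IsSuperharmonic (assoc₁ 𝓗) ⊤ (pureFn 𝓗 (q y))

/-- The sheaf of the pairs `(h, k)` such that `(P h, Q k)` is biharmonic. -/
def quotientSheaf (𝓗 : Opens X → Set ((X → ℝ) × (X → ℝ))) (P Q : X → ℝ) (U : Opens X) :
    Set ((X → ℝ) × (X → ℝ)) :=
  {a | ContinuousOn a.1 U ∧ ContinuousOn a.2 U ∧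
    ((fun x => P x * a.1 x, fun x => Q x * a.2 x) : (X → ℝ) × (X → ℝ)) ∈ 𝓗 U}

/-- `V` is the coupling kernel of the biharmonic space. -/
def IsCouplingKernel (𝓗 : Opens X → Set ((X → ℝ) × (X → ℝ))) (V : Kernel X X) : Prop :=
  (∀ φ : X → ℝ, Continuous φ → HasCompactSupport φ → (∀ x, 0 ≤ φ x) →
    IsPotential (assoc₁ 𝓗) (fun x => ((∫⁻ y, ENNReal.ofReal (φ y) ∂(V x) : ENNReal) : EReal)) ∧
    ∀ U : Opens X, (U : Set X) = (tsupport φ)ᶜ →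
      IsHarmonicOn (assoc₁ 𝓗) U
        (fun x => ((∫⁻ y, ENNReal.ofReal (φ y) ∂(V x) : ENNReal) : EReal))) ∧
  ∀ v ∈ hyper₂ 𝓗 ⊤, (∀ x, 0 ≤ v x) →
    pureFn 𝓗 v = fun x => ((∫⁻ y, (v y).toENNReal ∂(V x) : ENNReal) : EReal)

/-- The measure `μ` represents the function `w` by means of the potentials `p y`:
`w = ∫ p y dμ(y)`. -/
def Represents (p : X → X → EReal) (μ : Measure X) (w : X → EReal) : Prop :=
  ∀ x, w x = ((∫⁻ y, (p y x).toENNReal ∂μ : ENNReal) : EReal)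

/-- The adjoint kernel `V* f (x) = ∫ q x (y) f (y) dμ(y)`. -/
def adjointKernel (q : X → X → EReal) (μ : Measure X) (f : X → ENNReal) (x : X) : ENNReal :=
  ∫⁻ y, (q x y).toENNReal * f y ∂μ

/-- The condition that `V* φ` is finite and continuous for every nonnegative continuous `φ` with
compact support. -/
def AdjointRegular (q : X → X → EReal) (μ : Measure X) : Prop :=
  ∀ φ : X → ℝ, Continuous φ → HasCompactSupport φ → (∀ x, 0 ≤ φ x) →
    (∀ x, adjointKernel q μ (fun y => ENNReal.ofReal (φ y)) x ≠ ⊤) ∧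
    Continuous (adjointKernel q μ fun y => ENNReal.ofReal (φ y))

end General

/-! ### The space `[0, 1[` -/

/-- The space `Ω = [0, 1[`. -/
abbrev Om : Type := Set.Ico (0 : ℝ) 1

/-- The point `0` of `Ω`. -/
def zeroOm : Om := ⟨0, by norm_num, by norm_num⟩

/-- A function on `Ω`, extended by `0` to the real line. -/
def extendOm (u : Om → ℝ) : ℝ → ℝ := Function.extend Subtype.val u 0

/-- `u` is of class `C²` on the open subset `ω` of `Ω` (one-sided at the point `0`). -/
def IsC2On (u : Om → ℝ) (ω : Opens Om) : Prop :=
  ContDiffOn ℝ 2 (extendOm u) (Subtype.val '' (ω : Set Om))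

/-- The second derivative of `x ↦ x u(x)` on `ω` (one-sided at the point `0`). -/
def secondDeriv (u : Om → ℝ) (ω : Opens Om) (x : Om) : ℝ :=
  iteratedDerivWithin 2 (fun t => t * extendOm u t) (Subtype.val '' (ω : Set Om)) (x : ℝ)

/-- `𝓗₁ (ω)`: the functions of class `C²` with `(x u)'' = 0`. -/
def exH₁ (ω : Opens Om) : Set (Om → ℝ) :=
  {u | IsC2On u ω ∧ ∀ x ∈ ω, secondDeriv u ω x = 0}

/-- `𝓗₂ (ω)`: the continuous functions equal to some `a / x² + b` on each connected component
of `ω` (by continuity they are constant on the component of `0`, if `0 ∈ ω`). -/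
def exH₂ (ω : Opens Om) : Set (Om → ℝ) :=
  {v | ContinuousOn v ω ∧ ∀ x ∈ ω, ∃ a b : ℝ, ∀ y ∈ connectedComponentIn (ω : Set Om) x,
    0 < (y : ℝ) → v y = a / (y : ℝ) ^ 2 + b}

/-- `𝓗 (ω)`: the pairs of class `C²` with `(x u)'' = -v` and `v ∈ 𝓗₂ (ω)`. -/
def exH (ω : Opens Om) : Set ((Om → ℝ) × (Om → ℝ)) :=
  {a | IsC2On a.1 ω ∧ IsC2On a.2 ω ∧ (∀ x ∈ ω, secondDeriv a.1 ω x = -a.2 x) ∧ a.2 ∈ exH₂ ω}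

/-- `1 / t` with the convention `1 / 0 = +∞`. -/
def invTop (t : ℝ) : EReal := if t = 0 then ⊤ else ((1 / t : ℝ) : EReal)

/-- The potentials `p_y`. -/
def exGreen₁ (y x : Om) : EReal := if x ≤ y then invTop y - 1 else invTop x - 1

/-- The potentials `q_y`. -/
def exGreen₂ (y x : Om) : EReal :=
  if x ≤ y then invTop ((y : ℝ) ^ 2) - 1 else invTop ((x : ℝ) ^ 2) - 1

/-- The function `p(x) = 1/2 - x/2`. -/
def exP (x : Om) : ℝ := 1 / 2 - (x : ℝ) / 2

/-- The function `q(x) = min (1, 1/x² - 1)`, with the value `1` at `0`. -/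
def exQ (x : Om) : ℝ := if (x : ℝ) = 0 then 1 else min 1 (1 / (x : ℝ) ^ 2 - 1)

/-- The measure `y dy` on `[0, 1[`. -/
def exμ : Measure Om :=
  (Measure.comap Subtype.val (volume : Measure ℝ)).withDensity fun y => ENNReal.ofReal (y : ℝ)

end Biharmonic

end

noncomputable section

namespace Biharmonic

/-! ### The topology of `[0, 1[` -/

/-! Everything reduces to formulas in one variable. On an interval the sections of both associated
sheaves are affine functions α + β s of a scale s, with s = 1/x for the first sheaf and s = 1/x² for
the second; on an interval containing 0 one must have β = 0, since s is unbounded there. The spaces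
𝓗 and 𝓗' are treated together: `wSheaf s w` divides such functions by a positive continuous w, and
all results on pairs are proved for `quotientSheaf exH P Q`, of which 𝓗 is the case P = Q = 1.

The components of a regular set are [0, b[ and ]a, b[ with a > 0, so harmonic measures are carried
by one or two points. Hence u is hyperharmonic if and only if w u satisfies elementary inequalities
on intervals (`isHyperharmonic_wSheaf_iff`): on Ω it is decreasing, and it is concave as a function
of s. The Green function s (max x y) - 1, the Harnack inequality and the proportionality of
potentials (`eq_mul_green_of_support`) follow from this. For pairs, (x u)'' = -v with v = a/x² + b
integrates to x u = a log x - b x²/2 + α x + β (`mem_exH_iff`); the Riquier problem is solved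
explicitly on the same intervals, which leads to `isHyperharmonicPair_iff`.

The core is `pureFn_quotient`: P times the pure function of v is ∫ p_y(x) Q(y) v(y) y dy. Indeed x y
p_y(x) = min(x,y) (1 - max(x,y)) is the Green function of -z'' on ]0,1[, so x times the integral
solves -z'' = Q v. That the integral is admissible is `hypPair_pot`; that it is the least admissible
function is a minimum principle, `potR_le_of_hypPair`, proved for bounded functions and extended by
truncation.

The counterexample is a divergence. A potential of support {0} is a multiple of q_0 / Q, and q_0(y)
grows like 1/y², while p_y(x) is bounded below by a positive constant for small y. Against y dy this
leaves ∫ dy/y, which diverges at 0 for every x. If a pure pair had biharmonic support {0}, then Q v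
= α + β/x² off 0 with β ≥ 0: for β > 0 the first component is infinite, and for β = 0 the pair is
biharmonic across 0. The same integral gives V*φ(0) = +∞. Uniqueness of the coupling kernel and of
the representing measure comes from `eq_of_green`: Green potentials determine a finite measure. -/

theorem isPreconnected_of_ordConnected {A : Set Om} (h : A.OrdConnected) : IsPreconnected A := by
  rw [← IsInducing.subtypeVal.isPreconnected_image]
  refine Set.OrdConnected.isPreconnected ⟨?_⟩
  rintro _ ⟨x, hx, rfl⟩ _ ⟨y, hy, rfl⟩ z hz
  exact ⟨⟨z, x.2.1.trans hz.1, hz.2.trans_lt y.2.2⟩, h.out hx hy ⟨hz.1, hz.2⟩, rfl⟩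

theorem Om.exists_between {a b : Om} (h : a < b) : ∃ c : Om, a < c ∧ c < b := by
  have h' : (a : ℝ) < b := h
  refine ⟨⟨((a : ℝ) + b) / 2, ?_, ?_⟩, ?_, ?_⟩
  · linarith [a.2.1, b.2.1]
  · linarith [b.2.2]
  · show (a : ℝ) < ((a : ℝ) + b) / 2
    linarith
  · show ((a : ℝ) + b) / 2 < b
    linarith

theorem Om.exists_gt (a : Om) : ∃ c : Om, a < c := by
  refine ⟨⟨((a : ℝ) + 1) / 2, ?_, ?_⟩, ?_⟩
  · linarith [a.2.1]
  · linarith [a.2.2]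
  · show (a : ℝ) < ((a : ℝ) + 1) / 2
    linarith [a.2.2]

instance : DenselyOrdered Om := ⟨fun _ _ h => Om.exists_between h⟩

instance : NoMaxOrder Om := ⟨fun a => Om.exists_gt a⟩

theorem zeroOm_le (x : Om) : zeroOm ≤ x := x.2.1

theorem zeroOm_lt_iff {x : Om} : zeroOm < x ↔ 0 < (x : ℝ) := Iff.rfl

theorem Om.pos_of_lt {a b : Om} (h : a < b) : 0 < (b : ℝ) := lt_of_le_of_lt a.2.1 h

theorem Om.eq_zero_of_not_pos {x : Om} (h : ¬ 0 < (x : ℝ)) : x = zeroOm :=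
  Subtype.ext (le_antisymm (not_lt.mp h) x.2.1)

theorem Om.eq_zero_or_pos (x : Om) : x = zeroOm ∨ 0 < (x : ℝ) := by
  by_cases h : 0 < (x : ℝ)
  · exact Or.inr h
  · exact Or.inl (Om.eq_zero_of_not_pos h)

/-- The point 0 is an end of Ω, so its neighbourhoods are one-sided. This is the source of the two
kinds of test intervals used throughout: [0, b[ at 0 and ]a, b[ with a > 0 elsewhere. -/
theorem nhds_zeroOm_basis {s : Set Om} (hs : s ∈ 𝓝 zeroOm) :
    ∃ b : Om, 0 < (b : ℝ) ∧ Iic b ⊆ s := by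
  obtain ⟨l, hl, h⟩ := exists_Ico_subset_of_mem_nhds hs (Om.exists_gt zeroOm)
  obtain ⟨b, hb, hbl⟩ := Om.exists_between hl
  exact ⟨b, hb, fun y hy => h ⟨zeroOm_le y, lt_of_le_of_lt hy hbl⟩⟩

theorem nhds_pos_basis {x : Om} (hx : 0 < (x : ℝ)) {s : Set Om} (hs : s ∈ 𝓝 x) :
    ∃ a b : Om, 0 < (a : ℝ) ∧ a < x ∧ x < b ∧ Icc a b ⊆ s := by
  obtain ⟨l, u, hxlu, h⟩ := (mem_nhds_iff_exists_Ioo_subset' ⟨zeroOm, hx⟩ (Om.exists_gt x)).mp hs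
  obtain ⟨a, ha, hax⟩ := Om.exists_between hxlu.1
  obtain ⟨b, hb, hbx⟩ := Om.exists_between hxlu.2
  exact ⟨a, b, Om.pos_of_lt ha, hax, hb,
    fun y hy => h ⟨lt_of_lt_of_le ha hy.1, lt_of_le_of_lt hy.2 hbx⟩⟩

theorem exists_right_subset_of_mem_nhds {x : Om} {s : Set Om} (hs : s ∈ 𝓝 x) :
    ∃ b : Om, x < b ∧ Icc x b ⊆ s := by
  obtain ⟨l, hl, h⟩ := exists_Ico_subset_of_mem_nhds hs (Om.exists_gt x)
  obtain ⟨b, hb, hbl⟩ := Om.exists_between hl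
  exact ⟨b, hb, fun y hy => h ⟨hy.1, lt_of_le_of_lt hy.2 hbl⟩⟩

theorem Iic_mem_nhds_zero {b : Om} (hb : 0 < (b : ℝ)) : Iio b ∈ 𝓝 zeroOm :=
  Iio_mem_nhds (zeroOm_lt_iff.mpr hb)

theorem eventually_pos {x : Om} (hx : 0 < (x : ℝ)) : ∀ᶠ y : Om in 𝓝 x, 0 < (y : ℝ) :=
  Ioi_mem_nhds (zeroOm_lt_iff.mpr hx)

/-- A neighbourhood of a point contains two distinct positive points. -/
theorem exists_two_points {x : Om} {p : Om → Prop} (h : ∀ᶠ y in 𝓝 x, p y) :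
    ∃ y z : Om, 0 < (y : ℝ) ∧ y < z ∧ p y ∧ p z := by
  obtain ⟨b, hb, h⟩ := exists_right_subset_of_mem_nhds h
  obtain ⟨c, hc, hcb⟩ := Om.exists_between hb
  exact ⟨c, b, Om.pos_of_lt hc, hcb, h ⟨hc.le, hcb.le⟩, h ⟨hb.le, le_rfl⟩⟩

instance : NoncompactSpace Om := by
  refine ⟨fun h => ?_⟩
  obtain ⟨M, -, hM⟩ := h.exists_isMaxOn ⟨zeroOm, mem_univ _⟩ (continuous_id (X := Om)).continuousOn
  obtain ⟨c, hc⟩ := Om.exists_gt M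
  exact absurd (hM (mem_univ c)) (not_le.mpr hc)

instance : LocallyCompactSpace Om :=
  (isLocallyClosed_Ico (a := (0 : ℝ)) (b := 1)).locallyCompactSpace

instance : ConnectedSpace Om :=
  { isPreconnected_univ := isPreconnected_of_ordConnected ordConnected_univ
    toNonempty := ⟨zeroOm⟩ }

theorem isOpen_nbhd_interval {x : Om} {s : Set Om} (hs : s ∈ 𝓝 x) :
    ∃ V : Set Om, IsOpen V ∧ x ∈ V ∧ V ⊆ s ∧ V.OrdConnected := by
  rcases Om.eq_zero_or_pos x with rfl | hx
  · obtain ⟨b, hb, h⟩ := nhds_zeroOm_basis hs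
    exact ⟨Iio b, isOpen_Iio, hb, Iio_subset_Iic_self.trans h, ordConnected_Iio⟩
  · obtain ⟨a, b, ha, hax, hxb, h⟩ := nhds_pos_basis hx hs
    exact ⟨Ioo a b, isOpen_Ioo, ⟨hax, hxb⟩, Ioo_subset_Icc_self.trans h, ordConnected_Ioo⟩

instance : LocallyConnectedSpace Om := by
  refine locallyConnectedSpace_of_connected_bases (fun (_ : Om) (V : Set Om) => V)
    (fun x V => IsOpen V ∧ x ∈ V ∧ V.OrdConnected) (fun x => ⟨fun s => ⟨fun hs => ?_, ?_⟩⟩) ?_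
  · obtain ⟨V, h1, h2, h3, h4⟩ := isOpen_nbhd_interval hs
    exact ⟨V, ⟨h1, h2, h4⟩, h3⟩
  · rintro ⟨V, ⟨h1, h2, -⟩, h3⟩
    exact mem_of_superset (h1.mem_nhds h2) h3
  · rintro x V ⟨-, -, h⟩
    exact isPreconnected_of_ordConnected h

/-! ### Scales and weighted sheaves -/

/-- A scale: a continuous decreasing function on `]0, 1[` with limits `+∞` at `0` and `1` at `1`. -/
structure IsScale (s : Om → ℝ) : Prop where
  anti : ∀ x y : Om, 0 < (x : ℝ) → x < y → s y < s x
  cont : ∀ x : Om, 0 < (x : ℝ) → ContinuousAt s x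
  one_lt : ∀ x : Om, 0 < (x : ℝ) → 1 < s x
  exists_lt : ∀ c : ℝ, 1 < c → ∃ x : Om, 0 < (x : ℝ) ∧ s x < c
  tendsto_zero : Tendsto s (𝓝[>] zeroOm) atTop

/-- The scale `1 / x`. -/
def scale₁ (x : Om) : ℝ := 1 / (x : ℝ)

/-- The scale `1 / x²`. -/
def scale₂ (x : Om) : ℝ := 1 / (x : ℝ) ^ 2

theorem tendsto_val_zeroOm : Tendsto (fun x : Om => (x : ℝ)) (𝓝[>] zeroOm) (𝓝[>] (0 : ℝ)) := by
  refine tendsto_nhdsWithin_iff.mpr ⟨?_, ?_⟩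
  · exact (continuous_subtype_val.tendsto zeroOm).mono_left nhdsWithin_le_nhds
  · filter_upwards [self_mem_nhdsWithin] with x hx
    exact hx

theorem isScale_scale₁ : IsScale scale₁ where
  anti x y hx h := one_div_lt_one_div_of_lt hx h
  cont x hx := by
    unfold scale₁
    exact continuousAt_const.div continuous_subtype_val.continuousAt hx.ne'
  one_lt x hx := by
    rw [scale₁, lt_div_iff₀ hx]
    linarith [x.2.2]
  exists_lt c hc := by
    obtain ⟨d, hd, hdc⟩ := _root_.exists_between hc
    have hd0 : 0 < d := by linarith
    refine ⟨⟨1 / d, by positivity, ?_⟩, by positivity, ?_⟩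
    · rw [div_lt_one hd0]
      exact hd
    · simpa [scale₁] using hdc
  tendsto_zero := by
    have := tendsto_inv_nhdsGT_zero.comp tendsto_val_zeroOm
    exact this.congr fun x => (one_div _).symm

theorem isScale_scale₂ : IsScale scale₂ where
  anti x y hx h := by
    have h' : (x : ℝ) < y := h
    exact one_div_lt_one_div_of_lt (by positivity) (by gcongr)
  cont x hx := by
    unfold scale₂
    exact continuousAt_const.div (continuous_subtype_val.pow 2).continuousAt (by positivity)
  one_lt x hx := by
    rw [scale₂, lt_div_iff₀ (by positivity)]
    nlinarith [x.2.2]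
  exists_lt c hc := by
    obtain ⟨x, hx, h⟩ := isScale_scale₁.exists_lt (Real.sqrt c)
      (by rw [Real.lt_sqrt (by norm_num)]; linarith)
    refine ⟨x, hx, ?_⟩
    have : scale₂ x = scale₁ x ^ 2 := by simp [scale₁, scale₂]
    rw [this]
    have h0 : 0 ≤ scale₁ x := by rw [scale₁]; positivity
    have := Real.sq_sqrt (show 0 ≤ c by linarith)
    nlinarith [Real.sqrt_nonneg c]
  tendsto_zero := by
    have := (tendsto_pow_atTop (α := ℝ) (n := 2) (by norm_num)).comp
      (tendsto_inv_nhdsGT_zero.comp tendsto_val_zeroOm)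
    exact this.congr fun x => by simp [scale₂]

/-- The sheaf of the functions `u` such that locally `w u = α + β s`, with `β = 0` at `0`. -/
def wSheaf (s w : Om → ℝ) (U : Opens Om) : Set (Om → ℝ) :=
  {u | ∀ x ∈ U, ∃ α β : ℝ, ((x : ℝ) = 0 → β = 0) ∧ ∀ᶠ y in 𝓝 x, w y * u y = α + β * s y}

/-- A weight: a continuous positive function. -/
structure IsWeight (w : Om → ℝ) : Prop where
  cont : Continuous w
  pos : ∀ x, 0 < w x

theorem isWeight_one : IsWeight fun _ => 1 := ⟨continuous_const, fun _ => one_pos⟩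

section Sheaf

variable {s w : Om → ℝ}

/-- A scale takes different values at different positive points, so two values determine both
coefficients. -/
theorem IsScale.coef_unique (hs : IsScale s) {y z : Om} (hy : 0 < (y : ℝ)) (hyz : y < z)
    {α β α' β' : ℝ} (h1 : α + β * s y = α' + β' * s y) (h2 : α + β * s z = α' + β' * s z) :
    α = α' ∧ β = β' := by
  have h := hs.anti y z hy hyz
  have hβ : (β - β') * (s y - s z) = 0 := by linarith
  rcases mul_eq_zero.mp hβ with h3 | h3
  · have : β = β' := by linarith
    subst this
    exact ⟨by linarith, rfl⟩
  · linarith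

/-- The coefficients of a section do not vary on a connected set. -/
theorem exists_coef_of_isPreconnected (hs : IsScale s) {U : Opens Om} {u : Om → ℝ}
    (hu : u ∈ wSheaf s w U) {S : Set Om} (hS : IsPreconnected S) (hSU : S ⊆ U) :
    ∃ α β : ℝ, (∀ x ∈ S, (x : ℝ) = 0 → β = 0) ∧
      ∀ x ∈ S, ∀ᶠ y in 𝓝 x, w y * u y = α + β * s y := by
  rcases S.eq_empty_or_nonempty with rfl | ⟨x₀, hx₀⟩
  · exact ⟨0, 0, by simp, by simp⟩
  obtain ⟨α, β, -, hαβ⟩ := hu x₀ (hSU hx₀)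
  -- `A` and `B` collect the points near which the section has the coefficients found at `x₀`,
  -- respectively other ones. Both are open and they are disjoint by `coef_unique`, so the
  -- preconnected set `S` lies in `A`.
  set A : Set Om := {x | ∀ᶠ y in 𝓝 x, w y * u y = α + β * s y} with hA
  set B : Set Om := {x | ∃ α' β', ¬ (α' = α ∧ β' = β) ∧
    ∀ᶠ y in 𝓝 x, w y * u y = α' + β' * s y} with hB
  have hAo : IsOpen A := by
    rw [isOpen_iff_mem_nhds]
    exact fun x hx => eventually_eventually_nhds.mpr hx
  have hBo : IsOpen B := by
    rw [isOpen_iff_mem_nhds]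
    rintro x ⟨α', β', h1, h2⟩
    filter_upwards [eventually_eventually_nhds.mpr h2] with y hy
    exact ⟨α', β', h1, hy⟩
  have hAB : Disjoint A B := by
    rw [Set.disjoint_left]
    rintro x hx ⟨α', β', h1, h2⟩
    obtain ⟨y, z, hy, hyz, hpy, hpz⟩ := exists_two_points (hx.and h2)
    exact h1 (hs.coef_unique hy hyz (hpy.2.symm.trans hpy.1) (hpz.2.symm.trans hpz.1))
  have hcov : S ⊆ A ∪ B := by
    intro x hx
    obtain ⟨α', β', -, h⟩ := hu x (hSU hx)
    by_cases h1 : α' = α ∧ β' = β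
    · left
      rw [h1.1, h1.2] at h
      exact h
    · exact Or.inr ⟨α', β', h1, h⟩
  have hSA : S ⊆ A := hS.subset_left_of_subset_union hAo hBo hAB hcov ⟨x₀, hx₀, hαβ⟩
  refine ⟨α, β, fun x hx hx0 => ?_, hSA⟩
  -- If `S` contains 0, the local expression at 0 has no term in `s`, and uniqueness transfers this
  -- to `β`.
  obtain ⟨α', β', h0, h⟩ := hu x (hSU hx)
  have h' : ∀ᶠ y in 𝓝 x, w y * u y = α + β * s y := hSA hx
  obtain ⟨y, z, hy, hyz, hpy, hpz⟩ := exists_two_points (h'.and h)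
  rw [(hs.coef_unique hy hyz (hpy.1.symm.trans hpy.2) (hpz.1.symm.trans hpz.2)).2]
  exact h0 hx0

theorem exists_coef_on (hs : IsScale s) {U : Opens Om} {u : Om → ℝ}
    (hu : u ∈ wSheaf s w U) {S : Set Om} (hS : S.OrdConnected) (hSU : S ⊆ U) :
    ∃ α β : ℝ, (∀ x ∈ S, (x : ℝ) = 0 → β = 0) ∧ ∀ x ∈ S, w x * u x = α + β * s x := by
  obtain ⟨α, β, h0, h⟩ := exists_coef_of_isPreconnected hs hu (isPreconnected_of_ordConnected hS) hSU
  exact ⟨α, β, h0, fun x hx => (h x hx).self_of_nhds⟩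

/-- At 0 the scale has an arbitrary value and is unbounded nearby; continuity holds there only
because its coefficient vanishes. -/
theorem IsScale.continuousAt_affine (hs : IsScale s) {α β : ℝ} {x : Om}
    (h : (x : ℝ) = 0 → β = 0) : ContinuousAt (fun y => α + β * s y) x := by
  rcases Om.eq_zero_or_pos x with hx | hx
  · have : β = 0 := h (by rw [hx]; rfl)
    simp only [this, zero_mul, add_zero]
    exact continuousAt_const
  · exact continuousAt_const.add (continuousAt_const.mul (hs.cont x hx))

theorem wSheaf_continuousAt (hs : IsScale s) (hw : IsWeight w) {U : Opens Om} {u : Om → ℝ}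
    (hu : u ∈ wSheaf s w U) {x : Om} (hx : x ∈ U) : ContinuousAt u x := by
  obtain ⟨α, β, h0, h⟩ := hu x hx
  have h1 : ContinuousAt (fun y => (α + β * s y) / w y) x :=
    (hs.continuousAt_affine h0).div hw.cont.continuousAt (hw.pos x).ne'
  refine h1.congr ?_
  filter_upwards [h] with y hy
  rw [← hy, mul_div_cancel_left₀ _ (hw.pos y).ne']

theorem mem_wSheaf_of_eqOn {U : Opens Om} {u : Om → ℝ} (α β : ℝ) (h0 : zeroOm ∈ U → β = 0)
    (h : ∀ x ∈ U, w x * u x = α + β * s x) : u ∈ wSheaf s w U := fun x hx =>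
  ⟨α, β, fun hx0 => h0 (by rwa [show zeroOm = x from Subtype.ext hx0.symm]),
    by filter_upwards [U.isOpen.mem_nhds hx] with y hy using h y hy⟩

theorem isFunctionSheaf_wSheaf (hs : IsScale s) (hw : IsWeight w) :
    IsFunctionSheaf (wSheaf s w) where
  congr U f g hfg hf x hx := by
    obtain ⟨α, β, h0, h⟩ := hf x hx
    refine ⟨α, β, h0, ?_⟩
    filter_upwards [h, U.isOpen.mem_nhds hx] with y hy hyU
    rw [← hfg hyU, hy]
  continuousOn U f hf x hx := (wSheaf_continuousAt hs hw hf hx).continuousWithinAt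
  zero_mem U := mem_wSheaf_of_eqOn 0 0 (fun _ => rfl) (by simp)
  add_mem U f hf g hg x hx := by
    obtain ⟨α, β, h0, h⟩ := hf x hx
    obtain ⟨α', β', h0', h'⟩ := hg x hx
    refine ⟨α + α', β + β', fun hx0 => by rw [h0 hx0, h0' hx0, add_zero], ?_⟩
    filter_upwards [h, h'] with y hy hy'
    rw [mul_add, hy, hy']
    ring
  smul_mem U c f hf x hx := by
    obtain ⟨α, β, h0, h⟩ := hf x hx
    refine ⟨c * α, c * β, fun hx0 => by rw [h0 hx0, mul_zero], ?_⟩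
    filter_upwards [h] with y hy
    rw [mul_left_comm, hy]
    ring
  restrict U V hUV f hf x hx := hf x (hUV hx)
  glue 𝒮 f hf x hx := by
    obtain ⟨U, hU, hxU⟩ := Opens.mem_sSup.mp hx
    exact hf U hU x hxU

/-- Pointwise limits of sections are sections. -/
theorem wSheaf_of_tendsto (hs : IsScale s) {ι : Type*} {l : Filter ι} [l.NeBot]
    {U : Opens Om} {h : ι → Om → ℝ} {g : Om → ℝ} (hh : ∀ i, h i ∈ wSheaf s w U)
    (hlim : ∀ x ∈ U, Tendsto (fun i => h i x) l (𝓝 (g x))) : g ∈ wSheaf s w U := by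
  intro x hx
  obtain ⟨V, hVo, hxV, hVU, hVc⟩ := isOpen_nbhd_interval (U.isOpen.mem_nhds hx)
  choose α β h0 h1 using fun i => exists_coef_on hs (hh i) hVc hVU
  obtain ⟨y, z, hy, hyz, hyV, hzV⟩ := exists_two_points (hVo.mem_nhds hxV)
  have hd := hs.anti y z hy hyz
  have hlw : ∀ x ∈ V, Tendsto (fun i => α i + β i * s x) l (𝓝 (w x * g x)) := fun x hx =>
    ((hlim x (hVU hx)).const_mul (w x)).congr fun i => h1 i x hx
  -- The values at two points determine the coefficients linearly, so convergence at `y` and `z`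
  -- makes the coefficients converge, and with them the whole expression on `V`.
  have hβ : Tendsto β l (𝓝 ((w y * g y - w z * g z) / (s y - s z))) := by
    refine (((hlw y hyV).sub (hlw z hzV)).div_const (s y - s z)).congr fun i => ?_
    rw [div_eq_iff (by linarith)]
    ring
  have hα := (hlw y hyV).sub (hβ.mul_const (s y))
  simp only [add_sub_cancel_right] at hα
  refine ⟨_, _, fun hx0 => ?_, by
    filter_upwards [hVo.mem_nhds hxV] with t ht using
      tendsto_nhds_unique (hlw t ht) (hα.add (hβ.mul_const (s t)))⟩
  · refine tendsto_nhds_unique hβ ?_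
    exact tendsto_const_nhds.congr fun i => (h0 i x hxV hx0).symm

end Sheaf


/-! ### Measures carried by two points -/

/-- The measure `c δ_a + d δ_b`. -/
def twoPt (c d : ℝ) (a b : Om) : Measure Om :=
  ENNReal.ofReal c • Measure.dirac a + ENNReal.ofReal d • Measure.dirac b

instance (c d : ℝ) (a b : Om) : IsFiniteMeasure (twoPt c d a b) := by
  unfold twoPt
  have h (r : ℝ) (x : Om) : IsFiniteMeasure (ENNReal.ofReal r • Measure.dirac x) :=
    Measure.smul_finite _ ENNReal.ofReal_ne_top
  have := h c a
  have := h d b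
  infer_instance

theorem lintegral_twoPt (c d : ℝ) (a b : Om) (f : Om → ENNReal) :
    ∫⁻ y, f y ∂(twoPt c d a b) = ENNReal.ofReal c * f a + ENNReal.ofReal d * f b := by
  simp [twoPt]

theorem integral_twoPt {c d : ℝ} (hc : 0 ≤ c) (hd : 0 ≤ d) (a b : Om) (f : Om → ℝ) :
    ∫ y, f y ∂(twoPt c d a b) = c * f a + d * f b := by
  have hi (r : ℝ) (x : Om) : Integrable f (ENNReal.ofReal r • Measure.dirac x) :=
    (integrable_dirac (by simp)).smul_measure ENNReal.ofReal_ne_top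
  rw [twoPt, integral_add_measure (hi c a) (hi d b), integral_smul_measure, integral_smul_measure,
    integral_dirac, integral_dirac, ENNReal.toReal_ofReal hc, ENNReal.toReal_ofReal hd]
  rfl

theorem twoPt_compl {c d : ℝ} {a b : Om} {F : Set Om} (hF : IsClosed F) (ha : a ∈ F) (hb : b ∈ F) :
    twoPt c d a b Fᶜ = 0 := by
  simp [twoPt, Measure.dirac_apply' _ hF.measurableSet.compl, ha, hb]

theorem setIntegral_eq_of_compl_eq_zero {ρ : Measure Om} {F : Set Om} (hρ : ρ Fᶜ = 0)
    (f : Om → ℝ) : ∫ y in F, f y ∂ρ = ∫ y, f y ∂ρ := by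
  rw [Measure.restrict_eq_self_of_ae_mem]
  exact hρ

theorem setIntegral_twoPt {c d : ℝ} (hc : 0 ≤ c) (hd : 0 ≤ d) {a b : Om} {F : Set Om}
    (hF : IsClosed F) (ha : a ∈ F) (hb : b ∈ F) (f : Om → ℝ) :
    ∫ y in F, f y ∂(twoPt c d a b) = c * f a + d * f b := by
  rw [setIntegral_eq_of_compl_eq_zero (twoPt_compl hF ha hb), integral_twoPt hc hd]

theorem eq_twoPt {ρ : Measure Om} (hρ : IsFiniteMeasure ρ) {F : Set Om} (h0 : ρ Fᶜ = 0)
    {c d : ℝ} (hc : 0 ≤ c) (hd : 0 ≤ d) {a b : Om}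
    (h : ∀ f : Om → ℝ, Continuous f → ∫ y in F, f y ∂ρ = c * f a + d * f b) :
    ρ = twoPt c d a b := by
  refine ext_of_forall_integral_eq_of_IsFiniteMeasure fun f => ?_
  rw [integral_twoPt hc hd, ← h f f.continuous, setIntegral_eq_of_compl_eq_zero h0]

/-- Splits a multiple of `z` into positive and negative parts in the way `upperIntegral` does, so
that upper integrals against point masses become ordinary sums. -/
theorem EReal.coe_mul_eq_sub {c : ℝ} (hc : 0 ≤ c) {z : EReal} (hz : z ≠ ⊥) :
    (c : EReal) * z = ((ENNReal.ofReal c * z.toENNReal : ENNReal) : EReal) -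
      ((ENNReal.ofReal c * (-z).toENNReal : ENNReal) : EReal) := by
  have hc' : ((ENNReal.ofReal c : ENNReal) : EReal) = c := by
    rw [EReal.coe_ennreal_ofReal, max_eq_left hc]
  rw [EReal.coe_ennreal_mul, EReal.coe_ennreal_mul, hc']
  induction z with
  | bot => exact absurd rfl hz
  | top => simp
  | coe r =>
    rcases le_total 0 r with h | h
    · rw [EReal.coe_toENNReal (by exact_mod_cast h), EReal.toENNReal_of_nonpos (x := -(r : EReal))]
      · simp
      · rw [← EReal.coe_neg]
        exact_mod_cast (neg_nonpos.mpr h)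
    · rw [EReal.toENNReal_of_nonpos (x := (r : EReal)) (by exact_mod_cast h), EReal.coe_toENNReal]
      · simp
      · rw [← EReal.coe_neg]
        exact_mod_cast (neg_nonneg.mpr h)

theorem EReal.ofReal_mul_neg_toENNReal_ne_top (c : ℝ) {z : EReal} (hz : z ≠ ⊥) :
    ENNReal.ofReal c * (-z).toENNReal ≠ ⊤ := by
  refine ENNReal.mul_ne_top ENNReal.ofReal_ne_top ?_
  rw [EReal.toENNReal_ne_top_iff]
  simpa using hz

theorem upperIntegral_twoPt {c d : ℝ} (hc : 0 ≤ c) (hd : 0 ≤ d) {a b : Om} {u : Om → EReal}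
    (ha : u a ≠ ⊥) (hb : u b ≠ ⊥) :
    upperIntegral (twoPt c d a b) u = c * u a + d * u b := by
  rw [upperIntegral, lintegral_twoPt, lintegral_twoPt, EReal.coe_mul_eq_sub hc ha,
    EReal.coe_mul_eq_sub hd hb, EReal.coe_ennreal_add, EReal.coe_ennreal_add]
  refine EReal.add_sub_add_comm (Or.inl (EReal.coe_ennreal_ne_bot _)) (Or.inl ?_)
  rw [Ne, EReal.coe_ennreal_eq_top_iff]
  exact EReal.ofReal_mul_neg_toENNReal_ne_top c ha

/-! ### Extended real functions -/

theorem EReal.coe_mul_ne_bot {c : ℝ} (hc : 0 ≤ c) {z : EReal} (hz : z ≠ ⊥) : (c : EReal) * z ≠ ⊥ := by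
  induction z with
  | bot => exact absurd rfl hz
  | top =>
    rcases hc.eq_or_lt with rfl | h
    · simp
    · simp [EReal.coe_mul_top_of_pos h]
  | coe r =>
    rw [← EReal.coe_mul]
    exact EReal.coe_ne_bot _

theorem EReal.coe_mul_inv_cancel {c : ℝ} (hc : c ≠ 0) (z : EReal) :
    (c : EReal) * (((1 / c : ℝ) : EReal) * z) = z := by
  rw [← mul_assoc, ← EReal.coe_mul, mul_one_div_cancel hc, EReal.coe_one, one_mul]

theorem EReal.coe_inv_mul_cancel {c : ℝ} (hc : c ≠ 0) (z : EReal) :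
    (((1 / c : ℝ) : EReal)) * ((c : EReal) * z) = z := by
  rw [← mul_assoc, ← EReal.coe_mul, one_div_mul_cancel hc, EReal.coe_one, one_mul]

theorem EReal.coe_mul_le_coe_mul_iff {c : ℝ} (hc : 0 < c) {y z : EReal} :
    (c : EReal) * y ≤ c * z ↔ y ≤ z := by
  constructor
  · intro h
    have := mul_le_mul_of_nonneg_left h (show (0 : EReal) ≤ ((1 / c : ℝ) : EReal) by
      exact_mod_cast (one_div_pos.mpr hc).le)
    rwa [coe_inv_mul_cancel hc.ne', coe_inv_mul_cancel hc.ne'] at this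
  · exact fun h => mul_le_mul_of_nonneg_left h (by exact_mod_cast hc.le)

theorem EReal.coe_mul_add {c : ℝ} (hc : 0 ≤ c) (y z : EReal) :
    (c : EReal) * (y + z) = c * y + c * z :=
  EReal.left_distrib_of_nonneg_of_ne_top (by exact_mod_cast hc) (EReal.coe_ne_top c) y z

theorem EReal.coe_mul_ne_top {c : ℝ} (hc : 0 < c) {z : EReal} : (c : EReal) * z ≠ ⊤ ↔ z ≠ ⊤ := by
  induction z with
  | bot => simp [EReal.coe_mul_bot_of_pos hc]
  | top => simp [EReal.coe_mul_top_of_pos hc]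
  | coe r =>
    rw [← EReal.coe_mul]
    exact iff_of_true (EReal.coe_ne_top _) (EReal.coe_ne_top _)

theorem EReal.coe_mul_ne_bot_iff {c : ℝ} (hc : 0 < c) {z : EReal} :
    (c : EReal) * z ≠ ⊥ ↔ z ≠ ⊥ := by
  refine ⟨fun h hz => h ?_, EReal.coe_mul_ne_bot hc.le⟩
  rw [hz, EReal.coe_mul_bot_of_pos hc]

theorem lsc_weight_mul {w : Om → ℝ} (hw : IsWeight w) {U : Set Om} {u : Om → EReal}
    (hu : LowerSemicontinuousOn u U) :
    LowerSemicontinuousOn (fun x => (w x : EReal) * u x) U := by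
  intro x hx y hy
  have hwx : (0 : EReal) < w x := by exact_mod_cast hw.pos x
  change y < (w x : EReal) * u x at hy
  rw [mul_comm, ← EReal.div_lt_iff hwx (EReal.coe_ne_top _)] at hy
  -- A real `c` strictly between `y / w x` and `u x` separates the two factors: near `x` one has `u
  -- > c` by semicontinuity and `c * w > y` by continuity.
  obtain ⟨c, hc1, hc2⟩ := EReal.lt_iff_exists_real_btwn.mp hy
  rw [EReal.div_lt_iff hwx (EReal.coe_ne_top _)] at hc1
  have h1 : ContinuousWithinAt (fun z => ((c * w z : ℝ) : EReal)) U x :=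
    (continuous_coe_real_ereal.comp (continuous_const.mul hw.cont)).continuousWithinAt
  filter_upwards [hu x hx _ hc2, h1.eventually (lt_mem_nhds (by simpa using hc1))] with z hz1 hz2
  refine hz2.trans_le ?_
  rw [mul_comm, EReal.coe_mul]
  exact mul_le_mul_of_nonneg_left hz1.le (by exact_mod_cast (hw.pos z).le)

theorem IsWeight.inv {w : Om → ℝ} (hw : IsWeight w) : IsWeight fun x => 1 / w x :=
  ⟨continuous_const.div hw.cont fun x => (hw.pos x).ne', fun x => one_div_pos.mpr (hw.pos x)⟩

theorem lsc_weight_mul_iff {w : Om → ℝ} (hw : IsWeight w) {U : Set Om} {u : Om → EReal} :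
    LowerSemicontinuousOn (fun x => (w x : EReal) * u x) U ↔ LowerSemicontinuousOn u U := by
  refine ⟨fun h => ?_, lsc_weight_mul hw⟩
  have := lsc_weight_mul hw.inv h
  simpa only [EReal.coe_inv_mul_cancel (hw.pos _).ne'] using this

/-! ### Components of relatively compact open sets -/

theorem isCompact_Icc_Om (a b : Om) : IsCompact (Icc a b) := by
  rw [Topology.IsEmbedding.subtypeVal.isCompact_iff]
  convert isCompact_Icc (a := (a : ℝ)) (b := b)
  ext z
  constructor
  · rintro ⟨x, hx, rfl⟩
    exact hx
  · exact fun hz => ⟨⟨z, a.2.1.trans hz.1, hz.2.trans_lt b.2.2⟩, hz, rfl⟩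

theorem frontier_Ioo_Om {a b : Om} (h : a < b) : frontier (Ioo a b) = {a, b} := by
  rw [isOpen_Ioo.frontier_eq, closure_Ioo h.ne, Icc_sdiff_Ioo_same h.le]

theorem closure_Iio_Om {b : Om} (h : 0 < (b : ℝ)) : closure (Iio b) = Iic b :=
  closure_Iio' ⟨zeroOm, h⟩

theorem frontier_Iio_Om {b : Om} (h : 0 < (b : ℝ)) : frontier (Iio b) = {b} := by
  rw [isOpen_Iio.frontier_eq, closure_Iio_Om h, Iic_sdiff_Iio_same]

theorem right_mem_frontier {ω : Opens Om} {x b : Om} (hxb : x < b) (hb : b ∉ ω)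
    (h : Ioo x b ⊆ (ω : Set Om)) : b ∈ frontier (ω : Set Om) := by
  rw [ω.isOpen.frontier_eq]
  refine ⟨closure_mono h ?_, hb⟩
  rw [closure_Ioo hxb.ne]
  exact right_mem_Icc.mpr hxb.le

theorem left_mem_frontier {ω : Opens Om} {a x : Om} (hax : a < x) (ha : a ∉ ω)
    (h : Ioo a x ⊆ (ω : Set Om)) : a ∈ frontier (ω : Set Om) := by
  rw [ω.isOpen.frontier_eq]
  refine ⟨closure_mono h ?_, ha⟩
  rw [closure_Ioo hax.ne]
  exact left_mem_Icc.mpr hax.le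

/-- The component of a point of a relatively compact open set. -/
theorem exists_component {ω : Opens Om} (hω : IsCompact (closure (ω : Set Om))) {x : Om}
    (hx : x ∈ ω) :
    (∃ b, x < b ∧ b ∈ frontier (ω : Set Om) ∧ Iio b ⊆ (ω : Set Om)) ∨
    ∃ a b, a < x ∧ x < b ∧ a ∈ frontier (ω : Set Om) ∧ b ∈ frontier (ω : Set Om) ∧
      Ioo a b ⊆ (ω : Set Om) := by
  -- Compactness of the closure puts a point of Ω beyond ω, so the component of `x` has a right end
  -- in Ω.
  obtain ⟨M, -, hM⟩ := hω.exists_isMaxOn ⟨x, subset_closure hx⟩ continuous_id.continuousOn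
  obtain ⟨c, hc⟩ := Om.exists_gt M
  have hcω : c ∉ ω := fun h => absurd (hM (subset_closure h)) (not_le.mpr hc)
  have hxc : x < c := lt_of_le_of_lt (hM (subset_closure hx)) hc
  have hT : IsCompact (Icc x c ∩ (ω : Set Om)ᶜ) :=
    (isCompact_Icc_Om x c).inter_right ω.isOpen.isClosed_compl
  obtain ⟨b, hb, hbl⟩ := hT.exists_isLeast ⟨c, ⟨hxc.le, le_rfl⟩, hcω⟩
  have hxb : x < b := lt_of_le_of_ne hb.1.1 fun h => hb.2 (h ▸ hx)
  have hIco : Ico x b ⊆ (ω : Set Om) := by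
    intro z hz
    by_contra hzω
    exact absurd (hbl ⟨⟨hz.1, hz.2.le.trans hb.1.2⟩, hzω⟩) (not_le.mpr hz.2)
  have hbF := right_mem_frontier hxb hb.2 (Ioo_subset_Ico_self.trans hIco)
  have hT' : IsCompact (Icc zeroOm x ∩ (ω : Set Om)ᶜ) :=
    (isCompact_Icc_Om zeroOm x).inter_right ω.isOpen.isClosed_compl
  -- If ω has no gap to the left of `x`, the component reaches 0, which is then an interior point
  -- and not a boundary point.
  rcases (Icc zeroOm x ∩ (ω : Set Om)ᶜ).eq_empty_or_nonempty with he | hne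
  · left
    refine ⟨b, hxb, hbF, fun z hz => ?_⟩
    rcases le_total x z with h | h
    · exact hIco ⟨h, hz⟩
    · by_contra hzω
      exact absurd (show z ∈ Icc zeroOm x ∩ (ω : Set Om)ᶜ from ⟨⟨zeroOm_le z, h⟩, hzω⟩)
        (by rw [he]; exact notMem_empty z)
  · right
    obtain ⟨a, ha, hal⟩ := hT'.exists_isGreatest hne
    have hax : a < x := lt_of_le_of_ne ha.1.2 fun h => ha.2 (h ▸ hx)
    have hIoc : Ioc a x ⊆ (ω : Set Om) := by
      intro z hz
      by_contra hzω
      exact absurd (hal ⟨⟨zeroOm_le z, hz.2⟩, hzω⟩) (not_le.mpr hz.1)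
    refine ⟨a, b, hax, hxb, left_mem_frontier hax ha.2 (Ioo_subset_Ioc_self.trans hIoc), hbF, ?_⟩
    intro z hz
    rcases le_total x z with h | h
    · exact hIco ⟨h, hz.2⟩
    · exact hIoc ⟨hz.1, h⟩

/-! ### The Dirichlet problem -/

/-- The affine interpolation weight of the point `a` in the scale `s`. -/
def lam (s : Om → ℝ) (a b x : Om) : ℝ := (s x - s b) / (s a - s b)

section Dirichlet

variable {s w : Om → ℝ}

theorem IsScale.lam_left_pos (hs : IsScale s) {a b x : Om} (ha : 0 < (a : ℝ)) (hax : a < x)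
    (hxb : x < b) : 0 < lam s a b x :=
  div_pos (sub_pos.mpr (hs.anti x b (Om.pos_of_lt hax) hxb))
    (sub_pos.mpr (hs.anti a b ha (hax.trans hxb)))

theorem IsScale.lam_right_pos (hs : IsScale s) {a b x : Om} (ha : 0 < (a : ℝ)) (hax : a < x)
    (hxb : x < b) : 0 < lam s b a x :=
  div_pos_of_neg_of_neg (sub_neg.mpr (hs.anti a x ha hax))
    (sub_neg.mpr (hs.anti a b ha (hax.trans hxb)))

theorem IsScale.lam_add (hs : IsScale s) {a b : Om} (ha : 0 < (a : ℝ)) (hab : a < b) (x : Om) :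
    lam s a b x + lam s b a x = 1 := by
  have h := hs.anti a b ha hab
  have h1 : s a - s b ≠ 0 := by linarith
  have h2 : s b - s a ≠ 0 := by linarith
  rw [lam, lam]
  field_simp
  ring

theorem IsScale.lam_mul_add (hs : IsScale s) {a b : Om} (ha : 0 < (a : ℝ)) (hab : a < b) (x : Om) :
    lam s a b x * s a + lam s b a x * s b = s x := by
  have h := hs.anti a b ha hab
  have h1 : s a - s b ≠ 0 := by linarith
  have h2 : s b - s a ≠ 0 := by linarith
  rw [lam, lam]
  field_simp
  ring

theorem IsScale.interp (hs : IsScale s) {a b : Om} (ha : 0 < (a : ℝ)) (hab : a < b) (x : Om)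
    (α β : ℝ) : α + β * s x =
      lam s a b x * (α + β * s a) + lam s b a x * (α + β * s b) := by
  linear_combination (-β) * hs.lam_mul_add ha hab x + (-α) * hs.lam_add ha hab x

/-- The coefficient of `s` in the function `α + β s` with values `A` at `a` and `B` at `b`. -/
theorem IsScale.exists_coef (hs : IsScale s) {a b : Om} (ha : 0 < (a : ℝ)) (hab : a < b)
    (A B : ℝ) : ∃ α β : ℝ, ∀ x, lam s a b x * A + lam s b a x * B = α + β * s x := by
  have h := hs.anti a b ha hab
  have h1 : s a - s b ≠ 0 := by linarith
  have h2 : s b - s a ≠ 0 := by linarith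
  refine ⟨(B * s a - A * s b) / (s a - s b), (A - B) / (s a - s b), fun x => ?_⟩
  rw [lam, lam]
  field_simp
  ring

theorem lam_self_left (hs : IsScale s) {a b : Om} (ha : 0 < (a : ℝ)) (hab : a < b) :
    lam s a b a = 1 ∧ lam s b a a = 0 ∧ lam s a b b = 0 ∧ lam s b a b = 1 := by
  have h := hs.anti a b ha hab
  have h1 : s a - s b ≠ 0 := by linarith
  have h2 : s b - s a ≠ 0 := by linarith
  simp [lam, div_self h1, div_self h2]

/-- A boundary value of a section is the value of its expression. -/
theorem boundary_value (hs : IsScale s) (hw : IsWeight w) {ω : Opens Om} {h : Om → ℝ} {S : Set Om}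
    (hS : S ⊆ ω) {α β : ℝ} (hrep : ∀ x ∈ S, w x * h x = α + β * s x) {y : Om}
    (hy : y ∈ closure S) (hpos : (y : ℝ) = 0 → β = 0) {r : ℝ}
    (hlim : Tendsto h (𝓝[(ω : Set Om)] y) (𝓝 r)) : α + β * s y = w y * r := by
  have := mem_closure_iff_nhdsWithin_neBot.mp hy
  have h1 : Tendsto (fun x => w x * h x) (𝓝[S] y) (𝓝 (w y * r)) :=
    (hw.cont.continuousAt.mono_left nhdsWithin_le_nhds).mul (hlim.mono_left (nhdsWithin_mono y hS))
  have h2 : Tendsto (fun x => α + β * s x) (𝓝[S] y) (𝓝 (α + β * s y)) :=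
    (hs.continuousAt_affine hpos).mono_left nhdsWithin_le_nhds
  refine tendsto_nhds_unique (h2.congr' ?_) h1
  filter_upwards [self_mem_nhdsWithin] with x hx using (hrep x hx).symm

/-- On a component containing 0 the function w h is constant, so its only boundary point fixes it.
-/
theorem rep_of_Iio (hs : IsScale s) (hw : IsWeight w) {ω : Opens Om} {h f : Om → ℝ}
    (hh : IsDirichletSolution (wSheaf s w) ω f h) {b : Om} (hb0 : 0 < (b : ℝ))
    (hb : b ∈ frontier (ω : Set Om)) (hω : Iio b ⊆ (ω : Set Om)) {x : Om} (hx : x < b) :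
    w x * h x = w b * f b := by
  obtain ⟨α, β, h0, hr⟩ := exists_coef_on hs hh.1 ordConnected_Iio hω
  have hβ : β = 0 := h0 zeroOm (zeroOm_lt_iff.mpr hb0) rfl
  have h1 := boundary_value hs hw hω hr (y := b) (by rw [closure_Iio_Om hb0]; exact self_mem_Iic)
    (fun _ => hβ) (hh.2 b hb)
  rw [hr x hx, ← h1, hβ]
  simp

theorem rep_of_Ioo (hs : IsScale s) (hw : IsWeight w) {ω : Opens Om} {h f : Om → ℝ}
    (hh : IsDirichletSolution (wSheaf s w) ω f h) {a b : Om} (ha0 : 0 < (a : ℝ)) (hab : a < b)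
    (ha : a ∈ frontier (ω : Set Om)) (hb : b ∈ frontier (ω : Set Om))
    (hω : Ioo a b ⊆ (ω : Set Om)) {x : Om} (hx : x ∈ Ioo a b) :
    w x * h x = lam s a b x * (w a * f a) + lam s b a x * (w b * f b) := by
  obtain ⟨α, β, h0, hr⟩ := exists_coef_on hs hh.1 ordConnected_Ioo hω
  have hcl := closure_Ioo hab.ne
  have h1 := boundary_value hs hw hω hr (y := a) (by rw [hcl]; exact left_mem_Icc.mpr hab.le)
    (fun h => absurd h ha0.ne') (hh.2 a ha)
  have h2 := boundary_value hs hw hω hr (y := b) (by rw [hcl]; exact right_mem_Icc.mpr hab.le)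
    (fun h => absurd h (ha0.trans hab).ne') (hh.2 b hb)
  rw [hr x hx, ← h1, ← h2, hs.interp ha0 hab]

/-- A bounded component of a set in which the Dirichlet problem is solvable does not end at `0`. -/
theorem left_pos_of_solvable (hs : IsScale s) (hw : IsWeight w) {ω : Opens Om} {a b : Om}
    {h : Om → ℝ} (hh : IsDirichletSolution (wSheaf s w) ω (fun y => (b : ℝ) - y) h)
    (hab : a < b) (ha : a ∈ frontier (ω : Set Om)) (hb : b ∈ frontier (ω : Set Om))
    (hω : Ioo a b ⊆ (ω : Set Om)) : 0 < (a : ℝ) := by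
  by_contra ha0
  obtain rfl := Om.eq_zero_of_not_pos ha0
  obtain ⟨α, β, -, hr⟩ := exists_coef_on hs hh.1 ordConnected_Ioo hω
  have hcl := closure_Ioo hab.ne
  have hne : (𝓝[Ioo zeroOm b] zeroOm).NeBot := by
    rw [← mem_closure_iff_nhdsWithin_neBot, hcl]
    exact left_mem_Icc.mpr hab.le
  have h1 : Tendsto (fun x => w x * h x) (𝓝[Ioo zeroOm b] zeroOm)
      (𝓝 (w zeroOm * ((b : ℝ) - (zeroOm : Om)))) :=
    (hw.cont.continuousAt.mono_left nhdsWithin_le_nhds).mul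
      ((hh.2 zeroOm ha).mono_left (nhdsWithin_mono _ hω))
  have h2 : Tendsto (fun x => α + β * s x) (𝓝[Ioo zeroOm b] zeroOm)
      (𝓝 (w zeroOm * ((b : ℝ) - (zeroOm : Om)))) := by
    refine h1.congr' ?_
    filter_upwards [self_mem_nhdsWithin] with x hx using hr x hx
  -- The solution has a finite limit at 0 while `s` tends to +∞, so w h is constant on ]0, b[. But
  -- the data b - y prescribe a positive value for it at 0 and the value 0 at `b`.
  have hβ : β = 0 := by
    by_contra hβ
    have h3 : Tendsto s (𝓝[Ioo zeroOm b] zeroOm)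
        (𝓝 ((w zeroOm * ((b : ℝ) - (zeroOm : Om)) - α) / β)) := by
      refine ((h2.sub_const α).div_const β).congr fun x => ?_
      field_simp
      ring
    exact not_tendsto_nhds_of_tendsto_atTop
      (hs.tendsto_zero.mono_left (nhdsWithin_mono _ fun x hx => hx.1)) _ h3
  have h3 := boundary_value hs hw hω hr (y := zeroOm)
    (by rw [hcl]; exact left_mem_Icc.mpr hab.le) (fun _ => hβ) (hh.2 zeroOm ha)
  have h4 := boundary_value hs hw hω hr (y := b)
    (by rw [hcl]; exact right_mem_Icc.mpr hab.le) (fun _ => hβ) (hh.2 b hb)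
  simp only [hβ, zero_mul, add_zero, sub_self, mul_zero] at h3 h4
  have h5 : w zeroOm * ((b : ℝ) - (zeroOm : Om)) > 0 :=
    mul_pos (hw.pos _) (sub_pos.mpr hab)
  linarith

theorem continuous_sub_val (b : Om) : Continuous fun y : Om => (b : ℝ) - y :=
  continuous_const.sub continuous_subtype_val

/-- The solution of the Dirichlet problem on `]a, b[`. -/
theorem exists_solution_Ioo (hs : IsScale s) (hw : IsWeight w) {a b : Om} (ha0 : 0 < (a : ℝ))
    (hab : a < b) (f : Om → ℝ) :
    IsDirichletSolution (wSheaf s w) ⟨Ioo a b, isOpen_Ioo⟩ f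
      fun x => (lam s a b x * (w a * f a) + lam s b a x * (w b * f b)) / w x := by
  obtain ⟨α, β, hc⟩ := hs.exists_coef ha0 hab (w a * f a) (w b * f b)
  have key : ∀ y : Om, 0 < (y : ℝ) → ContinuousAt
      (fun x => (lam s a b x * (w a * f a) + lam s b a x * (w b * f b)) / w x) y := by
    intro y hy
    simp only [hc]
    exact (hs.continuousAt_affine fun h => absurd h hy.ne').div hw.cont.continuousAt (hw.pos y).ne'
  refine ⟨mem_wSheaf_of_eqOn α β (fun h => absurd h.1 (not_lt.mpr (zeroOm_le a))) fun x _ => ?_, ?_⟩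
  · rw [mul_div_cancel₀ _ (hw.pos x).ne', hc]
  · rintro y hy
    change y ∈ frontier (Ioo a b) at hy
    rw [frontier_Ioo_Om hab] at hy
    obtain ⟨e1, e2, e3, e4⟩ := lam_self_left hs ha0 hab
    rcases hy with rfl | rfl
    · have h := (key y ha0).mono_left (nhdsWithin_le_nhds (s := Ioo y b))
      simp only [e1, e2, zero_mul, add_zero, one_mul] at h
      rwa [mul_div_cancel_left₀ _ (hw.pos y).ne'] at h
    · have h := (key y (ha0.trans hab)).mono_left (nhdsWithin_le_nhds (s := Ioo a y))
      simp only [e3, e4, zero_mul, zero_add, one_mul] at h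
      rwa [mul_div_cancel_left₀ _ (hw.pos y).ne'] at h

theorem exists_solution_Iio (hw : IsWeight w) {b : Om} (hb0 : 0 < (b : ℝ))
    (f : Om → ℝ) :
    IsDirichletSolution (wSheaf s w) ⟨Iio b, isOpen_Iio⟩ f fun x => w b * f b / w x := by
  refine ⟨mem_wSheaf_of_eqOn (w b * f b) 0 (fun _ => rfl) fun x _ => ?_, ?_⟩
  · rw [mul_div_cancel₀ _ (hw.pos x).ne', zero_mul, add_zero]
  · rintro y hy
    change y ∈ frontier (Iio b) at hy
    rw [frontier_Iio_Om hb0] at hy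
    obtain rfl : y = b := hy
    have h : ContinuousAt (fun x => w y * f y / w x) y :=
      continuousAt_const.div hw.cont.continuousAt (hw.pos y).ne'
    have h' := h.mono_left (nhdsWithin_le_nhds (s := Iio y))
    simp only at h'
    rwa [mul_div_cancel_left₀ _ (hw.pos y).ne'] at h'

theorem isRegular_Ioo (hs : IsScale s) (hw : IsWeight w) {a b : Om} (ha0 : 0 < (a : ℝ))
    (hab : a < b) : IsRegular (wSheaf s w) ⟨Ioo a b, isOpen_Ioo⟩ := by
  have hfr := frontier_Ioo_Om hab
  refine ⟨?_, fun f _ => ⟨_, exists_solution_Ioo hs hw ha0 hab f, fun hf x hx => ?_,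
    fun h' hh' x hx => ?_⟩⟩
  · change IsCompact (closure (Ioo a b))
    rw [closure_Ioo hab.ne]
    exact isCompact_Icc_Om a b
  · change ∀ y ∈ frontier (Ioo a b), 0 ≤ f y at hf
    rw [hfr] at hf
    have h1 := mul_nonneg (hs.lam_left_pos ha0 hx.1 hx.2).le
      (mul_nonneg (hw.pos a).le (hf a (by simp)))
    have h2 := mul_nonneg (hs.lam_right_pos ha0 hx.1 hx.2).le
      (mul_nonneg (hw.pos b).le (hf b (by simp)))
    exact div_nonneg (by linarith) (hw.pos x).le
  · simp only
    rw [← rep_of_Ioo hs hw hh' ha0 hab (by simp [hfr]) (by simp [hfr]) Subset.rfl hx,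
      mul_div_cancel_left₀ _ (hw.pos x).ne']

theorem isRegular_Iio (hs : IsScale s) (hw : IsWeight w) {b : Om} (hb0 : 0 < (b : ℝ)) :
    IsRegular (wSheaf s w) ⟨Iio b, isOpen_Iio⟩ := by
  have hfr := frontier_Iio_Om hb0
  refine ⟨?_, fun f _ => ⟨_, exists_solution_Iio hw hb0 f, fun hf x hx => ?_,
    fun h' hh' x hx => ?_⟩⟩
  · change IsCompact (closure (Iio b))
    rw [closure_Iio_Om hb0]
    exact (isCompact_Icc_Om zeroOm b).of_isClosed_subset isClosed_Iic fun x hx => ⟨zeroOm_le x, hx⟩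
  · change ∀ y ∈ frontier (Iio b), 0 ≤ f y at hf
    rw [hfr] at hf
    exact div_nonneg (mul_nonneg (hw.pos b).le (hf b rfl)) (hw.pos x).le
  · simp only
    rw [← rep_of_Iio hs hw hh' hb0 (by simp [hfr]) Subset.rfl hx,
      mul_div_cancel_left₀ _ (hw.pos x).ne']

/-- The components of a regular set are `[0, b[` and `]a, b[` with `a > 0`. -/
theorem IsRegular.component (hs : IsScale s) (hw : IsWeight w) {ω : Opens Om}
    (hω : IsRegular (wSheaf s w) ω) {x : Om} (hx : x ∈ ω) :
    (∃ b, x < b ∧ b ∈ frontier (ω : Set Om) ∧ Iio b ⊆ (ω : Set Om)) ∨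
    ∃ a b : Om, 0 < (a : ℝ) ∧ a < x ∧ x < b ∧ a ∈ frontier (ω : Set Om) ∧ b ∈ frontier (ω : Set Om) ∧
      Ioo a b ⊆ (ω : Set Om) := by
  rcases exists_component hω.1 hx with h | ⟨a, b, hax, hxb, ha, hb, hab⟩
  · exact Or.inl h
  · obtain ⟨h, hh, -, -⟩ := hω.2 _ (continuous_sub_val b).continuousOn
    exact Or.inr ⟨a, b, left_pos_of_solvable hs hw hh (hax.trans hxb) ha hb hab, hax, hxb, ha, hb,
      hab⟩

/-! ### Harmonic measures and hyperharmonic functions -/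

theorem isHarmonicMeasure_of_Iio (hs : IsScale s) (hw : IsWeight w) {ω : Opens Om} {b x : Om}
    (hxb : x < b) (hb : b ∈ frontier (ω : Set Om)) (hbω : Iio b ⊆ (ω : Set Om)) :
    IsHarmonicMeasure (wSheaf s w) ω x (twoPt 0 (w b / w x) b b) := by
  refine ⟨inferInstance, twoPt_compl isClosed_frontier hb hb, fun f h _ hh => ?_⟩
  rw [setIntegral_twoPt le_rfl (div_pos (hw.pos b) (hw.pos x)).le isClosed_frontier hb hb,
    zero_mul, zero_add, div_mul_eq_mul_div, ← rep_of_Iio hs hw hh (Om.pos_of_lt hxb) hb hbω hxb,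
    mul_div_cancel_left₀ _ (hw.pos x).ne']

theorem isHarmonicMeasure_of_Ioo (hs : IsScale s) (hw : IsWeight w) {ω : Opens Om} {a b x : Om}
    (ha0 : 0 < (a : ℝ)) (hax : a < x) (hxb : x < b) (ha : a ∈ frontier (ω : Set Om))
    (hb : b ∈ frontier (ω : Set Om)) (hω : Ioo a b ⊆ (ω : Set Om)) :
    IsHarmonicMeasure (wSheaf s w) ω x
      (twoPt (w a / w x * lam s a b x) (w b / w x * lam s b a x) a b) := by
  refine ⟨inferInstance, twoPt_compl isClosed_frontier ha hb, fun f h _ hh => ?_⟩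
  have h1 := (hs.lam_left_pos ha0 hax hxb).le
  have h2 := (hs.lam_right_pos ha0 hax hxb).le
  have hwa := hw.pos a
  have hwb := hw.pos b
  have hwx := hw.pos x
  rw [setIntegral_twoPt (by positivity) (by positivity) isClosed_frontier ha hb]
  have := rep_of_Ioo hs hw hh ha0 (hax.trans hxb) ha hb hω ⟨hax, hxb⟩
  field_simp
  linarith

/-- Solvability for all continuous boundary data fixes the integrals of continuous functions, so a
regular set has only one harmonic measure at a point. -/
theorem eq_of_isHarmonicMeasure {ω : Opens Om} (hω : IsRegular (wSheaf s w) ω) {x : Om}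
    {ρ : Measure Om} (hρ : IsHarmonicMeasure (wSheaf s w) ω x ρ)
    {c d : ℝ} (hc : 0 ≤ c) (hd : 0 ≤ d) {a b : Om} (ha : a ∈ frontier (ω : Set Om))
    (hb : b ∈ frontier (ω : Set Om))
    (h : IsHarmonicMeasure (wSheaf s w) ω x (twoPt c d a b)) : ρ = twoPt c d a b := by
  refine eq_twoPt hρ.1 hρ.2.1 hc hd fun f hf => ?_
  obtain ⟨g, hg, -, -⟩ := hω.2 f hf.continuousOn
  rw [← hρ.2.2 f g hf.continuousOn hg, h.2.2 f g hf.continuousOn hg,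
    setIntegral_twoPt hc hd isClosed_frontier ha hb]

/-- The harmonic measures of the regular sets. -/
theorem isHarmonicMeasure_cases (hs : IsScale s) (hw : IsWeight w) {ω : Opens Om}
    (hω : IsRegular (wSheaf s w) ω) {x : Om} (hx : x ∈ ω)
    {ρ : Measure Om} (hρ : IsHarmonicMeasure (wSheaf s w) ω x ρ) :
    (∃ b, x < b ∧ Iic b ⊆ closure (ω : Set Om) ∧ ρ = twoPt 0 (w b / w x) b b) ∨
    ∃ a b : Om, 0 < (a : ℝ) ∧ a < x ∧ x < b ∧ Icc a b ⊆ closure (ω : Set Om) ∧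
      ρ = twoPt (w a / w x * lam s a b x) (w b / w x * lam s b a x) a b := by
  have hwx := hw.pos x
  rcases hω.component hs hw hx with ⟨b, hxb, hb, hbω⟩ | ⟨a, b, ha0, hax, hxb, ha, hb, hab⟩
  · refine Or.inl ⟨b, hxb, ?_, eq_of_isHarmonicMeasure hω hρ le_rfl
      (div_pos (hw.pos b) hwx).le hb hb (isHarmonicMeasure_of_Iio hs hw hxb hb hbω)⟩
    rw [← closure_Iio_Om (Om.pos_of_lt hxb)]
    exact closure_mono hbω
  · have h1 := (hs.lam_left_pos ha0 hax hxb).le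
    have h2 := (hs.lam_right_pos ha0 hax hxb).le
    have hwa := hw.pos a
    have hwb := hw.pos b
    refine Or.inr ⟨a, b, ha0, hax, hxb, ?_, eq_of_isHarmonicMeasure hω hρ (by positivity)
      (by positivity) ha hb (isHarmonicMeasure_of_Ioo hs hw ha0 hax hxb ha hb hab)⟩
    rw [← closure_Ioo (hax.trans hxb).ne]
    exact closure_mono hab

/-- Hyperharmonicity expressed on intervals, for the weight `1`. -/
structure Hyp (s : Om → ℝ) (U : Set Om) (f : Om → EReal) : Prop where
  lsc : LowerSemicontinuousOn f U
  ne_bot : ∀ x ∈ U, f x ≠ ⊥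
  two : ∀ a x b : Om, 0 < (a : ℝ) → a < x → x < b → Icc a b ⊆ U →
    (lam s a b x : EReal) * f a + (lam s b a x : EReal) * f b ≤ f x
  one : ∀ x b : Om, x < b → Iic b ⊆ U → f b ≤ f x

/-- Multiplying by the weight at the interior point turns the mean value inequality of the weighted
sheaf into the unweighted one for the functions multiplied by the weight. -/
theorem EReal.weighted_le_iff {c d ca cb cx : ℝ} (hca : 0 < ca) (hcb : 0 < cb) (hcx : 0 < cx)
    {A B C : EReal} :
    ((ca / cx * c : ℝ) : EReal) * A + ((cb / cx * d : ℝ) : EReal) * B ≤ C ↔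
      (c : EReal) * (ca * A) + d * (cb * B) ≤ cx * C := by
  rw [← EReal.coe_mul_le_coe_mul_iff hcx, EReal.coe_mul_add hcx.le, ← mul_assoc, ← mul_assoc,
    ← mul_assoc, ← mul_assoc, ← EReal.coe_mul, ← EReal.coe_mul, ← EReal.coe_mul, ← EReal.coe_mul]
  have e1 : cx * (ca / cx * c) = c * ca := by field_simp
  have e2 : cx * (cb / cx * d) = d * cb := by field_simp
  rw [e1, e2]

/-- All harmonic measures are those of the intervals [0, b[ and ]a, b[ with a > 0, and these
intervals are themselves regular, so it suffices to test on them. -/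
theorem isHyperharmonic_wSheaf_iff (hs : IsScale s) (hw : IsWeight w) {U : Opens Om}
    {u : Om → EReal} :
    IsHyperharmonic (wSheaf s w) U u ↔ Hyp s U fun x => (w x : EReal) * u x := by
  have hone {b x : Om} (hub : u b ≠ ⊥) : upperIntegral (twoPt 0 (w b / w x) b b) u ≤ u x ↔
      (w b : EReal) * u b ≤ (w x : EReal) * u x := by
    rw [upperIntegral_twoPt le_rfl (div_pos (hw.pos b) (hw.pos x)).le hub hub]
    have := EReal.weighted_le_iff (hw.pos b) (hw.pos b) (hw.pos x) (c := 0) (d := 1) (A := u b) (B := u b) (C := u x)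
    simpa using this
  have htwo {a b x : Om} (ha0 : 0 < (a : ℝ)) (hax : a < x) (hxb : x < b) (hua : u a ≠ ⊥)
      (hub : u b ≠ ⊥) :
      upperIntegral (twoPt (w a / w x * lam s a b x) (w b / w x * lam s b a x) a b) u ≤ u x ↔
      (lam s a b x : EReal) * (w a * u a) + (lam s b a x : EReal) * (w b * u b) ≤ w x * u x := by
    have h1 := (hs.lam_left_pos ha0 hax hxb).le
    have h2 := (hs.lam_right_pos ha0 hax hxb).le
    have hwa := hw.pos a
    have hwb := hw.pos b
    have hwx := hw.pos x
    rw [upperIntegral_twoPt (by positivity) (by positivity) hua hub]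
    exact EReal.weighted_le_iff hwa hwb hwx
  constructor
  · intro h
    refine ⟨lsc_weight_mul hw h.lsc, fun x hx => EReal.coe_mul_ne_bot (hw.pos x).le (h.ne_bot x hx),
      fun a x b ha0 hax hxb hU => ?_, fun x b hxb hU => ?_⟩
    · have hfr := frontier_Ioo_Om (hax.trans hxb)
      refine (htwo ha0 hax hxb (h.ne_bot a (hU ⟨le_rfl, (hax.trans hxb).le⟩))
        (h.ne_bot b (hU ⟨(hax.trans hxb).le, le_rfl⟩))).mp
        (h.mean_le ⟨Ioo a b, isOpen_Ioo⟩ (isRegular_Ioo hs hw ha0 (hax.trans hxb)) ?_ x ⟨hax, hxb⟩ _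
          (isHarmonicMeasure_of_Ioo hs hw ha0 hax hxb (by simp [hfr]) (by simp [hfr]) Subset.rfl))
      change closure (Ioo a b) ⊆ _
      rwa [closure_Ioo (hax.trans hxb).ne]
    · have hfr := frontier_Iio_Om (Om.pos_of_lt hxb)
      refine (hone (h.ne_bot b (hU self_mem_Iic))).mp
        (h.mean_le ⟨Iio b, isOpen_Iio⟩ (isRegular_Iio hs hw (Om.pos_of_lt hxb)) ?_ x hxb _
          (isHarmonicMeasure_of_Iio hs hw hxb (by simp [hfr]) Subset.rfl))
      change closure (Iio b) ⊆ _
      rwa [closure_Iio_Om (Om.pos_of_lt hxb)]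
  · intro h
    have hnb : ∀ x ∈ U, u x ≠ ⊥ := fun x hx =>
      (EReal.coe_mul_ne_bot_iff (hw.pos x)).mp (h.ne_bot x hx)
    refine ⟨(lsc_weight_mul_iff hw).mp h.lsc, hnb, fun ω hω hωU x hx ρ hρ => ?_⟩
    rcases isHarmonicMeasure_cases hs hw hω hx hρ with ⟨b, hxb, hbω, rfl⟩ |
      ⟨a, b, ha0, hax, hxb, hab, rfl⟩
    · exact (hone (hnb b (hωU (hbω self_mem_Iic)))).mpr (h.one x b hxb (hbω.trans hωU))
    · exact (htwo ha0 hax hxb (hnb a (hωU (hab ⟨le_rfl, (hax.trans hxb).le⟩)))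
        (hnb b (hωU (hab ⟨(hax.trans hxb).le, le_rfl⟩)))).mpr
        (h.two a x b ha0 hax hxb (hab.trans hωU))

end Dirichlet


/-! ### Green functions -/

/-- A scale with the value `+∞` at `0`. -/
def topScale (s : Om → ℝ) (x : Om) : EReal := if (x : ℝ) = 0 then ⊤ else (s x : EReal)

/-- The Green function of a scale. -/
def green (s : Om → ℝ) (y x : Om) : EReal := if x ≤ y then topScale s y - 1 else topScale s x - 1

theorem topScale_of_pos (s : Om → ℝ) {x : Om} (hx : 0 < (x : ℝ)) : topScale s x = s x :=
  if_neg hx.ne'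

theorem topScale_zero (s : Om → ℝ) : topScale s zeroOm = ⊤ := if_pos rfl

theorem exGreen₁_eq : exGreen₁ = green scale₁ := rfl

theorem exGreen₂_eq : exGreen₂ = green scale₂ := by
  funext y x
  simp [exGreen₂, green, topScale, invTop, scale₂]

theorem green_eq_max (s : Om → ℝ) (y x : Om) : green s y x = topScale s (max x y) - 1 := by
  rw [green]
  split_ifs with h
  · rw [max_eq_right h]
  · rw [max_eq_left (not_le.mp h).le]

theorem green_comm (s : Om → ℝ) (y x : Om) : green s y x = green s x y := by
  rw [green_eq_max, green_eq_max, max_comm]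

theorem green_coe (s : Om → ℝ) {y x : Om} (h : 0 < ((max x y : Om) : ℝ)) :
    green s y x = ((s (max x y) - 1 : ℝ) : EReal) := by
  rw [green_eq_max, topScale_of_pos s h]
  norm_cast

theorem green_of_le (s : Om → ℝ) {y x : Om} (hy : 0 < (y : ℝ)) (h : x ≤ y) :
    green s y x = ((s y - 1 : ℝ) : EReal) := by
  rw [green_coe s (by rwa [max_eq_right h]), max_eq_right h]

theorem green_of_ge (s : Om → ℝ) {y x : Om} (hx : 0 < (x : ℝ)) (h : y ≤ x) :
    green s y x = ((s x - 1 : ℝ) : EReal) := by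
  rw [green_coe s (by rwa [max_eq_left h]), max_eq_left h]

theorem green_zero_zero (s : Om → ℝ) : green s zeroOm zeroOm = ⊤ := by
  rw [green_eq_max, max_self, topScale_zero]
  rfl

theorem max_pos_of_left {x : Om} (hx : 0 < (x : ℝ)) (y : Om) : 0 < ((max x y : Om) : ℝ) :=
  lt_of_lt_of_le hx (le_max_left x y : (x : ℝ) ≤ (max x y : Om))

theorem max_pos_of_right {y : Om} (hy : 0 < (y : ℝ)) (x : Om) : 0 < ((max x y : Om) : ℝ) := by
  rw [max_comm]
  exact max_pos_of_left hy x

theorem green_eq_top_iff (s : Om → ℝ) (y x : Om) :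
    green s y x = ⊤ ↔ y = zeroOm ∧ x = zeroOm := by
  constructor
  · intro h
    by_contra hne
    have hpos : 0 < ((max x y : Om) : ℝ) := by
      rcases Om.eq_zero_or_pos x with hx | hx
      · rcases Om.eq_zero_or_pos y with hy | hy
        · exact absurd ⟨hy, hx⟩ hne
        · exact max_pos_of_right hy x
      · exact max_pos_of_left hx y
    rw [green_coe s hpos] at h
    exact EReal.coe_ne_top _ h
  · rintro ⟨rfl, rfl⟩
    exact green_zero_zero s

section Scale

variable {s w : Om → ℝ}

theorem IsScale.anti_le (hs : IsScale s) {x y : Om} (hx : 0 < (x : ℝ)) (h : x ≤ y) : s y ≤ s x := by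
  rcases h.eq_or_lt with rfl | h
  · exact le_rfl
  · exact (hs.anti x y hx h).le

theorem continuous_topScale (hs : IsScale s) : Continuous (topScale s) := by
  rw [continuous_iff_continuousAt]
  intro x
  rcases Om.eq_zero_or_pos x with rfl | hx
  · have h : Tendsto (topScale s) (𝓝[>] zeroOm) (𝓝 ⊤) := by
      refine (EReal.tendsto_coe_nhds_top_iff.mpr hs.tendsto_zero).congr' ?_
      filter_upwards [self_mem_nhdsWithin] with y hy
      exact (topScale_of_pos s (zeroOm_lt_iff.mp hy)).symm
    have h' : ContinuousWithinAt (topScale s) (Ioi zeroOm) zeroOm := by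
      rw [ContinuousWithinAt, topScale_zero]
      exact h
    have h2 := h'.insert
    rw [Ioi_insert] at h2
    refine h2.continuousAt ?_
    rw [show Ici zeroOm = univ from eq_univ_of_forall zeroOm_le]
    exact univ_mem
  · have h := (continuous_coe_real_ereal.continuousAt.comp (hs.cont x hx))
    refine h.congr ?_
    filter_upwards [eventually_pos hx] with y hy
    exact (topScale_of_pos s hy).symm

theorem continuous_sub_one : Continuous fun z : EReal => z - 1 := by
  rw [continuous_iff_continuousAt]
  intro z
  have h : ContinuousAt (fun p : EReal × EReal => p.1 + p.2) (z, -1) :=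
    EReal.continuousAt_add (Or.inr (show (-1 : EReal) ≠ ⊥ by decide))
      (Or.inr (show (-1 : EReal) ≠ ⊤ by decide))
  exact h.comp (f := fun z : EReal => (z, -1)) (by fun_prop)

theorem continuous_green (hs : IsScale s) : Continuous fun z : Om × Om => green s z.2 z.1 := by
  simp only [green_eq_max]
  exact continuous_sub_one.comp ((continuous_topScale hs).comp (continuous_fst.max continuous_snd))

theorem continuous_green_right (hs : IsScale s) (y : Om) : Continuous (green s y) :=
  (continuous_green hs).comp (f := fun x => (x, y)) (by fun_prop)

theorem continuous_green_left (hs : IsScale s) (x : Om) : Continuous fun y => green s y x :=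
  (continuous_green hs).comp (f := fun y => (x, y)) (by fun_prop)

theorem green_nonneg (hs : IsScale s) (y x : Om) : 0 ≤ green s y x := by
  by_cases h : 0 < ((max x y : Om) : ℝ)
  · rw [green_coe s h]
    have := hs.one_lt _ h
    exact_mod_cast (by linarith : (0 : ℝ) ≤ s (max x y) - 1)
  · rw [green_eq_max, Om.eq_zero_of_not_pos h, topScale_zero]
    exact le_top

theorem green_antitone (hs : IsScale s) (y : Om) : Antitone (green s y) := by
  intro x z hxz
  by_cases h : 0 < ((max x y : Om) : ℝ)
  · have hm : max x y ≤ max z y := max_le_max_right y hxz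
    rw [green_coe s h, green_coe s (lt_of_lt_of_le h hm)]
    have := hs.anti_le h hm
    exact_mod_cast (by linarith : s (max z y) - 1 ≤ s (max x y) - 1)
  · rw [green_eq_max s y x, Om.eq_zero_of_not_pos h, topScale_zero]
    exact le_top

/-- Away from 0 this is min (s x) (s y) - 1 (for y = 0 simply s x - 1), a minimum of functions
affine in s, hence concave in s and decreasing in x. -/
theorem hyp_green (hs : IsScale s) (U : Set Om) (y : Om) : Hyp s U (green s y) where
  lsc := (continuous_green_right hs y).lowerSemicontinuous.lowerSemicontinuousOn U
  ne_bot x _ h := by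
    have := green_nonneg hs y x
    rw [h] at this
    exact absurd this (by simp)
  two a x b ha hax hxb _ := by
    have h1 := hs.lam_left_pos ha hax hxb
    have h2 := hs.lam_right_pos ha hax hxb
    have hx := ha.trans hax
    have hb := hx.trans hxb
    rw [green_coe s (max_pos_of_left ha y), green_coe s (max_pos_of_left hx y),
      green_coe s (max_pos_of_left hb y), ← EReal.coe_mul, ← EReal.coe_mul, ← EReal.coe_add,
      EReal.coe_le_coe_iff]
    have hsum := hs.lam_add ha (hax.trans hxb) x
    have hval := hs.lam_mul_add ha (hax.trans hxb) x
    have ea := hs.anti_le ha (le_max_left a y)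
    have eb := hs.anti_le hb (le_max_left b y)
    rcases le_total x y with h | h
    · rw [max_eq_right h, max_eq_right (hax.le.trans h)]
      have := hs.anti_le (lt_of_lt_of_le hx h) (le_max_right b y)
      have e : lam s a b x * (s y - 1) + lam s b a x * (s y - 1) = s y - 1 := by
        rw [← add_mul, hsum, one_mul]
      nlinarith
    · rw [max_eq_left h]
      nlinarith
  one x b hxb _ := green_antitone hs y hxb.le

/-! ### Harmonic functions and potentials on the whole space -/

/-- Ω is an interval containing 0, so the term in s disappears and only constants remain. -/
theorem coef_global (hs : IsScale s) {h : Om → ℝ} (hh : h ∈ wSheaf s w ⊤) :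
    ∃ α, ∀ x, w x * h x = α := by
  obtain ⟨α, β, h0, hr⟩ := exists_coef_on hs hh (S := univ) ordConnected_univ (subset_univ _)
  refine ⟨α, fun x => ?_⟩
  rw [hr x (mem_univ x), h0 zeroOm (mem_univ _) rfl, zero_mul, add_zero]

theorem const_div_mem_wSheaf (hw : IsWeight w) (U : Opens Om) (α : ℝ) :
    (fun x => α / w x) ∈ wSheaf s w U :=
  mem_wSheaf_of_eqOn α 0 (fun _ => rfl) fun x _ => by
    rw [mul_div_cancel₀ _ (hw.pos x).ne', zero_mul, add_zero]

theorem Hyp.antitone {f : Om → EReal} (hf : Hyp s univ f) : Antitone f := by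
  intro x y hxy
  rcases hxy.eq_or_lt with rfl | h
  · exact le_rfl
  · exact hf.one x y h (subset_univ _)

theorem isSuperharmonic_iff_dense {𝓚 : Opens Om → Set (Om → ℝ)} {u : Om → EReal} :
    IsSuperharmonic 𝓚 ⊤ u ↔ IsHyperharmonic 𝓚 ⊤ u ∧ Dense {x | u x ≠ ⊤} := by
  rw [IsSuperharmonic, dense_iff_closure_eq, ← univ_subset_iff]
  simp

/-- By concavity in s, an infinite value at a positive point spreads to an interval on its right,
against the density of the finite values. Only 0 can be a pole. -/
theorem Hyp.ne_top (hs : IsScale s) {f : Om → EReal} (hf : Hyp s univ f) (hd : Dense {x | f x ≠ ⊤})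
    {x : Om} (hx : 0 < (x : ℝ)) : f x ≠ ⊤ := by
  intro htop
  obtain ⟨b, hb⟩ := Om.exists_gt x
  obtain ⟨y, hy, hyf⟩ := hd.inter_open_nonempty (Ioo x b) isOpen_Ioo
    ((Om.exists_between hb).imp fun _ h => ⟨h.1, h.2⟩)
  have h := hf.two x y b hx hy.1 hy.2 (subset_univ _)
  rw [htop, EReal.coe_mul_top_of_pos (hs.lam_left_pos hx hy.1 hy.2), EReal.top_add_of_ne_bot
    (EReal.coe_mul_ne_bot (hs.lam_right_pos hx hy.1 hy.2).le (hf.ne_bot b (mem_univ b)))] at h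
  exact hyf (top_le_iff.mp h)

theorem dense_ne_zeroOm : Dense {x : Om | 0 < (x : ℝ)} := by
  intro x
  rw [mem_closure_iff_nhds]
  intro t ht
  obtain ⟨y, z, hy, -, hyt, -⟩ := exists_two_points (x := x) (p := fun y => y ∈ t) ht
  exact ⟨y, hyt, hy⟩

/-- The nonnegative harmonic functions on Ω are the functions α / w with α ≥ 0. Hence p has no
nonzero harmonic minorant of this kind exactly when w p takes arbitrarily small values. -/
theorem isPotential_wSheaf_iff (hs : IsScale s) (hw : IsWeight w) {p : Om → EReal} :
    IsPotential (wSheaf s w) p ↔ Hyp s univ (fun x => (w x : EReal) * p x) ∧ (∀ x, 0 ≤ p x) ∧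
      Dense {x | p x ≠ ⊤} ∧ ∀ ε : ℝ, 0 < ε → ∃ x, (w x : EReal) * p x < ε := by
  rw [IsPotential, posSuperharmonic, mem_ofPred_eq, isSuperharmonic_iff_dense,
    isHyperharmonic_wSheaf_iff hs hw]
  constructor
  · rintro ⟨⟨⟨h1, h2⟩, h3⟩, h4⟩
    refine ⟨h1, h3, h2, fun ε hε => ?_⟩
    by_contra! hcon
    have := h4 _ (const_div_mem_wSheaf hw ⊤ ε) (fun x => (div_pos hε (hw.pos x)).le) (fun x => by
      rw [← EReal.coe_mul_le_coe_mul_iff (hw.pos x), ← EReal.coe_mul,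
        mul_div_cancel₀ _ (hw.pos x).ne']
      exact hcon x) zeroOm
    exact (div_pos hε (hw.pos _)).ne' this
  · rintro ⟨h1, h3, h2, h4⟩
    refine ⟨⟨⟨h1, h2⟩, h3⟩, fun h hh h0 hp => ?_⟩
    obtain ⟨α, hα⟩ := coef_global hs hh
    have hα0 : α = 0 := by
      refine le_antisymm (le_of_forall_pos_le_add fun ε hε => ?_) ?_
      · obtain ⟨x, hx⟩ := h4 ε hε
        have := ((EReal.coe_mul_le_coe_mul_iff (hw.pos x)).mpr (hp x)).trans hx.le
        rw [← EReal.coe_mul, hα, EReal.coe_le_coe_iff] at this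
        linarith
      · rw [← hα zeroOm]
        exact mul_nonneg (hw.pos _).le (h0 _)
    intro x
    have := hα x
    rw [hα0] at this
    exact (mul_eq_zero.mp this).resolve_left (hw.pos x).ne'

/-- The Green function of the weighted sheaf. -/
def wGreen (s w : Om → ℝ) (y x : Om) : EReal := ((1 / w x : ℝ) : EReal) * green s y x

theorem wGreen_one (s : Om → ℝ) : wGreen s (fun _ => 1) = green s := by
  funext y x
  simp [wGreen]

theorem weight_mul_wGreen (hw : IsWeight w) (y x : Om) :
    (w x : EReal) * wGreen s w y x = green s y x :=
  EReal.coe_mul_inv_cancel (hw.pos x).ne' _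

theorem exists_green_lt (hs : IsScale s) (y : Om) {ε : ℝ} (hε : 0 < ε) :
    ∃ x, green s y x < ε := by
  obtain ⟨x, hx, hxε⟩ := hs.exists_lt (1 + ε) (by linarith)
  refine ⟨max x y, ?_⟩
  rw [green_of_ge s (max_pos_of_left hx y) (le_max_right x y), EReal.coe_lt_coe_iff]
  have := hs.anti_le hx (le_max_left x y)
  linarith

theorem isPotential_wGreen (hs : IsScale s) (hw : IsWeight w) (y : Om) :
    IsPotential (wSheaf s w) (wGreen s w y) := by
  rw [isPotential_wSheaf_iff hs hw]
  simp only [weight_mul_wGreen hw]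
  refine ⟨hyp_green hs _ y, fun x => EReal.mul_nonneg ?_ (green_nonneg hs y x), ?_,
    fun ε hε => exists_green_lt hs y hε⟩
  · exact_mod_cast (one_div_pos.mpr (hw.pos x)).le
  · refine dense_ne_zeroOm.mono fun x hx => ?_
    rw [mem_ofPred_eq, wGreen, EReal.coe_mul_ne_top (one_div_pos.mpr (hw.pos x)), Ne,
      green_eq_top_iff]
    rintro ⟨-, rfl⟩
    exact lt_irrefl _ (zeroOm_lt_iff.mpr hx)

theorem harmonicSupport_wGreen (hs : IsScale s) (hw : IsWeight w) (y : Om) :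
    harmonicSupport (wSheaf s w) (wGreen s w y) = {y} := by
  ext x
  rw [mem_singleton_iff]
  constructor
  · intro hx
    by_contra hne
    rcases lt_or_gt_of_ne hne with h | h
    · refine hx ⟨Iio y, isOpen_Iio⟩ h ⟨_, const_div_mem_wSheaf hw _ (s y - 1), fun z hz => ?_⟩
      rw [wGreen, green_of_le s (Om.pos_of_lt h) (le_of_lt hz), ← EReal.coe_mul]
      congr 1
      ring
    · refine hx ⟨Ioi y, isOpen_Ioi⟩ h ⟨fun z => (s z - 1) / w z,
        mem_wSheaf_of_eqOn (-1) 1 (fun h => absurd h (not_lt.mpr (zeroOm_le y))) fun z _ => ?_,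
        fun z hz => ?_⟩
      · rw [mul_div_cancel₀ _ (hw.pos z).ne']
        ring
      · rw [wGreen, green_of_ge s (Om.pos_of_lt hz) (le_of_lt hz), ← EReal.coe_mul]
        congr 1
        ring
  · rintro rfl U hxU ⟨h, hh, he⟩
    obtain ⟨α, β, h0, hr⟩ := hh x hxU
    have hr' : ∀ᶠ z in 𝓝 x, green s x z = ((α + β * s z : ℝ) : EReal) := by
      filter_upwards [hr, U.isOpen.mem_nhds hxU] with z hz hzU
      rw [← hz, EReal.coe_mul, ← he z hzU, weight_mul_wGreen hw]
    rcases Om.eq_zero_or_pos x with rfl | hx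
    · have := hr'.self_of_nhds
      rw [green_zero_zero] at this
      exact EReal.coe_ne_top _ this.symm
    · obtain ⟨a, b, ha, hax, hxb, hab⟩ := nhds_pos_basis hx hr'
      have e1 : s x - 1 = α + β * s a := by
        have := hab ⟨le_rfl, (hax.trans hxb).le⟩
        rw [mem_ofPred_eq, green_of_le s hx hax.le, EReal.coe_eq_coe_iff] at this
        exact this
      have e2 : s x - 1 = α + β * s x := by
        have := hab ⟨hax.le, hxb.le⟩
        rw [mem_ofPred_eq, green_of_le s hx le_rfl, EReal.coe_eq_coe_iff] at this
        exact this
      have e3 : s b - 1 = α + β * s b := by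
        have := hab ⟨(hax.trans hxb).le, le_rfl⟩
        rw [mem_ofPred_eq, green_of_ge s (Om.pos_of_lt hxb) hxb.le, EReal.coe_eq_coe_iff] at this
        exact this
      have h1 := hs.anti a x ha hax
      have h2 := hs.anti x b hx hxb
      have hβ : β * (s a - s x) = 0 := by linarith
      rcases mul_eq_zero.mp hβ with h | h
      · rw [h] at e2 e3
        linarith
      · linarith

/-- The family of the Green functions is continuous for the topology of Hervé. -/
theorem isGreenFamily_wGreen (hs : IsScale s) (hw : IsWeight w) :
    IsGreenFamily (wSheaf s w) (wGreen s w) := by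
  refine ⟨fun y => ⟨isPotential_wGreen hs hw y, harmonicSupport_wGreen hs hw y⟩,
    fun y => (isPotential_wGreen hs hw y).1, ?_⟩
  refine continuous_iInf_rng.mpr fun ρ => continuous_iInf_rng.mpr ?_
  rintro ⟨ω, x, hω, -, -, hx, hρ⟩
  refine continuous_induced_rng.mpr ?_
  -- The harmonic measures are carried by one or two positive points `z`, and there the Green
  -- function is finite and continuous in `y`, also at y = 0.
  have hcont : ∀ c : ℝ, ∀ z : Om,
      0 < (z : ℝ) → Continuous fun y => ENNReal.ofReal c * (wGreen s w y z).toENNReal := by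
    intro c z hz
    refine (ENNReal.continuous_const_mul ENNReal.ofReal_ne_top).comp ?_
    refine Continuous.ereal_toENNReal ?_
    have : (fun y => wGreen s w y z) = fun y => ((1 / w z * (s (max z y) - 1) : ℝ) : EReal) := by
      funext y
      rw [wGreen, green_coe s (max_pos_of_left hz y), ← EReal.coe_mul]
    rw [this]
    refine continuous_coe_real_ereal.comp (continuous_const.mul (Continuous.sub ?_ continuous_const))
    rw [continuous_iff_continuousAt]
    intro y
    exact (hs.cont _ (max_pos_of_left hz y)).comp (f := fun y => max z y)
      (continuous_const.max continuous_id).continuousAt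
  rcases isHarmonicMeasure_cases hs hw hω hx hρ with ⟨b, hxb, -, rfl⟩ |
    ⟨a, b, ha0, hax, hxb, -, rfl⟩
  · simp only [Function.comp_def, lintegral_twoPt]
    exact (hcont _ b (Om.pos_of_lt hxb)).add (hcont _ b (Om.pos_of_lt hxb))
  · simp only [Function.comp_def, lintegral_twoPt]
    exact (hcont _ a ha0).add (hcont _ b (Om.pos_of_lt hxb))

/-! ### Bauer and Brelot spaces -/

theorem isTopologicalBasis_of_intervals {B : Set (Set Om)} (hB : ∀ V ∈ B, IsOpen V)
    (h0 : ∀ b : Om, 0 < (b : ℝ) → Iio b ∈ B)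
    (h1 : ∀ a b : Om, 0 < (a : ℝ) → a < b → Ioo a b ∈ B) : IsTopologicalBasis B := by
  refine isTopologicalBasis_of_isOpen_of_nhds hB fun x U hx hU => ?_
  rcases Om.eq_zero_or_pos x with rfl | hx0
  · obtain ⟨b, hb, h⟩ := nhds_zeroOm_basis (hU.mem_nhds hx)
    exact ⟨Iio b, h0 b hb, hb, Iio_subset_Iic_self.trans h⟩
  · obtain ⟨a, b, ha, hax, hxb, h⟩ := nhds_pos_basis hx0 (hU.mem_nhds hx)
    exact ⟨Ioo a b, h1 a b ha (hax.trans hxb), ⟨hax, hxb⟩, Ioo_subset_Icc_self.trans h⟩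

theorem isBauerHarmonicSpace_wSheaf (hs : IsScale s) (hw : IsWeight w) :
    IsBauerHarmonicSpace (wSheaf s w) where
  locallyCompact := inferInstance
  hausdorff := inferInstance
  countableBase := inferInstance
  sheaf := isFunctionSheaf_wSheaf hs hw
  base := isTopologicalBasis_of_intervals (by rintro _ ⟨ω, rfl, -⟩; exact ω.isOpen)
    (fun _ hb => ⟨_, rfl, isRegular_Iio hs hw hb⟩)
    (fun _ _ ha hab => ⟨_, rfl, isRegular_Ioo hs hw ha hab⟩)
  convergence U h g hh _ _ hlim := wSheaf_of_tendsto hs hh hlim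
  positivity x := ⟨⊤, trivial, _, const_div_mem_wSheaf hw ⊤ 1, (one_div_pos.mpr (hw.pos x)).ne'⟩
  separation x₀ := by
    -- The quotient of the two functions is the Green function of pole 0, which is strictly
    -- decreasing on Ω (infinite at 0) and so separates points.
    refine ⟨⊤, trivial, fun x _ y _ hxy => ⟨fun x => ((1 / w x : ℝ) : EReal), wGreen s w zeroOm,
      ?_, fun z _ => ?_, ?_, fun z _ => ?_, ?_⟩⟩
    · rw [isHyperharmonic_wSheaf_iff hs hw]
      have : (fun x => (w x : EReal) * ((1 / w x : ℝ) : EReal)) = fun _ => 1 := by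
        funext x
        have := EReal.coe_mul_inv_cancel (hw.pos x).ne' 1
        rwa [mul_one] at this
      rw [this]
      refine ⟨lowerSemicontinuousOn_const, fun x _ => by decide, fun a x b ha hax hxb _ => ?_,
        fun _ _ _ _ => le_rfl⟩
      rw [mul_one, mul_one, ← EReal.coe_add, hs.lam_add ha (hax.trans hxb)]
      rfl
    · exact EReal.coe_nonneg.mpr (one_div_pos.mpr (hw.pos z)).le
    · rw [isHyperharmonic_wSheaf_iff hs hw]
      simp only [weight_mul_wGreen hw]
      exact hyp_green hs _ _
    · exact ((isPotential_wGreen hs hw zeroOm).1.2 z)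
    · intro h
      have key : green s zeroOm y = green s zeroOm x := by
        have h' := congrArg (fun z => (w x : EReal) * ((w y : EReal) * z)) h
        simp only [wGreen] at h'
        have e1 : (w x : EReal) * (w y * (((1 / w x : ℝ) : EReal) *
            (((1 / w y : ℝ) : EReal) * green s zeroOm y))) = green s zeroOm y := by
          rw [mul_left_comm (w y : EReal), EReal.coe_mul_inv_cancel (hw.pos y).ne',
            EReal.coe_mul_inv_cancel (hw.pos x).ne']
        have e2 : (w x : EReal) * (w y * (((1 / w y : ℝ) : EReal) *
            (((1 / w x : ℝ) : EReal) * green s zeroOm x))) = green s zeroOm x := by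
          rw [EReal.coe_mul_inv_cancel (hw.pos y).ne', EReal.coe_mul_inv_cancel (hw.pos x).ne']
        rw [← e1, ← e2]
        exact h'
      have hlt : ∀ x y : Om, x < y → green s zeroOm y < green s zeroOm x := by
        intro x y hxy
        have hy := Om.pos_of_lt hxy
        rw [green_of_ge s hy (zeroOm_le y)]
        rcases Om.eq_zero_or_pos x with rfl | hx
        · rw [green_zero_zero]
          exact EReal.coe_lt_top _
        · rw [green_of_ge s hx (zeroOm_le x), EReal.coe_lt_coe_iff]
          have := hs.anti x y hx hxy
          linarith
      rcases lt_or_gt_of_ne hxy with h1 | h1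
      · exact (hlt x y h1).ne key
      · exact (hlt y x h1).ne key.symm

/-- A bound in the Harnack inequality. -/
theorem exists_harnack (hs : IsScale s) (hw : IsWeight w) {U : Opens Om}
    (hU : IsConnected (U : Set Om)) {x₀ x : Om} (hx₀ : x₀ ∈ U) (hx : x ∈ U) :
    ∃ C : ℝ, 0 ≤ C ∧ ∀ h ∈ wSheaf s w U, (∀ z ∈ U, 0 ≤ h z) → h x ≤ C * h x₀ := by
  have hUc : (U : Set Om).OrdConnected := by
    refine ⟨fun a ha b hb z hz => ?_⟩
    exact hU.isPreconnected.Icc_subset ha hb hz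
  by_cases h0 : zeroOm ∈ U
  · refine ⟨w x₀ / w x, (div_pos (hw.pos _) (hw.pos _)).le, fun h hh _ => ?_⟩
    obtain ⟨α, β, hβ, hr⟩ := exists_coef_on hs hh hUc Subset.rfl
    have e1 := hr x hx
    have e2 := hr x₀ hx₀
    rw [hβ zeroOm h0 rfl, zero_mul, add_zero] at e1 e2
    rw [div_mul_eq_mul_div, e2, ← e1, mul_div_cancel_left₀ _ (hw.pos x).ne']
  · have hpos : ∀ z ∈ U, 0 < (z : ℝ) := fun z hz =>
      (Om.eq_zero_or_pos z).resolve_left fun h => h0 (h ▸ hz)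
    have hwx := hw.pos x
    have hwx₀ := hw.pos x₀
    -- The points `a` and `b` lie on either side of `x₀`. Interpolate w h at `x₀` between `x` and
    -- the one on the other side, and drop the nonnegative term of the latter.
    obtain ⟨a, b, ha, hax, hxb, hab⟩ := nhds_pos_basis (hpos x₀ hx₀) (U.isOpen.mem_nhds hx₀)
    have haU : a ∈ U := hab ⟨le_rfl, (hax.trans hxb).le⟩
    have hbU : b ∈ U := hab ⟨(hax.trans hxb).le, le_rfl⟩
    rcases lt_trichotomy x x₀ with hlt | rfl | hlt
    · have hl := hs.lam_left_pos (hpos x hx) hlt hxb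
      have hr := hs.lam_right_pos (hpos x hx) hlt hxb
      refine ⟨w x₀ / (lam s x b x₀ * w x), by positivity, fun h hh hn => ?_⟩
      obtain ⟨α, β, -, hrep⟩ := exists_coef_on hs hh hUc Subset.rfl
      have e := hs.interp (hpos x hx) (hlt.trans hxb) x₀ α β
      rw [← hrep x hx, ← hrep b hbU, ← hrep x₀ hx₀] at e
      rw [div_mul_eq_mul_div, le_div_iff₀ (by positivity)]
      have := mul_nonneg hr.le (mul_nonneg (hw.pos b).le (hn b hbU))
      linarith
    · exact ⟨1, zero_le_one, fun h _ _ => by rw [one_mul]⟩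
    · have hl := hs.lam_left_pos ha hax hlt
      have hr := hs.lam_right_pos ha hax hlt
      refine ⟨w x₀ / (lam s x a x₀ * w x), by positivity, fun h hh hn => ?_⟩
      obtain ⟨α, β, -, hrep⟩ := exists_coef_on hs hh hUc Subset.rfl
      have e := hs.interp ha (hax.trans hlt) x₀ α β
      rw [← hrep x hx, ← hrep a haU, ← hrep x₀ hx₀] at e
      rw [div_mul_eq_mul_div, le_div_iff₀ (by positivity)]
      have := mul_nonneg hl.le (mul_nonneg (hw.pos a).le (hn a haU))
      linarith

theorem sub_mem_wSheaf (hs : IsScale s) (hw : IsWeight w) {U : Opens Om} {f g : Om → ℝ}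
    (hf : f ∈ wSheaf s w U) (hg : g ∈ wSheaf s w U) : (fun x => f x - g x) ∈ wSheaf s w U := by
  have h := isFunctionSheaf_wSheaf hs hw
  refine h.congr U _ _ (fun x _ => ?_) (h.add_mem U f hf _ (h.smul_mem U (-1) g hg))
  ring

/-- If the envelope is finite at one point, Harnack's inequality for the nonnegative differences
with a fixed member bounds the family at every point. The family is then a pointwise convergent
increasing net, and pointwise limits of sections are sections. -/
theorem brelot_convergence (hs : IsScale s) (hw : IsWeight w) (U : Opens Om)
    (hU : IsConnected (U : Set Om)) (S : Set (Om → ℝ)) (hS : S ⊆ wSheaf s w U) (hne : S.Nonempty)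
    (hdir : DirectedOn (fun f g : Om → ℝ => ∀ x ∈ U, f x ≤ g x) S) :
    (∀ x ∈ U, ⨆ f ∈ S, (f x : EReal) = ⊤) ∨
      ∃ h ∈ wSheaf s w U, ∀ x ∈ U, ⨆ f ∈ S, (f x : EReal) = (h x : EReal) := by
  by_cases hcase : ∀ x ∈ U, ⨆ f ∈ S, (f x : EReal) = ⊤
  · exact Or.inl hcase
  right
  push Not at hcase
  obtain ⟨x₀, hx₀, hfin⟩ := hcase
  obtain ⟨f₀, hf₀⟩ := hne
  obtain ⟨M, hM, -⟩ := EReal.lt_iff_exists_real_btwn.mp (lt_top_iff_ne_top.mpr hfin)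
  have hMb : ∀ f ∈ S, f x₀ ≤ M := fun f hf => by
    have := (le_iSup₂ (f := fun (f : Om → ℝ) (_ : f ∈ S) => (f x₀ : EReal)) f hf).trans hM.le
    exact_mod_cast this
  have hbound : ∀ x ∈ U, ∃ B : ℝ, ∀ f ∈ S, f x ≤ B := by
    intro x hx
    obtain ⟨C, hC, hCh⟩ := exists_harnack hs hw hU hx₀ hx
    refine ⟨f₀ x + C * (M - f₀ x₀), fun f hf => ?_⟩
    obtain ⟨g, hg, hfg, hf₀g⟩ := hdir f hf f₀ hf₀
    have h1 := hCh _ (sub_mem_wSheaf hs hw (hS hg) (hS hf₀)) fun z hz => sub_nonneg.mpr (hf₀g z hz)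
    have h2 := hfg x hx
    have h3 := mul_le_mul_of_nonneg_left (hMb g hg) hC
    linarith
  obtain ⟨ι, F, rfl⟩ : ∃ (ι : Type) (F : ι → Om → ℝ), range F = S :=
    ⟨S, Subtype.val, Subtype.range_val⟩
  -- Comparison on `U` orders the indices, which makes the family itself a monotone net.
  let _ : Preorder ι :=
    { le := fun i j => ∀ x ∈ U, F i x ≤ F j x
      le_refl := fun i x _ => le_rfl
      le_trans := fun i j k h1 h2 x hx => (h1 x hx).trans (h2 x hx) }
  obtain ⟨i₀, -⟩ := hf₀
  have : Nonempty ι := ⟨i₀⟩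
  have : IsDirectedOrder ι := ⟨fun i j => by
    obtain ⟨_, ⟨k, rfl⟩, h1, h2⟩ := hdir _ (mem_range_self i) _ (mem_range_self j)
    exact ⟨k, h1, h2⟩⟩
  have hlim : ∀ x ∈ U, Tendsto (fun i => F i x) atTop (𝓝 (⨆ i, F i x)) := by
    intro x hx
    obtain ⟨B, hB⟩ := hbound x hx
    exact tendsto_atTop_ciSup (fun i j hij => hij x hx)
      ⟨B, by rintro _ ⟨i, rfl⟩; exact hB _ (mem_range_self i)⟩
  refine ⟨fun x => ⨆ i, F i x, wSheaf_of_tendsto hs (fun i => hS (mem_range_self i)) hlim,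
    fun x hx => ?_⟩
  rw [iSup_range]
  refine tendsto_nhds_unique (tendsto_atTop_iSup fun i j hij => ?_)
    ((continuous_coe_real_ereal.tendsto _).comp (hlim x hx))
  exact EReal.coe_le_coe_iff.mpr (hij x hx)

theorem isConnected_Ioo_Om {a b : Om} (h : a < b) : IsConnected (Ioo a b) :=
  ⟨(Om.exists_between h).imp fun _ h => ⟨h.1, h.2⟩,
    isPreconnected_of_ordConnected ordConnected_Ioo⟩

theorem isConnected_Iio_Om {b : Om} (h : 0 < (b : ℝ)) : IsConnected (Iio b) :=
  ⟨⟨zeroOm, h⟩, isPreconnected_of_ordConnected ordConnected_Iio⟩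

theorem isBrelotHarmonicSpace_wSheaf (hs : IsScale s) (hw : IsWeight w) :
    IsBrelotHarmonicSpace (wSheaf s w) where
  locallyCompact := inferInstance
  hausdorff := inferInstance
  countableBase := inferInstance
  connected := inferInstance
  locallyConnected := inferInstance
  noncompact := inferInstance
  sheaf := isFunctionSheaf_wSheaf hs hw
  base := isTopologicalBasis_of_intervals (by rintro _ ⟨ω, rfl, -⟩; exact ω.isOpen)
    (fun _ hb => ⟨_, rfl, isRegular_Iio hs hw hb, isConnected_Iio_Om hb⟩)
    (fun _ _ ha hab => ⟨_, rfl, isRegular_Ioo hs hw ha hab, isConnected_Ioo_Om hab⟩)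
  convergence := brelot_convergence hs hw

/-! ### Potentials of one-point support -/

/-- Harmonicity is local: off the support the harmonic representatives agree with the real values of
p and glue to one section. -/
theorem toReal_mem_wSheaf_compl {y : Om} {p : Om → EReal}
    (hsupp : harmonicSupport (wSheaf s w) p ⊆ {y}) {U : Opens Om} (hU : y ∉ U) :
    (fun x => (p x).toReal) ∈ wSheaf s w U ∧ ∀ x ∈ U, p x = ((p x).toReal : EReal) := by
  have h : ∀ x ∈ U, ∃ V : Opens Om, x ∈ V ∧ IsHarmonicOn (wSheaf s w) V p := by
    intro x hx
    by_contra! hcon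
    exact hU ((hsupp hcon : x = y) ▸ hx)
  constructor
  · intro x hx
    obtain ⟨V, hxV, g, hg, hpg⟩ := h x hx
    obtain ⟨α, β, h0, hr⟩ := hg x hxV
    refine ⟨α, β, h0, ?_⟩
    filter_upwards [hr, V.isOpen.mem_nhds hxV] with z hz hzV
    rw [hpg z hzV, EReal.toReal_coe, hz]
  · intro x hx
    obtain ⟨V, hxV, g, hg, hpg⟩ := h x hx
    rw [hpg x hxV, EReal.toReal_coe]

theorem harmonicSupport_zero_of_forall (hw : IsWeight w) {p : Om → EReal}
    (hp : ∀ x, (w x : EReal) * p x = 0) : harmonicSupport (wSheaf s w) p = ∅ := by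
  ext x
  simp only [mem_empty_iff_false, iff_false]
  intro h
  refine h ⊤ trivial ⟨_, const_div_mem_wSheaf hw ⊤ 0, fun z _ => ?_⟩
  have := congrArg (fun t => ((1 / w z : ℝ) : EReal) * t) (hp z)
  simp only [EReal.coe_inv_mul_cancel (hw.pos z).ne', mul_zero] at this
  rw [this, zero_div]
  rfl

/-- Potentials with the same one-point support are proportional. -/
theorem eq_mul_green_of_support (hs : IsScale s) (hw : IsWeight w) {p : Om → EReal} {y : Om}
    (hp : IsPotential (wSheaf s w) p) (hsupp : harmonicSupport (wSheaf s w) p = {y}) :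
    ∃ c : ℝ, 0 < c ∧ ∀ x, (w x : EReal) * p x = c * green s y x := by
  obtain ⟨hH, hp0, hd, hinf⟩ := (isPotential_wSheaf_iff hs hw).mp hp
  have hanti := hH.antitone
  set f : Om → EReal := fun x => (w x : EReal) * p x with hf
  have hf0 : ∀ x, 0 ≤ f x := fun x => EReal.mul_nonneg (by exact_mod_cast (hw.pos x).le) (hp0 x)
  have hnotzero : ¬ ∀ x, f x = 0 := fun h => by
    rw [harmonicSupport_zero_of_forall hw h] at hsupp
    exact (singleton_nonempty y).ne_empty hsupp.symm
  obtain ⟨hm1, he1⟩ := toReal_mem_wSheaf_compl hsupp.subset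
    (U := ⟨Ioi y, isOpen_Ioi⟩) (lt_irrefl y)
  obtain ⟨α, β, -, hr⟩ := exists_coef_on hs hm1 ordConnected_Ioi Subset.rfl
  have hfr : ∀ x, y < x → f x = ((α + β * s x : ℝ) : EReal) := fun x hx => by
    rw [← hr x hx, hf, EReal.coe_mul, ← he1 x hx]
  obtain ⟨y₁, hy₁⟩ := Om.exists_gt y
  obtain ⟨y₂, hy₂⟩ := Om.exists_gt y₁
  have hβ0 : 0 ≤ β := by
    have h1 := hanti hy₂.le
    rw [hfr y₁ hy₁, hfr y₂ (hy₁.trans hy₂), EReal.coe_le_coe_iff] at h1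
    have h2 := hs.anti y₁ y₂ (Om.pos_of_lt hy₁) hy₂
    by_contra hneg
    nlinarith
  -- Since s comes arbitrarily close to 1, α + β is the limit of `f` at the end 1. It is nonnegative
  -- because `f` is, and nonpositive because the infimum of the potential is 0.
  have hαβ1 : 0 ≤ α + β := by
    refine le_of_forall_pos_le_add fun ε hε => ?_
    obtain ⟨x, hx, hxε⟩ := hs.exists_lt (1 + ε / (β + 1)) (by
      have : 0 < ε / (β + 1) := by positivity
      linarith)
    have h1 := hf0 (max x y₁)
    rw [hfr _ (lt_of_lt_of_le hy₁ (le_max_right _ _))] at h1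
    have h1' : 0 ≤ α + β * s (max x y₁) := by exact_mod_cast h1
    have h2 := hs.anti_le hx (le_max_left x y₁)
    have h3 : β * (s (max x y₁) - 1) ≤ β * (ε / (β + 1)) :=
      mul_le_mul_of_nonneg_left (by linarith) hβ0
    have h4 : β * (ε / (β + 1)) ≤ ε := by
      rw [mul_div_assoc', div_le_iff₀ (by positivity)]
      nlinarith
    linarith
  have hαβ2 : α + β ≤ 0 := by
    refine le_of_forall_pos_le_add fun ε hε => ?_
    obtain ⟨x, hx⟩ := hinf ε hε
    have h1 : f (max x y₁) < ε := lt_of_le_of_lt (hanti (le_max_left x y₁)) hx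
    have hpos : y < max x y₁ := lt_of_lt_of_le hy₁ (le_max_right _ _)
    rw [hfr _ hpos, EReal.coe_lt_coe_iff] at h1
    have h2 := hs.one_lt _ (Om.pos_of_lt hpos)
    nlinarith
  have hα : α = -β := by linarith
  have hfr' : ∀ x, y < x → f x = ((β * (s x - 1) : ℝ) : EReal) := fun x hx => by
    rw [hfr x hx, hα]
    congr 1
    ring
  rcases Om.eq_zero_or_pos y with rfl | hy
  -- With β = 0, `f` vanishes off 0 and, by lower semicontinuity, at 0 as well; its support would be
  -- empty.
  · have hβ : 0 < β := by
      refine hβ0.lt_of_ne fun h => hnotzero fun x => ?_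
      have hpos : ∀ x, zeroOm < x → f x = 0 := fun x hx => by
        rw [hfr' x hx, ← h, zero_mul]
        rfl
      rcases Om.eq_zero_or_pos x with rfl | hx
      · refine le_antisymm (not_lt.mp fun hlt => ?_) (hf0 _)
        have := hH.lsc zeroOm (mem_univ _) 0 hlt
        rw [nhdsWithin_univ] at this
        obtain ⟨a, b, ha, -, hpa, -⟩ := exists_two_points this
        rw [hpos a ha] at hpa
        exact lt_irrefl _ hpa
      · exact hpos x hx
    refine ⟨β, hβ, fun x => ?_⟩
    change f x = _
    rcases Om.eq_zero_or_pos x with rfl | hx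
    · rw [green_zero_zero, EReal.coe_mul_top_of_pos hβ, EReal.eq_top_iff_forall_lt]
      intro r
      -- `f` is decreasing, so its value at 0 dominates the values β (s z - 1), which are unbounded.
      have h1 : ∀ᶠ z in 𝓝[>] zeroOm, r / β + 1 < s z := hs.tendsto_zero.eventually_gt_atTop _
      have hne : (𝓝[>] zeroOm).NeBot := nhdsGT_neBot zeroOm
      obtain ⟨z, hz, hz0⟩ := (h1.and self_mem_nhdsWithin).exists
      refine lt_of_lt_of_le ?_ (hanti (zeroOm_le z))
      rw [hfr' z hz0, EReal.coe_lt_coe_iff]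
      have : r / β < s z - 1 := by linarith
      rw [div_lt_iff₀ hβ] at this
      linarith
    · rw [hfr' x hx, green_of_ge s hx (zeroOm_le x), ← EReal.coe_mul]
  · obtain ⟨hm2, he2⟩ := toReal_mem_wSheaf_compl hsupp.subset
      (U := ⟨Iio y, isOpen_Iio⟩) (lt_irrefl y)
    obtain ⟨γ, δ, hδ, hrl⟩ := exists_coef_on hs hm2 ordConnected_Iio Subset.rfl
    have hfl : ∀ x, x < y → f x = (γ : EReal) := fun x hx => by
      have := hrl x hx
      rw [hδ zeroOm hy rfl, zero_mul, add_zero] at this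
      rw [← this, hf, EReal.coe_mul, ← he2 x hx]
    have hfy_top : f y ≠ ⊤ := hH.ne_top hs (hd.mono fun x hx =>
      (EReal.coe_mul_ne_top (hw.pos x)).mpr hx) hy
    obtain ⟨r, hr⟩ : ∃ r : ℝ, f y = r :=
      ⟨(f y).toReal, (EReal.coe_toReal hfy_top (hH.ne_bot y (mem_univ y))).symm⟩
    have hslim : Tendsto s (𝓝[>] y) (𝓝 (s y)) := (hs.cont y hy).mono_left nhdsWithin_le_nhds
    have hne : (𝓝[>] y).NeBot := nhdsGT_neBot y
    have hr1 : β * (s y - 1) ≤ r := by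
      refine le_of_tendsto ((hslim.sub_const 1).const_mul β) ?_
      filter_upwards [self_mem_nhdsWithin] with z hz
      have := hanti (le_of_lt hz)
      rwa [hfr' z hz, hr, EReal.coe_le_coe_iff] at this
    -- Lower semicontinuity at `y` excludes a value above the right limit; monotonicity gave the
    -- other inequality.
    have hr2 : r ≤ β * (s y - 1) := by
      by_contra! hlt
      have h1 : ((β * (s y - 1) : ℝ) : EReal) < f y := by
        rw [hr]
        exact_mod_cast hlt
      have := hH.lsc y (mem_univ _) _ h1
      rw [nhdsWithin_univ] at this
      obtain ⟨b, hb, hsub⟩ := exists_right_subset_of_mem_nhds this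
      have h2 : ((β * (s y - 1) : ℝ) : EReal) < f b := hsub ⟨hb.le, le_rfl⟩
      rw [hfr' b hb, EReal.coe_lt_coe_iff] at h2
      have := hs.anti y b hy hb
      nlinarith
    have hγ1 : r ≤ γ := by
      have h1 := hanti (zeroOm_le y)
      rwa [hr, hfl zeroOm hy, EReal.coe_le_coe_iff] at h1
    -- Concavity on ]a, y₁[ evaluated at `y`: as a increases to y the weight of `a` tends to 1, so
    -- `f` has no jump at `y` from the left either.
    have hγ2 : γ ≤ r := by
      have hnel : (𝓝[<] y).NeBot := nhdsLT_neBot_of_exists_lt ⟨zeroOm, hy⟩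
      have hsl : Tendsto s (𝓝[<] y) (𝓝 (s y)) := (hs.cont y hy).mono_left nhdsWithin_le_nhds
      have hd1 := hs.anti y y₁ hy hy₁
      have hlim1 : Tendsto (fun a => lam s a y₁ y) (𝓝[<] y) (𝓝 1) := by
        have := (tendsto_const_nhds (x := s y - s y₁)).div (hsl.sub_const (s y₁)) (by linarith)
        rwa [div_self (by linarith)] at this
      have hlim2 : Tendsto (fun a => lam s y₁ a y) (𝓝[<] y) (𝓝 0) := by
        have h1 : Tendsto (fun a => s y - s a) (𝓝[<] y) (𝓝 (s y - s y)) :=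
          tendsto_const_nhds.sub hsl
        have h2 : Tendsto (fun a => s y₁ - s a) (𝓝[<] y) (𝓝 (s y₁ - s y)) :=
          tendsto_const_nhds.sub hsl
        have := h1.div h2 (by linarith)
        rwa [sub_self, zero_div] at this
      have hlim := (hlim1.mul_const γ).add (hlim2.mul_const (β * (s y₁ - 1)))
      simp only [one_mul, zero_mul, add_zero] at hlim
      refine le_of_tendsto hlim ?_
      have hev : ∀ᶠ a in 𝓝[<] y, 0 < ((a : Om) : ℝ) :=
        (eventually_pos hy).filter_mono nhdsWithin_le_nhds
      filter_upwards [self_mem_nhdsWithin, hev] with a ha ha0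
      have := hH.two a y y₁ ha0 ha hy₁ (subset_univ _)
      rw [hr] at this
      change (lam s a y₁ y : EReal) * f a + (lam s y₁ a y : EReal) * f y₁ ≤ r at this
      rw [hfl a ha, hfr' y₁ hy₁, ← EReal.coe_mul, ← EReal.coe_mul, ← EReal.coe_add,
        EReal.coe_le_coe_iff] at this
      exact this
    have hγ : γ = β * (s y - 1) := by linarith
    have hβ : 0 < β := by
      refine hβ0.lt_of_ne fun h => hnotzero fun x => ?_
      rw [← h, zero_mul] at hγ
      rcases lt_trichotomy x y with hx | rfl | hx
      · rw [hfl x hx, hγ]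
        rfl
      · rw [hr, show r = 0 by linarith]
        rfl
      · rw [hfr' x hx, ← h, zero_mul]
        rfl
    refine ⟨β, hβ, fun x => ?_⟩
    change f x = _
    rcases lt_trichotomy x y with hx | rfl | hx
    · rw [hfl x hx, hγ, green_of_le s hy hx.le, ← EReal.coe_mul]
    · rw [hr, green_of_le s hy le_rfl, ← EReal.coe_mul, EReal.coe_eq_coe_iff]
      linarith
    · rw [hfr' x hx, green_of_ge s (Om.pos_of_lt hx) hx.le, ← EReal.coe_mul]

theorem isGreenHarmonicSpace_wSheaf (hs : IsScale s) (hw : IsWeight w) :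
    IsGreenHarmonicSpace (wSheaf s w) := by
  refine ⟨isBrelotHarmonicSpace_wSheaf hs hw, fun y p p' hp hp' hsp hsp' => ?_⟩
  obtain ⟨c, hc, h⟩ := eq_mul_green_of_support hs hw hp hsp
  obtain ⟨c', hc', h'⟩ := eq_mul_green_of_support hs hw hp' hsp'
  refine ⟨c' / c, div_pos hc' hc, fun x => ?_⟩
  have e : (w x : EReal) * p' x = ((c' / c : ℝ) : EReal) * (w x * p x) := by
    rw [h, h', ← mul_assoc, ← EReal.coe_mul, div_mul_cancel₀ _ hc.ne']
  rw [← EReal.coe_inv_mul_cancel (hw.pos x).ne' (p' x), e, mul_left_comm,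
    EReal.coe_inv_mul_cancel (hw.pos x).ne']

end Scale


/-! ### Local form of the biharmonic pairs -/

theorem extendOm_val (u : Om → ℝ) (x : Om) : extendOm u (x : ℝ) = u x :=
  Subtype.val_injective.extend_apply u 0 x

/-- Identifies germs within the image of `U` in ℝ, which are one-sided at 0, with germs in Ω. The
classes `IsC2On` and `secondDeriv` are defined within this image. -/
theorem nhdsWithin_image_val {U : Opens Om} {x : Om} (hx : x ∈ U) :
    𝓝[Subtype.val '' (U : Set Om)] (x : ℝ) = map Subtype.val (𝓝 x) := by
  rw [← IsInducing.subtypeVal.map_nhdsWithin_eq, U.isOpen.nhdsWithin_eq hx]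

theorem ordConnected_image_val {A : Set Om} (h : A.OrdConnected) :
    (Subtype.val '' A : Set ℝ).OrdConnected := by
  refine ⟨?_⟩
  rintro _ ⟨x, hx, rfl⟩ _ ⟨y, hy, rfl⟩ z hz
  exact ⟨⟨z, x.2.1.trans hz.1, hz.2.trans_lt y.2.2⟩, h.out hx hy ⟨hz.1, hz.2⟩, rfl⟩

theorem uniqueDiffOn_image_val (U : Opens Om) : UniqueDiffOn ℝ (Subtype.val '' (U : Set Om)) := by
  rintro _ ⟨x, hx, rfl⟩
  obtain ⟨b, hb, h⟩ := exists_right_subset_of_mem_nhds (U.isOpen.mem_nhds hx)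
  refine (uniqueDiffOn_Icc (show (x : ℝ) < b from hb) x (left_mem_Icc.mpr hb.le)).mono fun t ht => ?_
  exact ⟨⟨t, x.2.1.trans ht.1, ht.2.trans_lt b.2.2⟩, h ⟨ht.1, ht.2⟩, rfl⟩

/-- Continuity at 0 excludes the unbounded term a / x² near 0 and fixes the value there. Conversely,
local coefficients are constant on connected components. -/
theorem exH₂_eq : exH₂ = wSheaf scale₂ fun _ => 1 := by
  funext U
  ext v
  constructor
  · rintro ⟨hc, hv⟩ x hx
    obtain ⟨a, b, hab⟩ := hv x hx
    have hmem : connectedComponentIn (U : Set Om) x ∈ 𝓝 x :=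
      (U.isOpen.connectedComponentIn).mem_nhds (mem_connectedComponentIn hx)
    rcases Om.eq_zero_or_pos x with rfl | hx0
    · have hcv : ContinuousAt v zeroOm := hc.continuousAt (U.isOpen.mem_nhds hx)
      have hne : (𝓝[>] zeroOm).NeBot := nhdsGT_neBot zeroOm
      have hlim : Tendsto v (𝓝[>] zeroOm) (𝓝 (v zeroOm)) := hcv.mono_left nhdsWithin_le_nhds
      have hev : ∀ᶠ y in 𝓝[>] zeroOm, v y = b + a * scale₂ y := by
        filter_upwards [nhdsWithin_le_nhds hmem, self_mem_nhdsWithin] with y hy hy0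
        rw [hab y hy hy0, scale₂]
        ring
      have ha : a = 0 := by
        by_contra ha
        have h3 : Tendsto scale₂ (𝓝[>] zeroOm) (𝓝 ((v zeroOm - b) / a)) := by
          refine ((hlim.sub_const b).div_const a).congr' ?_
          filter_upwards [hev] with y hy
          rw [hy]
          field_simp
          ring
        exact not_tendsto_nhds_of_tendsto_atTop isScale_scale₂.tendsto_zero _ h3
      have hv0 : v zeroOm = b := by
        refine tendsto_nhds_unique hlim (tendsto_const_nhds.congr' ?_)
        filter_upwards [hev] with y hy
        rw [hy, ha, zero_mul, add_zero]
      refine ⟨b, 0, fun _ => rfl, ?_⟩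
      filter_upwards [hmem] with y hy
      rcases Om.eq_zero_or_pos y with rfl | hy0
      · rw [hv0]
        ring
      · rw [hab y hy hy0, ha]
        ring
    · refine ⟨b, a, fun h => absurd h hx0.ne', ?_⟩
      filter_upwards [hmem, eventually_pos hx0] with y hy hy0
      rw [hab y hy hy0, scale₂]
      ring
  · intro hv
    refine ⟨fun x hx => (wSheaf_continuousAt isScale_scale₂ isWeight_one hv hx).continuousWithinAt,
      fun x hx => ?_⟩
    obtain ⟨α, β, -, h⟩ := exists_coef_of_isPreconnected isScale_scale₂ hv
      isPreconnected_connectedComponentIn (connectedComponentIn_subset (U : Set Om) x)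
    refine ⟨β, α, fun y hy _ => ?_⟩
    have := (h y hy).self_of_nhds
    rw [one_mul] at this
    rw [this, scale₂]
    ring

/-- The first component of a biharmonic pair with the second component `a / x² + b`. -/
def bihFun (a b α β : ℝ) (t : ℝ) : ℝ := a * (Real.log t / t) - b * t / 2 + α + β / t

/-- The function `x u` for the function `u` of `bihFun`. -/
def bihMul (a b α β : ℝ) (t : ℝ) : ℝ := a * Real.log t - b * t ^ 2 / 2 + α * t + β

theorem mul_bihFun {a b α β t : ℝ} (h : t = 0 → a = 0 ∧ β = 0) :
    t * bihFun a b α β t = bihMul a b α β t := by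
  by_cases ht : t = 0
  · obtain ⟨rfl, rfl⟩ := h ht
    simp [bihFun, bihMul, ht]
  · rw [bihFun, bihMul]
    field_simp

/-- The hypothesis removes the logarithm at t = 0, where a / t is then 0. -/
theorem hasDerivAt_bihMul {a b α β t : ℝ} (h : t = 0 → a = 0) :
    HasDerivAt (bihMul a b α β) (a / t - b * t + α) t := by
  have h1 : HasDerivAt (fun t => a * Real.log t) (a / t) t := by
    by_cases ht : t = 0
    · simp only [h ht, zero_mul, zero_div]
      exact hasDerivAt_const t 0
    · simpa [div_eq_mul_inv] using (Real.hasDerivAt_log ht).const_mul a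
  have h2 : HasDerivAt (fun t => b * t ^ 2 / 2) (b * t) t := by
    have := ((hasDerivAt_pow 2 t).const_mul b).div_const 2
    refine this.congr_deriv ?_
    push_cast
    ring
  have h3 := ((h1.sub h2).add ((hasDerivAt_id t).const_mul α)).add_const β
  rw [mul_one] at h3
  exact h3

theorem hasDerivAt_deriv_bihMul {a b α t : ℝ} (h : t = 0 → a = 0) :
    HasDerivAt (fun t => a / t - b * t + α) (-(a / t ^ 2 + b)) t := by
  have h1 : HasDerivAt (fun t => a / t) (-(a / t ^ 2)) t := by
    by_cases ht : t = 0
    · simp only [h ht, zero_div, neg_zero]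
      exact hasDerivAt_const t 0
    · have := (hasDerivAt_inv ht).const_mul a
      simp only [← div_eq_mul_inv] at this
      refine this.congr_deriv ?_
      ring
  have h3 := (h1.sub ((hasDerivAt_id t).const_mul b)).add_const α
  refine h3.congr_deriv ?_
  ring

theorem contDiffAt_bihFun {a b α β t : ℝ} (h : t = 0 → a = 0 ∧ β = 0) :
    ContDiffAt ℝ 2 (bihFun a b α β) t := by
  unfold bihFun
  by_cases ht : t = 0
  · obtain ⟨rfl, rfl⟩ := h ht
    simp only [zero_mul, zero_div, add_zero]
    fun_prop
  · refine ContDiffAt.add (ContDiffAt.add (ContDiffAt.sub (contDiffAt_const.mul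
      ((Real.contDiffAt_log.mpr ht).div contDiffAt_id ht)) (by fun_prop)) contDiffAt_const)
      (contDiffAt_const.div contDiffAt_id ht)

theorem contDiffAt_bihMul {a b α β t : ℝ} (h : t = 0 → a = 0) :
    ContDiffAt ℝ 2 (bihMul a b α β) t := by
  unfold bihMul
  by_cases ht : t = 0
  · simp only [h ht, zero_mul]
    fun_prop
  · exact ContDiffAt.add (ContDiffAt.add (ContDiffAt.sub (contDiffAt_const.mul
      (Real.contDiffAt_log.mpr ht)) (by fun_prop)) (by fun_prop)) contDiffAt_const

theorem iteratedDeriv_bihMul {a b α β : ℝ} {x : ℝ} (hx : x = 0 → a = 0) :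
    iteratedDeriv 2 (bihMul a b α β) x = -(a / x ^ 2 + b) := by
  rw [iteratedDeriv_succ, iteratedDeriv_one]
  refine ((hasDerivAt_deriv_bihMul (α := α) hx).congr_of_eventuallyEq ?_).deriv
  by_cases h0 : x = 0
  · exact Eventually.of_forall fun t => (hasDerivAt_bihMul fun _ => hx h0).deriv
  · filter_upwards [isOpen_ne.mem_nhds h0] with t ht
    exact (hasDerivAt_bihMul fun h => absurd h ht).deriv

theorem eventually_extend {U : Opens Om} {x : Om} (hx : x ∈ U) {u : Om → ℝ} {F : ℝ → ℝ}
    (h : ∀ᶠ y : Om in 𝓝 x, u y = F y) :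
    extendOm u =ᶠ[𝓝[Subtype.val '' (U : Set Om)] (x : ℝ)] F := by
  rw [nhdsWithin_image_val hx]
  refine Filter.eventually_map.mpr ?_
  filter_upwards [h] with y hy
  rw [extendOm_val, hy]

theorem isC2On_of_eventually {U : Opens Om} {u : Om → ℝ}
    (h : ∀ x ∈ U, ∃ F : ℝ → ℝ, ContDiffAt ℝ 2 F (x : ℝ) ∧ ∀ᶠ y : Om in 𝓝 x, u y = F y) :
    IsC2On u U := by
  rintro _ ⟨x, hx, rfl⟩
  obtain ⟨F, hF, he⟩ := h x hx
  refine hF.contDiffWithinAt.congr_of_eventuallyEq (eventually_extend hx he) ?_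
  rw [extendOm_val, he.self_of_nhds]

theorem secondDeriv_eq {U : Opens Om} {x : Om} (hx : x ∈ U) {u : Om → ℝ} {G : ℝ → ℝ}
    (hG : ContDiffAt ℝ 2 G (x : ℝ)) (h : ∀ᶠ y : Om in 𝓝 x, (y : ℝ) * u y = G y) :
    secondDeriv u U x = iteratedDeriv 2 G x := by
  rw [secondDeriv, ← iteratedDerivWithin_eq_iteratedDeriv (uniqueDiffOn_image_val U) hG ⟨x, hx, rfl⟩]
  have he : (fun t => t * extendOm u t) =ᶠ[𝓝[Subtype.val '' (U : Set Om)] (x : ℝ)] G := by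
    rw [nhdsWithin_image_val hx]
    refine Filter.eventually_map.mpr ?_
    filter_upwards [h] with y hy
    rw [extendOm_val, hy]
  refine Filter.EventuallyEq.iteratedDerivWithin_eq he ?_
  rw [extendOm_val, h.self_of_nhds]

theorem contDiffAt_div_sq {a b t : ℝ} (h : t = 0 → a = 0) :
    ContDiffAt ℝ 2 (fun t => a / t ^ 2 + b) t := by
  by_cases ht : t = 0
  · simp only [h ht, zero_div, zero_add]
    exact contDiffAt_const
  · exact (contDiffAt_const.div (contDiffAt_id.pow 2) (by simpa using ht)).add contDiffAt_const

theorem eq_of_hasDerivWithinAt_zero {I : Set ℝ} (hI : Convex ℝ I) {f : ℝ → ℝ}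
    (hf : ∀ t ∈ I, HasDerivWithinAt f 0 I t) {x y : ℝ} (hx : x ∈ I) (hy : y ∈ I) : f y = f x := by
  have := hI.norm_image_sub_le_of_norm_hasDerivWithin_le (C := 0) hf (fun _ _ => by simp) hx hy
  simpa [sub_eq_zero] using this

/-- The sections of the sheaf of biharmonic pairs. -/
theorem mem_exH_iff {U : Opens Om} {u v : Om → ℝ} :
    (u, v) ∈ exH U ↔ ∀ x ∈ U, ∃ a b α β : ℝ, ((x : ℝ) = 0 → a = 0 ∧ β = 0) ∧
      ∀ᶠ y : Om in 𝓝 x, u y = bihFun a b α β y ∧ v y = a / (y : ℝ) ^ 2 + b := by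
  constructor
  · rintro ⟨hu, -, hd, hv⟩ x hx
    simp only at hu hd hv
    have hv' := hv
    rw [exH₂_eq] at hv'
    obtain ⟨b, a, ha0, hab⟩ := hv' x hx
    have hab' : ∀ᶠ y in 𝓝 x, v y = a / (y : ℝ) ^ 2 + b := by
      filter_upwards [hab] with y hy
      rw [one_mul] at hy
      rw [hy, scale₂]
      ring
    -- The last condition keeps 0 out of `V` unless x = 0, so that the vanishing of `a` known at `x`
    -- suffices on all of `V`.
    obtain ⟨V, hVo, hxV, hVs, hVc⟩ := isOpen_nbhd_interval
      (Filter.inter_mem (Filter.inter_mem hab' (U.isOpen.mem_nhds hx))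
        (show ∀ᶠ y : Om in 𝓝 x, (y : ℝ) = 0 → (x : ℝ) = 0 by
          rcases Om.eq_zero_or_pos x with rfl | h
          · exact Eventually.of_forall fun _ _ => rfl
          · filter_upwards [eventually_pos h] with y hy h0 using absurd h0 hy.ne'))
    set S : Set ℝ := Subtype.val '' (U : Set Om) with hS
    set I : Set ℝ := Subtype.val '' V with hI
    have hVU : V ⊆ U := fun y hy => (hVs hy).1.2
    have hIS : I ⊆ S := image_mono hVU
    have hIc : Convex ℝ I := (ordConnected_image_val hVc).convex
    have hSd := uniqueDiffOn_image_val U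
    set g : ℝ → ℝ := fun t => t * extendOm u t with hg
    have hgC : ContDiffOn ℝ 2 g S := contDiffOn_id.mul hu
    set d : ℝ → ℝ := derivWithin g S with hdd
    have hdC : ContDiffOn ℝ 1 d S := hgC.derivWithin hSd (by norm_num)
    have hg' : ∀ t ∈ S, HasDerivWithinAt g (d t) S t := fun t ht =>
      ((hgC.differentiableOn (by norm_num)) t ht).hasDerivWithinAt
    have hd' : ∀ y ∈ U, HasDerivWithinAt d (-v y) S y := fun y hy => by
      have h1 := ((hdC.differentiableOn (by norm_num)) y ⟨y, hy, rfl⟩).hasDerivWithinAt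
      have h2 := hd y hy
      rw [secondDeriv, iteratedDerivWithin_succ, iteratedDerivWithin_one] at h2
      exact h1.congr_deriv h2
    have ha0' : ∀ t ∈ I, t = 0 → a = 0 := by
      rintro _ ⟨y, hy, rfl⟩ h0
      exact ha0 ((hVs hy).2 h0)
    -- First integration: (x u)' minus an explicit primitive of -v has derivative 0 on the interval,
    -- and the constant is α.
    set E : ℝ → ℝ := fun t => d t - (a / t - b * t + 0) with hE
    have hE0 : ∀ t ∈ I, HasDerivWithinAt E 0 I t := by
      rintro _ ⟨y, hy, rfl⟩
      have h1 := ((hd' y (hVU hy)).mono hIS).sub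
        (hasDerivAt_deriv_bihMul (a := a) (b := b) (α := 0)
          (ha0' y ⟨y, hy, rfl⟩)).hasDerivWithinAt
      refine h1.congr_deriv ?_
      have : v y = a / (y : ℝ) ^ 2 + b := (hVs hy).1.1
      rw [this]
      ring
    set α := E x with hα
    have hEc : ∀ t ∈ I, E t = α := fun t ht =>
      eq_of_hasDerivWithinAt_zero hIc hE0 ⟨x, hxV, rfl⟩ ht
    -- Second integration, with constant β.
    set D : ℝ → ℝ := fun t => g t - bihMul a b α 0 t with hD
    have hD0 : ∀ t ∈ I, HasDerivWithinAt D 0 I t := by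
      intro t ht
      have h1 := ((hg' t (hIS ht)).mono hIS).sub
        (hasDerivAt_bihMul (a := a) (b := b) (α := α) (β := 0) (ha0' t ht)).hasDerivWithinAt
      refine h1.congr_deriv ?_
      have := hEc t ht
      simp only [hE] at this
      linarith
    set β := D x with hβ
    have hDc : ∀ t ∈ I, D t = β := fun t ht =>
      eq_of_hasDerivWithinAt_zero hIc hD0 ⟨x, hxV, rfl⟩ ht
    -- Both x u and the explicit function without β vanish at 0; for the logarithm this uses
    -- `Real.log 0 = 0`.
    have hβ0 : (x : ℝ) = 0 → β = 0 := by
      intro h0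
      rw [hβ, hD]
      simp [hg, h0, bihMul]
    have hrep : ∀ y ∈ V, 0 < (y : ℝ) → u y = bihFun a b α β y := by
      intro y hy hy0
      have h1 := hDc y ⟨y, hy, rfl⟩
      simp only [hD, hg, extendOm_val] at h1
      have h2 : (y : ℝ) * bihFun a b α β y = bihMul a b α β y :=
        mul_bihFun fun h => absurd h hy0.ne'
      have h3 : bihMul a b α β y = bihMul a b α 0 y + β := by
        rw [bihMul, bihMul]
        ring
      refine mul_left_cancel₀ hy0.ne' ?_
      rw [h2, h3]
      linarith
    refine ⟨a, b, α, β, fun h => ⟨ha0 h, hβ0 h⟩, ?_⟩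
    filter_upwards [hVo.mem_nhds hxV] with y hy
    refine ⟨?_, (hVs hy).1.1⟩
    -- At 0 one cannot divide x u by x; the value of u there is the limit from the right.
    rcases Om.eq_zero_or_pos y with rfl | hy0
    · have hx0 : (x : ℝ) = 0 := (hVs hy).2 rfl
      have hcu : ContinuousWithinAt (extendOm u) S ((zeroOm : Om) : ℝ) :=
        hu.continuousOn _ ⟨_, hVU hy, rfl⟩
      rw [ContinuousWithinAt, nhdsWithin_image_val (hVU hy), tendsto_map'_iff] at hcu
      have h1 : Tendsto u (𝓝[>] zeroOm) (𝓝 (u zeroOm)) := by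
        refine ((hcu.mono_left nhdsWithin_le_nhds).congr fun z => ?_).trans_eq ?_
        · exact extendOm_val u z
        · rw [extendOm_val]
      have hne : (𝓝[>] zeroOm).NeBot := nhdsGT_neBot zeroOm
      have h2 : Tendsto (fun z : Om => bihFun a b α β z) (𝓝[>] zeroOm)
          (𝓝 (bihFun a b α β (zeroOm : Om))) := by
        have : ContinuousAt (bihFun a b α β) ((zeroOm : Om) : ℝ) :=
          (contDiffAt_bihFun fun _ => ⟨ha0 hx0, hβ0 hx0⟩).continuousAt
        exact (this.comp (f := fun z : Om => (z : ℝ)) continuous_subtype_val.continuousAt).mono_left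
          nhdsWithin_le_nhds
      refine tendsto_nhds_unique h1 (h2.congr' ?_)
      filter_upwards [self_mem_nhdsWithin, nhdsWithin_le_nhds (hVo.mem_nhds hy)] with z hz hzV
      exact (hrep z hzV hz).symm
    · exact hrep y hy hy0
  · intro h
    refine ⟨isC2On_of_eventually fun x hx => ?_, isC2On_of_eventually fun x hx => ?_,
      fun x hx => ?_, ?_⟩
    · obtain ⟨a, b, α, β, h0, he⟩ := h x hx
      exact ⟨_, contDiffAt_bihFun h0, he.mono fun y hy => hy.1⟩
    · obtain ⟨a, b, α, β, h0, he⟩ := h x hx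
      exact ⟨fun t => a / t ^ 2 + b, contDiffAt_div_sq fun h => (h0 h).1,
        he.mono fun y hy => hy.2⟩
    · obtain ⟨a, b, α, β, h0, he⟩ := h x hx
      rw [secondDeriv_eq hx (contDiffAt_bihMul (a := a) (b := b) (α := α) (β := β)
        fun h => (h0 h).1) ?_, iteratedDeriv_bihMul fun h => (h0 h).1]
      · simp only
        rw [he.self_of_nhds.2]
      · have hev : ∀ᶠ y : Om in 𝓝 x, (y : ℝ) = 0 → a = 0 ∧ β = 0 := by
          rcases Om.eq_zero_or_pos x with rfl | hx0
          · exact Eventually.of_forall fun _ _ => h0 rfl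
          · filter_upwards [eventually_pos hx0] with y hy h0 using absurd h0 hy.ne'
        filter_upwards [he, hev] with y hy hy0
        rw [hy.1, mul_bihFun hy0]
    · rw [exH₂_eq]
      intro x hx
      obtain ⟨a, b, α, β, h0, he⟩ := h x hx
      refine ⟨b, a, fun h => (h0 h).1, ?_⟩
      filter_upwards [he] with y hy
      rw [hy.2, scale₂]
      ring

theorem mem_exH₁_iff_exH {U : Opens Om} {u : Om → ℝ} :
    u ∈ exH₁ U ↔ (u, fun _ => (0 : ℝ)) ∈ exH U := by
  have hc : IsC2On (fun _ => 0) U :=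
    isC2On_of_eventually fun x _ => ⟨fun _ => 0, contDiffAt_const, Eventually.of_forall fun _ => rfl⟩
  have h2 : (fun _ => (0 : ℝ)) ∈ exH₂ U := by
    rw [exH₂_eq]
    exact mem_wSheaf_of_eqOn 0 0 (fun _ => rfl) (by simp)
  constructor
  · rintro ⟨h1, h3⟩
    exact ⟨h1, hc, fun x hx => by simp only [h3 x hx, neg_zero], h2⟩
  · rintro ⟨h1, -, h3, -⟩
    exact ⟨h1, fun x hx => by simpa using h3 x hx⟩

theorem bihFun_zero_zero (α β : ℝ) (y : Om) : bihFun 0 0 α β y = α + β * scale₁ y := by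
  simp [bihFun, scale₁, div_eq_mul_inv]

/-- This is the case v = 0, in which uniqueness of the coefficients gives a = b = 0 and leaves α +
β/x. -/
theorem exH₁_eq : exH₁ = wSheaf scale₁ fun _ => 1 := by
  funext U
  ext u
  rw [mem_exH₁_iff_exH, mem_exH_iff]
  refine forall₂_congr fun x hx => ?_
  constructor
  · rintro ⟨a, b, α, β, h0, he⟩
    obtain ⟨y, z, hy, hyz, hpy, hpz⟩ := exists_two_points he
    have e1 : b + a * scale₂ y = 0 + 0 * scale₂ y := by
      rw [scale₂]
      linear_combination -hpy.2
    have e2 : b + a * scale₂ z = 0 + 0 * scale₂ z := by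
      rw [scale₂]
      linear_combination -hpz.2
    obtain ⟨rfl, rfl⟩ := isScale_scale₂.coef_unique hy hyz e1 e2
    refine ⟨α, β, fun h => (h0 h).2, he.mono fun y hy => ?_⟩
    rw [one_mul, hy.1, bihFun_zero_zero]
  · rintro ⟨α, β, h0, he⟩
    refine ⟨0, 0, α, β, fun h => ⟨rfl, h0 h⟩, he.mono fun y hy => ⟨?_, by simp⟩⟩
    rw [bihFun_zero_zero, ← hy, one_mul]


/-! ### The weighted sheaf of biharmonic pairs -/

section Pairs

variable {P Q : Om → ℝ}

/-- Reduces the original space to the weighted one with weights 1, so that every statement on pairs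
is proved only once. -/
theorem exH_eq_quotient : exH = quotientSheaf exH (fun _ => 1) fun _ => 1 := by
  funext U
  ext ⟨u, v⟩
  simp only [quotientSheaf, one_mul]
  constructor
  · intro h
    refine ⟨?_, ?_, h⟩
    · have h' := h.1.continuousOn.comp continuous_subtype_val.continuousOn
        (mapsTo_image Subtype.val (U : Set Om))
      exact h'.congr fun x _ => (extendOm_val u x).symm
    · exact h.2.2.2.1
  · exact fun h => h.2.2

theorem continuousAt_bihFun {a b α β : ℝ} {x : Om} (h : (x : ℝ) = 0 → a = 0 ∧ β = 0) :
    ContinuousAt (fun y : Om => bihFun a b α β y) x :=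
  (contDiffAt_bihFun h).continuousAt.comp (f := fun z : Om => (z : ℝ))
    continuous_subtype_val.continuousAt

theorem IsWeight.continuousAt_of_mul {w : Om → ℝ} (hw : IsWeight w) {u F : Om → ℝ} {x : Om}
    (hF : ContinuousAt F x) (h : ∀ᶠ y in 𝓝 x, w y * u y = F y) : ContinuousAt u x := by
  refine (hF.div hw.cont.continuousAt (hw.pos x).ne').congr ?_
  filter_upwards [h] with y hy
  rw [Pi.div_apply, ← hy, mul_div_cancel_left₀ _ (hw.pos y).ne']

theorem mem_quotientSheaf_iff (hP : IsWeight P) (hQ : IsWeight Q) {U : Opens Om}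
    {c : (Om → ℝ) × (Om → ℝ)} :
    c ∈ quotientSheaf exH P Q U ↔ ∀ x ∈ U, ∃ a b α β : ℝ, ((x : ℝ) = 0 → a = 0 ∧ β = 0) ∧
      ∀ᶠ y : Om in 𝓝 x, P y * c.1 y = bihFun a b α β y ∧ Q y * c.2 y = a / (y : ℝ) ^ 2 + b := by
  rw [← mem_exH_iff]
  refine ⟨fun h => h.2.2, fun h => ⟨fun x hx => ?_, fun x hx => ?_, h⟩⟩
  · obtain ⟨a, b, α, β, h0, he⟩ := mem_exH_iff.mp h x hx
    exact (hP.continuousAt_of_mul (continuousAt_bihFun h0) (he.mono fun y hy => hy.1)).continuousWithinAt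
  · obtain ⟨a, b, α, β, h0, he⟩ := mem_exH_iff.mp h x hx
    refine (hQ.continuousAt_of_mul (F := fun y : Om => a / (y : ℝ) ^ 2 + b) ?_
      (he.mono fun y hy => hy.2)).continuousWithinAt
    exact (contDiffAt_div_sq fun h => (h0 h).1).continuousAt.comp (f := fun z : Om => (z : ℝ))
      continuous_subtype_val.continuousAt

theorem bihFun_add (a b α β a' b' α' β' t : ℝ) :
    bihFun (a + a') (b + b') (α + α') (β + β') t = bihFun a b α β t + bihFun a' b' α' β' t := by
  simp only [bihFun]
  ring

theorem bihFun_smul (c a b α β t : ℝ) :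
    bihFun (c * a) (c * b) (c * α) (c * β) t = c * bihFun a b α β t := by
  simp only [bihFun]
  ring

theorem isPairSheaf_quotient (hP : IsWeight P) (hQ : IsWeight Q) :
    IsPairSheaf (quotientSheaf exH P Q) where
  congr U a b h1 h2 ha := by
    rw [mem_quotientSheaf_iff hP hQ] at ha ⊢
    intro x hx
    obtain ⟨a', b', α, β, h0, he⟩ := ha x hx
    refine ⟨a', b', α, β, h0, ?_⟩
    filter_upwards [he, U.isOpen.mem_nhds hx] with y hy hyU
    rw [← h1 hyU, ← h2 hyU]
    exact hy
  continuousOn U a ha := ⟨ha.1, ha.2.1⟩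
  zero_mem U := by
    rw [mem_quotientSheaf_iff hP hQ]
    exact fun x _ => ⟨0, 0, 0, 0, fun _ => ⟨rfl, rfl⟩, Eventually.of_forall fun y => by
      simp [bihFun]⟩
  add_mem U c hc c' hc' := by
    rw [mem_quotientSheaf_iff hP hQ] at hc hc' ⊢
    intro x hx
    obtain ⟨a, b, α, β, h0, he⟩ := hc x hx
    obtain ⟨a', b', α', β', h0', he'⟩ := hc' x hx
    refine ⟨a + a', b + b', α + α', β + β', fun h => ?_, ?_⟩
    · simp [h0 h, h0' h]
    · filter_upwards [he, he'] with y hy hy'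
      rw [bihFun_add, ← hy.1, ← hy'.1, add_div, Prod.fst_add, Prod.snd_add, Pi.add_apply,
        Pi.add_apply]
      exact ⟨by ring, by linear_combination hy.2 + hy'.2⟩
  smul_mem U r c hc := by
    rw [mem_quotientSheaf_iff hP hQ] at hc ⊢
    intro x hx
    obtain ⟨a, b, α, β, h0, he⟩ := hc x hx
    refine ⟨r * a, r * b, r * α, r * β, fun h => ?_, ?_⟩
    · simp [h0 h]
    · filter_upwards [he] with y hy
      rw [bihFun_smul, ← hy.1, Prod.smul_fst, Prod.smul_snd, Pi.smul_apply, Pi.smul_apply,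
        smul_eq_mul, smul_eq_mul]
      exact ⟨by ring, by linear_combination r * hy.2⟩
  restrict U V hUV c hc := by
    rw [mem_quotientSheaf_iff hP hQ] at hc ⊢
    exact fun x hx => hc x (hUV hx)
  glue 𝒮 c hc := by
    rw [mem_quotientSheaf_iff hP hQ]
    intro x hx
    obtain ⟨U, hU, hxU⟩ := Opens.mem_sSup.mp hx
    exact (mem_quotientSheaf_iff hP hQ).mp (hc U hU) x hxU
  compatible U ω hω c hc h0 x hx := by
    -- If the first component vanishes near `x`, so does (x P u)'', which is -Q v.
    have hd := hc.2.2.2.2.1 x (hω hx)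
    simp only at hd
    rw [secondDeriv_eq (G := fun _ => 0) (hω hx) contDiffAt_const, iteratedDeriv_const] at hd
    · have h1 : Q x * c.2 x = 0 := by
        rw [if_neg two_ne_zero] at hd
        linarith
      exact (mul_eq_zero.mp h1).resolve_left (hQ.pos x).ne'
    · filter_upwards [ω.isOpen.mem_nhds hx] with y hy
      rw [h0 y hy, mul_zero, mul_zero]

theorem snd_mem_wSheaf (hP : IsWeight P) (hQ : IsWeight Q) {U : Opens Om}
    {c : (Om → ℝ) × (Om → ℝ)} (hc : c ∈ quotientSheaf exH P Q U) : c.2 ∈ wSheaf scale₂ Q U := by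
  intro x hx
  obtain ⟨a, b, α, β, h0, he⟩ := (mem_quotientSheaf_iff hP hQ).mp hc x hx
  refine ⟨b, a, fun h => (h0 h).1, he.mono fun y hy => ?_⟩
  rw [hy.2, scale₂]
  ring

theorem bihFun_split (a b α β : ℝ) (y : Om) :
    bihFun a b α β y = bihFun a b 0 0 y + (α + β * scale₁ y) := by
  simp only [bihFun, scale₁]
  ring

/-- The coefficients of a biharmonic pair do not vary on an interval. -/
theorem exists_pair_coef_on (hP : IsWeight P) (hQ : IsWeight Q) {U : Opens Om}
    {c : (Om → ℝ) × (Om → ℝ)} (hc : c ∈ quotientSheaf exH P Q U) {S : Set Om}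
    (hS : S.OrdConnected) (hSU : S ⊆ U) :
    ∃ a b α β : ℝ, (∀ x ∈ S, (x : ℝ) = 0 → a = 0 ∧ β = 0) ∧
      ∀ x ∈ S, P x * c.1 x = bihFun a b α β x ∧ Q x * c.2 x = a / (x : ℝ) ^ 2 + b := by
  obtain ⟨b, a, ha0, hab⟩ := exists_coef_of_isPreconnected isScale_scale₂ (snd_mem_wSheaf hP hQ hc)
    (isPreconnected_of_ordConnected hS) hSU
  -- The points near which the second component has the coefficients `a`, `b` valid on `S`. On this
  -- open set, subtracting a fixed particular solution leaves a section of the first sheaf, whose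
  -- coefficients are again constant on `S`.
  set U' : Opens Om := ⟨(U : Set Om) ∩ {x | ∀ᶠ y in 𝓝 x, Q y * c.2 y = b + a * scale₂ y},
    U.isOpen.inter (isOpen_iff_mem_nhds.mpr fun x hx => eventually_eventually_nhds.mpr hx)⟩
  have hSU' : S ⊆ U' := fun x hx => ⟨hSU hx, hab x hx⟩
  have hu : (fun x => c.1 x - bihFun a b 0 0 x / P x) ∈ wSheaf scale₁ P U' := by
    rintro x ⟨hxU, hx⟩
    obtain ⟨a', b', α, β, h0, he⟩ := (mem_quotientSheaf_iff hP hQ).mp hc x hxU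
    obtain ⟨y, z, hy, hyz, hpy, hpz⟩ := exists_two_points (he.and hx)
    have e (y : Om) (hpy : (P y * c.1 y = bihFun a' b' α β y ∧ Q y * c.2 y = a' / (y : ℝ) ^ 2 + b') ∧
        Q y * c.2 y = b + a * scale₂ y) : b' + a' * scale₂ y = b + a * scale₂ y := by
      rw [← hpy.2, hpy.1.2, scale₂]
      ring
    obtain ⟨rfl, rfl⟩ := isScale_scale₂.coef_unique hy hyz (e y hpy) (e z hpz)
    refine ⟨α, β, fun h => (h0 h).2, he.mono fun t ht => ?_⟩
    rw [mul_sub, mul_div_cancel₀ _ (hP.pos t).ne', ht.1, bihFun_split a' b' α β]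
    ring
  obtain ⟨α, β, hβ0, hαβ⟩ := exists_coef_on isScale_scale₁ hu hS hSU'
  refine ⟨a, b, α, β, fun x hx h => ⟨ha0 x hx h, hβ0 x hx h⟩, fun x hx => ⟨?_, ?_⟩⟩
  · have := hαβ x hx
    rw [mul_sub, mul_div_cancel₀ _ (hP.pos x).ne'] at this
    rw [bihFun_split]
    linarith
  · rw [(hab x hx).self_of_nhds, scale₂]
    ring

/-! ### The Riquier problem on an interval -/

/-- The contribution of the second boundary value at `c` to the solution of the Riquier problem on
the interval with end points `c` and `d`. -/
def nu (c d x : Om) : ℝ :=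
  bihFun (1 / (scale₂ c - scale₂ d)) (-scale₂ d / (scale₂ c - scale₂ d)) 0 0 x -
    lam scale₁ c d x *
      bihFun (1 / (scale₂ c - scale₂ d)) (-scale₂ d / (scale₂ c - scale₂ d)) 0 0 c -
    lam scale₁ d c x *
      bihFun (1 / (scale₂ c - scale₂ d)) (-scale₂ d / (scale₂ c - scale₂ d)) 0 0 d

/-- The function a/x² + b is the combination, with its end values as coefficients, of the two
functions that are 1 at one end and 0 at the other. The function `nu` is a particular solution for
one of these, corrected so as to vanish at both ends. -/
theorem bih_interp {c d : Om} (hc : 0 < (c : ℝ)) (hcd : c < d) (x : Om) (a b α β : ℝ) :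
    bihFun a b α β x = lam scale₁ c d x * bihFun a b α β c + lam scale₁ d c x * bihFun a b α β d +
      (nu c d x * (a / (c : ℝ) ^ 2 + b) + nu d c x * (a / (d : ℝ) ^ 2 + b)) := by
  have h := isScale_scale₂.anti c d hc hcd
  have h1 : scale₂ c - scale₂ d ≠ 0 := by linarith
  have h2 : scale₂ d - scale₂ c ≠ 0 := by linarith
  have hi := isScale_scale₁.interp hc hcd x α β
  have e1 : a / (c : ℝ) ^ 2 + b = a * scale₂ c + b := by rw [scale₂]; ring
  have e2 : a / (d : ℝ) ^ 2 + b = a * scale₂ d + b := by rw [scale₂]; ring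
  have ha : a = (a * scale₂ c + b) * (1 / (scale₂ c - scale₂ d)) +
      (a * scale₂ d + b) * (1 / (scale₂ d - scale₂ c)) := by
    field_simp
    ring
  have hb : b = (a * scale₂ c + b) * (-scale₂ d / (scale₂ c - scale₂ d)) +
      (a * scale₂ d + b) * (-scale₂ c / (scale₂ d - scale₂ c)) := by
    field_simp
    ring
  have hR : ∀ y : Om, bihFun a b 0 0 y = (a * scale₂ c + b) *
      bihFun (1 / (scale₂ c - scale₂ d)) (-scale₂ d / (scale₂ c - scale₂ d)) 0 0 y +
      (a * scale₂ d + b) *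
      bihFun (1 / (scale₂ d - scale₂ c)) (-scale₂ c / (scale₂ d - scale₂ c)) 0 0 y := by
    intro y
    rw [← bihFun_smul, ← bihFun_smul, ← bihFun_add, ← ha, ← hb]
    simp
  rw [e1, e2, bihFun_split a b α β x, bihFun_split a b α β c, bihFun_split a b α β d, hR x, hR c,
    hR d, nu, nu]
  linear_combination hi

theorem nu_end {c d : Om} (hc : 0 < (c : ℝ)) (hcd : c < d) :
    nu c d c = 0 ∧ nu d c c = 0 ∧ nu c d d = 0 ∧ nu d c d = 0 := by
  obtain ⟨e1, e2, e3, e4⟩ := lam_self_left isScale_scale₁ hc hcd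
  simp [nu, e1, e2, e3, e4]

/-- The solution of `-z'' = g`, `z (c) = z (d) = 0`. -/
def tentInt (c d x : ℝ) (g : ℝ → ℝ) : ℝ :=
  (d - x) / (d - c) * (∫ y in c..x, (y - c) * g y) + (x - c) / (d - c) * ∫ y in x..d, (d - y) * g y

/-- Multiplication by x turns interpolation in the scale 1/x into linear interpolation; this is the
passage from u to x u. -/
theorem lam_scale₁_left {c d x : Om} (hc : 0 < (c : ℝ)) (hcd : c < d) (hx : 0 < (x : ℝ)) :
    x * lam scale₁ c d x = (d - x) / (d - c) * c := by
  have h : (c : ℝ) < d := hcd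
  have hd : 0 < (d : ℝ) := hc.trans h
  have h1 : (d : ℝ) - c ≠ 0 := by linarith
  have h2 : (1 : ℝ) / c - 1 / d ≠ 0 := by
    rw [div_sub_div _ _ hc.ne' hd.ne', one_mul, mul_one]
    exact div_ne_zero h1 (by positivity)
  rw [lam, scale₁, scale₁, scale₁]
  have h3 : (1 : ℝ) / c - 1 / d = (d - c) / (c * d) := by field_simp
  rw [h3]
  field_simp

theorem lam_scale₁_right {c d x : Om} (hc : 0 < (c : ℝ)) (hcd : c < d) (hx : 0 < (x : ℝ)) :
    x * lam scale₁ d c x = (x - c) / (d - c) * d := by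
  have h : (c : ℝ) < d := hcd
  have h1 : (d : ℝ) - c ≠ 0 := by linarith
  have e := isScale_scale₁.lam_add hc hcd x
  have e2 : lam scale₁ d c x = 1 - lam scale₁ c d x := by linarith
  rw [e2, mul_sub, lam_scale₁_left hc hcd hx]
  field_simp
  ring

theorem continuousOn_div_sq (a b : ℝ) : ContinuousOn (fun t : ℝ => a / t ^ 2 + b) (Ioi 0) :=
  (continuousOn_const.div (continuousOn_pow 2) fun _ ht => pow_ne_zero 2 (ne_of_gt ht)).add
    continuousOn_const

/-- Both sides are the solution of -z'' = a/t² + b that vanishes at c and d. The integral form makes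
its sign and its monotonicity in the right-hand side visible. -/
theorem nu_eq_tentInt {c d x : Om} (hc : 0 < (c : ℝ)) (hcx : c < x) (hxd : x < d) (a b : ℝ) :
    x * (nu c d x * (a / (c : ℝ) ^ 2 + b) + nu d c x * (a / (d : ℝ) ^ 2 + b)) =
      tentInt c d x fun t => a / t ^ 2 + b := by
  have hx : 0 < (x : ℝ) := hc.trans hcx
  have hd : 0 < (d : ℝ) := hx.trans hxd
  have hcx' : (c : ℝ) < x := hcx
  have hxd' : (x : ℝ) < d := hxd
  have hcd := hcx.trans hxd
  have hi := bih_interp hc hcd x a b 0 0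
  have ex : x * bihFun a b 0 0 x = bihMul a b 0 0 x := mul_bihFun fun h => absurd h hx.ne'
  have ec : c * bihFun a b 0 0 c = bihMul a b 0 0 c := mul_bihFun fun h => absurd h hc.ne'
  have ed : d * bihFun a b 0 0 d = bihMul a b 0 0 d := mul_bihFun fun h => absurd h hd.ne'
  have l1 := lam_scale₁_left hc hcd hx
  have l2 := lam_scale₁_right hc hcd hx
  have key : x * (nu c d x * (a / (c : ℝ) ^ 2 + b) + nu d c x * (a / (d : ℝ) ^ 2 + b)) =
      bihMul a b 0 0 x - ((d : ℝ) - x) / (d - c) * bihMul a b 0 0 c -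
        ((x : ℝ) - c) / (d - c) * bihMul a b 0 0 d := by
    rw [← ex, ← ec, ← ed]
    linear_combination (-(x : ℝ)) * hi - bihFun a b 0 0 c * l1 - bihFun a b 0 0 d * l2
  have hcont : ∀ (f : ℝ → ℝ) {p q : ℝ}, Continuous f → 0 < p → p ≤ q →
      IntervalIntegrable (fun y => f y * (a / y ^ 2 + b)) volume p q := by
    intro f p q hf hp hpq
    refine ContinuousOn.intervalIntegrable (hf.continuousOn.mul ((continuousOn_div_sq a b).mono ?_))
    rw [uIcc_of_le hpq]
    exact fun t ht => hp.trans_le ht.1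
  -- Integration by parts: with z = `bihMul a b 0 0`, the function -(y - c) z' + z is a primitive of
  -- the integrand, since -z'' = a/y² + b.
  have I1 : ∫ y in (c : ℝ)..x, (y - c) * (a / y ^ 2 + b) =
      -(x - c) * (a / x - b * x + 0) + bihMul a b 0 0 x - bihMul a b 0 0 c := by
    have := intervalIntegral.integral_eq_sub_of_hasDerivAt
      (f := fun y => -((y - c) * (a / y - b * y + 0)) + bihMul a b 0 0 y)
      (f' := fun y => (y - c) * (a / y ^ 2 + b)) (a := c) (b := x) (fun y hy => ?_)
      (hcont _ (by fun_prop) hc hcx'.le)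
    · rw [this]
      ring
    · rw [uIcc_of_le hcx'.le] at hy
      have hy0 : y ≠ 0 := (hc.trans_le hy.1).ne'
      have h1 := (((hasDerivAt_id y).sub_const (c : ℝ)).mul
        (hasDerivAt_deriv_bihMul (a := a) (b := b) (α := 0) fun h => absurd h hy0)).neg.add
        (hasDerivAt_bihMul (a := a) (b := b) (α := 0) (β := 0) fun h => absurd h hy0)
      refine h1.congr_deriv ?_
      simp only [id_eq]
      ring
  have I2 : ∫ y in (x : ℝ)..d, (d - y) * (a / y ^ 2 + b) =
      (d - x) * (a / x - b * x + 0) + bihMul a b 0 0 x - bihMul a b 0 0 d := by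
    have := intervalIntegral.integral_eq_sub_of_hasDerivAt
      (f := fun y => -((d - y) * (a / y - b * y + 0)) - bihMul a b 0 0 y)
      (f' := fun y => (d - y) * (a / y ^ 2 + b)) (a := x) (b := d) (fun y hy => ?_)
      (hcont _ (by fun_prop) hx hxd'.le)
    · rw [this]
      ring
    · rw [uIcc_of_le hxd'.le] at hy
      have hy0 : y ≠ 0 := (hx.trans_le hy.1).ne'
      have h1 := (((hasDerivAt_id y).const_sub (d : ℝ)).mul
        (hasDerivAt_deriv_bihMul (a := a) (b := b) (α := 0) fun h => absurd h hy0)).neg.sub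
        (hasDerivAt_bihMul (a := a) (b := b) (α := 0) (β := 0) fun h => absurd h hy0)
      refine h1.congr_deriv ?_
      simp only [id_eq]
      ring
  have hdc : (d : ℝ) - c ≠ 0 := by linarith
  rw [key, tentInt, I1, I2]
  field_simp
  ring

theorem tentInt_nonneg {c d x : ℝ} (hcx : c < x) (hxd : x < d) {g : ℝ → ℝ}
    (hg : ∀ y ∈ Icc c d, 0 ≤ g y) : 0 ≤ tentInt c d x g := by
  have h1 : 0 ≤ ∫ y in c..x, (y - c) * g y := intervalIntegral.integral_nonneg hcx.le
    fun y hy => mul_nonneg (by linarith [hy.1]) (hg y ⟨hy.1, hy.2.trans hxd.le⟩)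
  have h2 : 0 ≤ ∫ y in x..d, (d - y) * g y := intervalIntegral.integral_nonneg hxd.le
    fun y hy => mul_nonneg (by linarith [hy.2]) (hg y ⟨hcx.le.trans hy.1, hy.2⟩)
  have h3 : 0 ≤ (d - x) / (d - c) := div_nonneg (by linarith) (by linarith)
  have h4 : 0 ≤ (x - c) / (d - c) := div_nonneg (by linarith) (by linarith)
  exact add_nonneg (mul_nonneg h3 h1) (mul_nonneg h4 h2)

/-- Choose the right-hand side 1/t² - 1/d², which is nonnegative on [c, d] and vanishes at d: the
integral is nonnegative and only the term in `nu c d` survives. The other end is treated with 1/c² -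
1/t². -/
theorem nu_left_nonneg {c d x : Om} (hc : 0 < (c : ℝ)) (hcx : c < x) (hxd : x < d) :
    0 ≤ nu c d x := by
  have hcd : (c : ℝ) < d := hcx.trans hxd
  have hd : 0 < (d : ℝ) := hc.trans hcd
  have h := nu_eq_tentInt hc hcx hxd 1 (-(1 / (d : ℝ) ^ 2))
  have hle : ∀ y : ℝ, 0 < y → y ≤ d → 1 / (d : ℝ) ^ 2 ≤ 1 / y ^ 2 := fun y hy hyd =>
    one_div_le_one_div_of_le (by positivity) (by gcongr)
  have hpos := tentInt_nonneg (g := fun t : ℝ => 1 / t ^ 2 + -(1 / (d : ℝ) ^ 2)) hcx hxd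
    fun y hy => by linarith [hle y (hc.trans_le hy.1) hy.2]
  rw [← h, add_neg_cancel, mul_zero, add_zero] at hpos
  have hlt : 1 / (d : ℝ) ^ 2 < 1 / (c : ℝ) ^ 2 := isScale_scale₂.anti c d hc hcd
  have hx : 0 < (x : ℝ) := hc.trans hcx
  have h2 := nonneg_of_mul_nonneg_right hpos hx
  exact nonneg_of_mul_nonneg_left h2 (by linarith)

theorem nu_right_nonneg {c d x : Om} (hc : 0 < (c : ℝ)) (hcx : c < x) (hxd : x < d) :
    0 ≤ nu d c x := by
  have hcd : (c : ℝ) < d := hcx.trans hxd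
  have hd : 0 < (d : ℝ) := hc.trans hcd
  have h := nu_eq_tentInt hc hcx hxd (-1) (1 / (c : ℝ) ^ 2)
  have hle : ∀ y : ℝ, (c : ℝ) ≤ y → 1 / y ^ 2 ≤ 1 / (c : ℝ) ^ 2 := fun y hy =>
    one_div_le_one_div_of_le (by positivity) (by gcongr)
  have hpos := tentInt_nonneg (g := fun t : ℝ => -1 / t ^ 2 + 1 / (c : ℝ) ^ 2) hcx hxd
    fun y hy => by
      rw [neg_div]
      linarith [hle y hy.1]
  rw [← h, neg_div, neg_add_cancel, mul_zero, zero_add] at hpos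
  have hlt : 1 / (d : ℝ) ^ 2 < 1 / (c : ℝ) ^ 2 := isScale_scale₂.anti c d hc hcd
  have hx : 0 < (x : ℝ) := hc.trans hcx
  have h2 := nonneg_of_mul_nonneg_right hpos hx
  refine nonneg_of_mul_nonneg_left h2 ?_
  rw [neg_div]
  linarith

/-- The case v = 1: the solution of -z'' = 1 with zero end values is (x - c)(d - x)/2. -/
theorem nu_add {c d x : Om} (hc : 0 < (c : ℝ)) (hcx : c < x) (hxd : x < d) :
    x * (nu c d x + nu d c x) = (x - c) * (d - x) / 2 := by
  have hcd := hcx.trans hxd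
  have hx : 0 < (x : ℝ) := hc.trans hcx
  have hcd' : (c : ℝ) < d := hcd
  have hi := bih_interp hc hcd x 0 1 0 0
  have l1 := lam_scale₁_left hc hcd hx
  have l2 := lam_scale₁_right hc hcd hx
  have hdc : (d : ℝ) - c ≠ 0 := by linarith
  simp only [bihFun, zero_mul, zero_div, zero_sub, one_mul, add_zero, zero_add, mul_one] at hi
  have : x * (nu c d x + nu d c x) = -(x : ℝ) * x / 2 + ((d : ℝ) - x) / (d - c) * c * (c / 2) +
      ((x : ℝ) - c) / (d - c) * d * (d / 2) := by
    rw [← l1, ← l2]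
    linear_combination (-(x : ℝ)) * hi
  rw [this]
  field_simp
  ring

/-! ### Solutions of the Riquier problem and regular sets -/

theorem IsRiquierSolution.snd (hP : IsWeight P) (hQ : IsWeight Q) {ω : Opens Om} {f g u v : Om → ℝ}
    (h : IsRiquierSolution (quotientSheaf exH P Q) ω f g u v) :
    IsDirichletSolution (wSheaf scale₂ Q) ω g v :=
  ⟨snd_mem_wSheaf hP hQ h.1, fun y hy => (h.2 y hy).2⟩

theorem pair_boundary_value (hP : IsWeight P) {ω : Opens Om} {u : Om → ℝ} {S : Set Om}
    (hS : S ⊆ ω) {a b α β : ℝ} (hrep : ∀ x ∈ S, P x * u x = bihFun a b α β x) {y : Om}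
    (hy : y ∈ closure S) (hpos : (y : ℝ) = 0 → a = 0 ∧ β = 0) {r : ℝ}
    (hlim : Tendsto u (𝓝[(ω : Set Om)] y) (𝓝 r)) : bihFun a b α β y = P y * r := by
  have := mem_closure_iff_nhdsWithin_neBot.mp hy
  have h1 : Tendsto (fun x => P x * u x) (𝓝[S] y) (𝓝 (P y * r)) :=
    (hP.cont.continuousAt.mono_left nhdsWithin_le_nhds).mul (hlim.mono_left (nhdsWithin_mono y hS))
  have h2 : Tendsto (fun x : Om => bihFun a b α β x) (𝓝[S] y) (𝓝 (bihFun a b α β y)) :=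
    (continuousAt_bihFun hpos).mono_left nhdsWithin_le_nhds
  refine tendsto_nhds_unique (h2.congr' ?_) h1
  filter_upwards [self_mem_nhdsWithin] with x hx using (hrep x hx).symm

theorem pair_boundary_value_snd (hQ : IsWeight Q) {ω : Opens Om} {v : Om → ℝ} {S : Set Om}
    (hS : S ⊆ ω) {a b : ℝ} (hrep : ∀ x ∈ S, Q x * v x = a / (x : ℝ) ^ 2 + b) {y : Om}
    (hy : y ∈ closure S) (hpos : (y : ℝ) = 0 → a = 0) {r : ℝ}
    (hlim : Tendsto v (𝓝[(ω : Set Om)] y) (𝓝 r)) : a / (y : ℝ) ^ 2 + b = Q y * r := by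
  rw [← boundary_value isScale_scale₂ hQ hS (α := b) (β := a) (fun x hx => ?_) hy hpos hlim, scale₂]
  · ring
  · rw [hrep x hx, scale₂]
    ring

/-- On [0, d[ the singular coefficients a and β vanish, so Q v is constant and P u is affine in x
with slope -Q v / 2. -/
theorem riquier_rep_Iio (hP : IsWeight P) (hQ : IsWeight Q) {ω : Opens Om} {f g u v : Om → ℝ}
    (h : IsRiquierSolution (quotientSheaf exH P Q) ω f g u v) {d : Om} (hd0 : 0 < (d : ℝ))
    (hd : d ∈ frontier (ω : Set Om)) (hω : Iio d ⊆ (ω : Set Om)) {x : Om} (hx : x < d) :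
    P x * u x = P d * f d + ((d : ℝ) - x) / 2 * (Q d * g d) ∧ Q x * v x = Q d * g d := by
  obtain ⟨a, b, α, β, h0, hr⟩ := exists_pair_coef_on hP hQ h.1 ordConnected_Iio hω
  obtain ⟨rfl, rfl⟩ : a = 0 ∧ β = 0 := h0 zeroOm (zeroOm_lt_iff.mpr hd0) rfl
  have hcl : d ∈ closure (Iio d) := by rw [closure_Iio_Om hd0]; exact self_mem_Iic
  have h1 := pair_boundary_value hP hω (fun x hx => (hr x hx).1) hcl (fun _ => ⟨rfl, rfl⟩)
    (h.2 d hd).1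
  have h2 := pair_boundary_value_snd hQ hω (fun x hx => (hr x hx).2) hcl (fun _ => rfl)
    (h.2 d hd).2
  obtain ⟨e1, e2⟩ := hr x hx
  simp only at e1 e2
  rw [e1, e2, ← h1, ← h2]
  simp only [bihFun]
  exact ⟨by ring, by ring⟩

theorem riquier_rep_Ioo (hP : IsWeight P) (hQ : IsWeight Q) {ω : Opens Om} {f g u v : Om → ℝ}
    (h : IsRiquierSolution (quotientSheaf exH P Q) ω f g u v) {c d : Om} (hc0 : 0 < (c : ℝ))
    (hcd : c < d) (hc : c ∈ frontier (ω : Set Om)) (hd : d ∈ frontier (ω : Set Om))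
    (hω : Ioo c d ⊆ (ω : Set Om)) {x : Om} (hx : x ∈ Ioo c d) :
    P x * u x = lam scale₁ c d x * (P c * f c) + lam scale₁ d c x * (P d * f d) +
      (nu c d x * (Q c * g c) + nu d c x * (Q d * g d)) ∧
    Q x * v x = lam scale₂ c d x * (Q c * g c) + lam scale₂ d c x * (Q d * g d) := by
  refine ⟨?_, rep_of_Ioo isScale_scale₂ hQ (h.snd hP hQ) hc0 hcd hc hd hω hx⟩
  obtain ⟨a, b, α, β, h0, hr⟩ := exists_pair_coef_on hP hQ h.1 ordConnected_Ioo hω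
  have hcl := closure_Ioo hcd.ne
  have hcc : c ∈ closure (Ioo c d) := by rw [hcl]; exact left_mem_Icc.mpr hcd.le
  have hdc : d ∈ closure (Ioo c d) := by rw [hcl]; exact right_mem_Icc.mpr hcd.le
  have hd0 := hc0.trans hcd
  rw [← pair_boundary_value hP hω (fun x hx => (hr x hx).1) hcc (fun h => absurd h hc0.ne')
    (h.2 c hc).1, ← pair_boundary_value hP hω (fun x hx => (hr x hx).1) hdc
    (fun h => absurd h hd0.ne') (h.2 d hd).1, ← pair_boundary_value_snd hQ hω
    (fun x hx => (hr x hx).2) hcc (fun h => absurd h hc0.ne') (h.2 c hc).2,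
    ← pair_boundary_value_snd hQ hω (fun x hx => (hr x hx).2) hdc
    (fun h => absurd h hd0.ne') (h.2 d hd).2, ← bih_interp hc0 hcd]
  exact (hr x hx).1

theorem exists_pair_coef {c d : Om} (hc : 0 < (c : ℝ)) (hcd : c < d) (F F' G G' : ℝ) :
    ∃ a b α β : ℝ, ∀ x : Om, lam scale₁ c d x * F + lam scale₁ d c x * F' +
      (nu c d x * G + nu d c x * G') = bihFun a b α β x ∧
      lam scale₂ c d x * G + lam scale₂ d c x * G' = a / (x : ℝ) ^ 2 + b := by
  have h2 := isScale_scale₂.anti c d hc hcd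
  obtain ⟨b, a, hab⟩ := isScale_scale₂.exists_coef hc hcd G G'
  obtain ⟨α, β, hαβ⟩ := isScale_scale₁.exists_coef hc hcd (F - bihFun a b 0 0 c)
    (F' - bihFun a b 0 0 d)
  obtain ⟨e1, e2, e3, e4⟩ := lam_self_left isScale_scale₂ hc hcd
  have hG : a / (c : ℝ) ^ 2 + b = G := by
    have := hab c
    rw [e1, e2, scale₂] at this
    linear_combination -this
  have hG' : a / (d : ℝ) ^ 2 + b = G' := by
    have := hab d
    rw [e3, e4, scale₂] at this
    linear_combination -this
  refine ⟨a, b, α, β, fun x => ⟨?_, ?_⟩⟩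
  · have h1 := bih_interp hc hcd x a b 0 0
    rw [hG, hG'] at h1
    have h3 := hαβ x
    rw [bihFun_split]
    linear_combination h3 - h1
  · rw [hab x, scale₂]
    ring

theorem exists_riquier_Ioo (hP : IsWeight P) (hQ : IsWeight Q) {c d : Om} (hc0 : 0 < (c : ℝ))
    (hcd : c < d) (f g : Om → ℝ) :
    IsRiquierSolution (quotientSheaf exH P Q) ⟨Ioo c d, isOpen_Ioo⟩ f g
      (fun x => (lam scale₁ c d x * (P c * f c) + lam scale₁ d c x * (P d * f d) +
        (nu c d x * (Q c * g c) + nu d c x * (Q d * g d))) / P x)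
      (fun x => (lam scale₂ c d x * (Q c * g c) + lam scale₂ d c x * (Q d * g d)) / Q x) := by
  have hv := exists_solution_Ioo isScale_scale₂ hQ hc0 hcd g
  obtain ⟨a, b, α, β, hr⟩ := exists_pair_coef hc0 hcd (P c * f c) (P d * f d) (Q c * g c) (Q d * g d)
  have key : ∀ y : Om, 0 < (y : ℝ) → ContinuousAt
      (fun x => (lam scale₁ c d x * (P c * f c) + lam scale₁ d c x * (P d * f d) +
        (nu c d x * (Q c * g c) + nu d c x * (Q d * g d))) / P x) y := by
    intro y hy
    simp only [(hr _).1]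
    exact (continuousAt_bihFun fun h => absurd h hy.ne').div hP.cont.continuousAt (hP.pos y).ne'
  refine ⟨?_, fun y hy => ⟨?_, hv.2 y hy⟩⟩
  · rw [mem_quotientSheaf_iff hP hQ]
    intro x hx
    refine ⟨a, b, α, β, fun h => absurd h (Om.pos_of_lt hx.1).ne', Eventually.of_forall fun y => ?_⟩
    simp only
    rw [mul_div_cancel₀ _ (hP.pos y).ne', mul_div_cancel₀ _ (hQ.pos y).ne']
    exact hr y
  · change y ∈ frontier (Ioo c d) at hy
    rw [frontier_Ioo_Om hcd] at hy
    obtain ⟨e1, e2, e3, e4⟩ := lam_self_left isScale_scale₁ hc0 hcd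
    obtain ⟨n1, n2, n3, n4⟩ := nu_end hc0 hcd
    rcases hy with rfl | rfl
    · have h := (key y hc0).mono_left (nhdsWithin_le_nhds (s := Ioo y d))
      simp only [e1, e2, n1, n2, zero_mul, add_zero, one_mul] at h
      rwa [mul_div_cancel_left₀ _ (hP.pos y).ne'] at h
    · have h := (key y (hc0.trans hcd)).mono_left (nhdsWithin_le_nhds (s := Ioo c y))
      simp only [e3, e4, n3, n4, zero_mul, zero_add, add_zero, one_mul] at h
      rwa [mul_div_cancel_left₀ _ (hP.pos y).ne'] at h

theorem exists_riquier_Iio (hP : IsWeight P) (hQ : IsWeight Q) {d : Om} (hd0 : 0 < (d : ℝ))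
    (f g : Om → ℝ) :
    IsRiquierSolution (quotientSheaf exH P Q) ⟨Iio d, isOpen_Iio⟩ f g
      (fun x => (P d * f d + ((d : ℝ) - x) / 2 * (Q d * g d)) / P x)
      (fun x => Q d * g d / Q x) := by
  have hv := exists_solution_Iio (s := scale₂) hQ hd0 g
  refine ⟨?_, fun y hy => ⟨?_, hv.2 y hy⟩⟩
  · rw [mem_quotientSheaf_iff hP hQ]
    intro x _
    refine ⟨0, Q d * g d, P d * f d + d / 2 * (Q d * g d), 0, fun _ => ⟨rfl, rfl⟩,
      Eventually.of_forall fun y => ?_⟩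
    simp only
    rw [mul_div_cancel₀ _ (hP.pos y).ne', mul_div_cancel₀ _ (hQ.pos y).ne', bihFun]
    exact ⟨by ring, by ring⟩
  · change y ∈ frontier (Iio d) at hy
    rw [frontier_Iio_Om hd0] at hy
    obtain rfl : y = d := hy
    have h : ContinuousAt (fun x : Om => (P y * f y + ((y : ℝ) - x) / 2 * (Q y * g y)) / P x) y :=
      ContinuousAt.div (by fun_prop) hP.cont.continuousAt (hP.pos y).ne'
    have h' := h.mono_left (nhdsWithin_le_nhds (s := Iio y))
    simp only [sub_self, zero_div, zero_mul, add_zero] at h'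
    rwa [mul_div_cancel_left₀ _ (hP.pos y).ne'] at h'

theorem isPairRegular_Ioo (hP : IsWeight P) (hQ : IsWeight Q) {c d : Om} (hc0 : 0 < (c : ℝ))
    (hcd : c < d) : IsPairRegular (quotientSheaf exH P Q) ⟨Ioo c d, isOpen_Ioo⟩ := by
  have hfr := frontier_Ioo_Om hcd
  refine ⟨(isRegular_Ioo isScale_scale₁ hP hc0 hcd).1, fun f g _ _ => ⟨_, _,
    exists_riquier_Ioo hP hQ hc0 hcd f g, fun hf x hx => ?_, fun u v h => ⟨fun x hx => ?_,
      fun x hx => ?_⟩⟩⟩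
  · change ∀ y ∈ frontier (Ioo c d), 0 ≤ f y ∧ 0 ≤ g y at hf
    rw [hfr] at hf
    obtain ⟨hfc, hgc⟩ := hf c (by simp)
    obtain ⟨hfd, hgd⟩ := hf d (by simp)
    have h1 := (isScale_scale₁.lam_left_pos hc0 hx.1 hx.2).le
    have h2 := (isScale_scale₁.lam_right_pos hc0 hx.1 hx.2).le
    have h3 := (isScale_scale₂.lam_left_pos hc0 hx.1 hx.2).le
    have h4 := (isScale_scale₂.lam_right_pos hc0 hx.1 hx.2).le
    have h5 := nu_left_nonneg hc0 hx.1 hx.2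
    have h6 := nu_right_nonneg hc0 hx.1 hx.2
    have := hP.pos c
    have := hP.pos d
    have := hP.pos x
    have := hQ.pos c
    have := hQ.pos d
    have := hQ.pos x
    constructor <;> positivity
  · simp only
    rw [← (riquier_rep_Ioo hP hQ h hc0 hcd (by simp [hfr]) (by simp [hfr]) Subset.rfl hx).1,
      mul_div_cancel_left₀ _ (hP.pos x).ne']
  · simp only
    rw [← (riquier_rep_Ioo hP hQ h hc0 hcd (by simp [hfr]) (by simp [hfr]) Subset.rfl hx).2,
      mul_div_cancel_left₀ _ (hQ.pos x).ne']

theorem isPairRegular_Iio (hP : IsWeight P) (hQ : IsWeight Q) {d : Om} (hd0 : 0 < (d : ℝ)) :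
    IsPairRegular (quotientSheaf exH P Q) ⟨Iio d, isOpen_Iio⟩ := by
  have hfr := frontier_Iio_Om hd0
  refine ⟨(isRegular_Iio isScale_scale₁ hP hd0).1, fun f g _ _ => ⟨_, _,
    exists_riquier_Iio hP hQ hd0 f g, fun hf x hx => ?_, fun u v h => ⟨fun x hx => ?_,
      fun x hx => ?_⟩⟩⟩
  · change ∀ y ∈ frontier (Iio d), 0 ≤ f y ∧ 0 ≤ g y at hf
    rw [hfr] at hf
    obtain ⟨hfd, hgd⟩ := hf d rfl
    have h1 : 0 ≤ (d : ℝ) - x := sub_nonneg.mpr (le_of_lt hx)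
    have := hP.pos d
    have := hP.pos x
    have := hQ.pos d
    have := hQ.pos x
    constructor <;> positivity
  · simp only
    rw [← (riquier_rep_Iio hP hQ h hd0 (by simp [hfr]) Subset.rfl hx).1,
      mul_div_cancel_left₀ _ (hP.pos x).ne']
  · simp only
    rw [← (riquier_rep_Iio hP hQ h hd0 (by simp [hfr]) Subset.rfl hx).2,
      mul_div_cancel_left₀ _ (hQ.pos x).ne']

/-! ### Biharmonic measures and hyperharmonic pairs -/

/-- The second component of a Riquier solution already solves a Dirichlet problem in the scale 1/x²,
and this excludes components ]0, b[. -/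
theorem IsPairRegular.component (hP : IsWeight P) (hQ : IsWeight Q) {ω : Opens Om}
    (hω : IsPairRegular (quotientSheaf exH P Q) ω) {x : Om} (hx : x ∈ ω) :
    (∃ b, x < b ∧ b ∈ frontier (ω : Set Om) ∧ Iio b ⊆ (ω : Set Om)) ∨
    ∃ a b : Om, 0 < (a : ℝ) ∧ a < x ∧ x < b ∧ a ∈ frontier (ω : Set Om) ∧
      b ∈ frontier (ω : Set Om) ∧ Ioo a b ⊆ (ω : Set Om) := by
  rcases exists_component hω.1 hx with h | ⟨a, b, hax, hxb, ha, hb, hab⟩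
  · exact Or.inl h
  · obtain ⟨u, v, h, -, -⟩ := hω.2 (fun _ => 0) _ continuousOn_const
      (continuous_sub_val b).continuousOn
    exact Or.inr ⟨a, b, left_pos_of_solvable isScale_scale₂ hQ (h.snd hP hQ) (hax.trans hxb) ha hb
      hab, hax, hxb, ha, hb, hab⟩

theorem isBiharmonicMeasures_of_Iio (hP : IsWeight P) (hQ : IsWeight Q) {ω : Opens Om} {d x : Om}
    (hxd : x < d) (hd : d ∈ frontier (ω : Set Om)) (hω : Iio d ⊆ (ω : Set Om)) :
    IsBiharmonicMeasures (quotientSheaf exH P Q) ω x (twoPt 0 (P d / P x) d d)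
      (twoPt 0 (Q d / P x * (((d : ℝ) - x) / 2)) d d) (twoPt 0 (Q d / Q x) d d) := by
  have hPd := hP.pos d
  have hPx := hP.pos x
  have hQd := hQ.pos d
  have hQx := hQ.pos x
  have hxd' : 0 ≤ (d : ℝ) - x := sub_nonneg.mpr (le_of_lt hxd)
  refine ⟨⟨inferInstance, inferInstance, inferInstance⟩, ⟨twoPt_compl isClosed_frontier hd hd,
    twoPt_compl isClosed_frontier hd hd, twoPt_compl isClosed_frontier hd hd⟩,
    fun f g u v _ _ h => ?_⟩
  obtain ⟨h1, h2⟩ := riquier_rep_Iio hP hQ h (Om.pos_of_lt hxd) hd hω hxd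
  rw [setIntegral_twoPt le_rfl (by positivity) isClosed_frontier hd hd,
    setIntegral_twoPt le_rfl (by positivity) isClosed_frontier hd hd,
    setIntegral_twoPt le_rfl (by positivity) isClosed_frontier hd hd]
  constructor
  · refine mul_left_cancel₀ hPx.ne' (h1.trans ?_)
    field_simp
    ring
  · refine mul_left_cancel₀ hQx.ne' (h2.trans ?_)
    field_simp
    ring

theorem isBiharmonicMeasures_of_Ioo (hP : IsWeight P) (hQ : IsWeight Q) {ω : Opens Om}
    {c d x : Om} (hc0 : 0 < (c : ℝ)) (hcx : c < x) (hxd : x < d)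
    (hc : c ∈ frontier (ω : Set Om)) (hd : d ∈ frontier (ω : Set Om))
    (hω : Ioo c d ⊆ (ω : Set Om)) :
    IsBiharmonicMeasures (quotientSheaf exH P Q) ω x
      (twoPt (P c / P x * lam scale₁ c d x) (P d / P x * lam scale₁ d c x) c d)
      (twoPt (Q c / P x * nu c d x) (Q d / P x * nu d c x) c d)
      (twoPt (Q c / Q x * lam scale₂ c d x) (Q d / Q x * lam scale₂ d c x) c d) := by
  have h1 := (isScale_scale₁.lam_left_pos hc0 hcx hxd).le
  have h2 := (isScale_scale₁.lam_right_pos hc0 hcx hxd).le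
  have h3 := (isScale_scale₂.lam_left_pos hc0 hcx hxd).le
  have h4 := (isScale_scale₂.lam_right_pos hc0 hcx hxd).le
  have h5 := nu_left_nonneg hc0 hcx hxd
  have h6 := nu_right_nonneg hc0 hcx hxd
  have hPc := hP.pos c
  have hPd := hP.pos d
  have hPx := hP.pos x
  have hQc := hQ.pos c
  have hQd := hQ.pos d
  have hQx := hQ.pos x
  refine ⟨⟨inferInstance, inferInstance, inferInstance⟩, ⟨twoPt_compl isClosed_frontier hc hd,
    twoPt_compl isClosed_frontier hc hd, twoPt_compl isClosed_frontier hc hd⟩,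
    fun f g u v _ _ h => ?_⟩
  obtain ⟨h7, h8⟩ := riquier_rep_Ioo hP hQ h hc0 (hcx.trans hxd) hc hd hω ⟨hcx, hxd⟩
  rw [setIntegral_twoPt (by positivity) (by positivity) isClosed_frontier hc hd,
    setIntegral_twoPt (by positivity) (by positivity) isClosed_frontier hc hd,
    setIntegral_twoPt (by positivity) (by positivity) isClosed_frontier hc hd]
  constructor
  · refine mul_left_cancel₀ hPx.ne' (h7.trans ?_)
    field_simp
  · refine mul_left_cancel₀ hQx.ne' (h8.trans ?_)
    field_simp

/-- Boundary data (f, 0) isolate the first measure, data (0, f) the other two. -/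
theorem eq_of_isBiharmonicMeasures {𝓗 : Opens Om → Set ((Om → ℝ) × (Om → ℝ))} {ω : Opens Om}
    (hω : IsPairRegular 𝓗 ω) {x : Om} {μ ν ρ : Measure Om}
    (h : IsBiharmonicMeasures 𝓗 ω x μ ν ρ) {c₁ d₁ c₂ d₂ c₃ d₃ : ℝ} (hc₁ : 0 ≤ c₁) (hd₁ : 0 ≤ d₁)
    (hc₂ : 0 ≤ c₂) (hd₂ : 0 ≤ d₂) (hc₃ : 0 ≤ c₃) (hd₃ : 0 ≤ d₃) {a b : Om}
    (ha : a ∈ frontier (ω : Set Om)) (hb : b ∈ frontier (ω : Set Om))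
    (h' : IsBiharmonicMeasures 𝓗 ω x (twoPt c₁ d₁ a b) (twoPt c₂ d₂ a b) (twoPt c₃ d₃ a b)) :
    μ = twoPt c₁ d₁ a b ∧ ν = twoPt c₂ d₂ a b ∧ ρ = twoPt c₃ d₃ a b := by
  obtain ⟨⟨m1, m2, m3⟩, ⟨z1, z2, z3⟩, hint⟩ := h
  refine ⟨eq_twoPt m1 z1 hc₁ hd₁ fun f hf => ?_, eq_twoPt m2 z2 hc₂ hd₂ fun f hf => ?_,
    eq_twoPt m3 z3 hc₃ hd₃ fun f hf => ?_⟩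
  · obtain ⟨u, v, huv, -, -⟩ := hω.2 f (fun _ => 0) hf.continuousOn continuousOn_const
    have e1 := (hint f _ u v hf.continuousOn continuousOn_const huv).1
    have e2 := (h'.2.2 f _ u v hf.continuousOn continuousOn_const huv).1
    rw [setIntegral_twoPt hc₁ hd₁ isClosed_frontier ha hb] at e2
    simp only [integral_zero, add_zero] at e1 e2
    rw [← e1, e2]
  · obtain ⟨u, v, huv, -, -⟩ := hω.2 (fun _ => 0) f continuousOn_const hf.continuousOn
    have e1 := (hint _ f u v continuousOn_const hf.continuousOn huv).1
    have e2 := (h'.2.2 _ f u v continuousOn_const hf.continuousOn huv).1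
    rw [setIntegral_twoPt hc₂ hd₂ isClosed_frontier ha hb] at e2
    simp only [integral_zero, zero_add] at e1 e2
    rw [← e1, e2]
  · obtain ⟨u, v, huv, -, -⟩ := hω.2 (fun _ => 0) f continuousOn_const hf.continuousOn
    have e1 := (hint _ f u v continuousOn_const hf.continuousOn huv).2
    have e2 := (h'.2.2 _ f u v continuousOn_const hf.continuousOn huv).2
    rw [setIntegral_twoPt hc₃ hd₃ isClosed_frontier ha hb] at e2
    rw [← e1, e2]

/-- Hyperharmonicity of a pair expressed on intervals, for the weights `1`. -/
structure HypPair (U : Set Om) (f g : Om → EReal) : Prop where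
  lsc : LowerSemicontinuousOn f U
  ne_bot : ∀ x ∈ U, f x ≠ ⊥
  hyp : Hyp scale₂ U g
  two : ∀ c x d : Om, 0 < (c : ℝ) → c < x → x < d → Icc c d ⊆ U →
    (lam scale₁ c d x : EReal) * f c + (lam scale₁ d c x : EReal) * f d +
      ((nu c d x : EReal) * g c + (nu d c x : EReal) * g d) ≤ f x
  one : ∀ x d : Om, x < d → Iic d ⊆ U → f d + ((((d : ℝ) - x) / 2 : ℝ) : EReal) * g d ≤ f x

theorem EReal.weighted_pair_le_iff {l l' n n' p p' q q' r : ℝ} (hr : 0 < r) {A B C D E : EReal} :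
    ((p / r * l : ℝ) : EReal) * A + ((p' / r * l' : ℝ) : EReal) * B +
      (((q / r * n : ℝ) : EReal) * C + ((q' / r * n' : ℝ) : EReal) * D) ≤ E ↔
    (l : EReal) * (p * A) + l' * (p' * B) + (n * (q * C) + n' * (q' * D)) ≤ r * E := by
  rw [← EReal.coe_mul_le_coe_mul_iff hr, EReal.coe_mul_add hr.le, EReal.coe_mul_add hr.le,
    EReal.coe_mul_add hr.le]
  simp only [← mul_assoc, ← EReal.coe_mul]
  have e (s t : ℝ) : r * (s / r) * t = t * s := by field_simp
  simp only [e]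

/-- As for one sheaf: the biharmonic measures are explicit and carried by at most two points, so the
intervals [0, d[ and ]c, d[ suffice, and the factors P, Q absorb the weights. -/
theorem isHyperharmonicPair_iff (hP : IsWeight P) (hQ : IsWeight Q) {U : Opens Om}
    {u v : Om → EReal} :
    IsHyperharmonicPair (quotientSheaf exH P Q) U u v ↔
      HypPair U (fun x => (P x : EReal) * u x) fun x => (Q x : EReal) * v x := by
  have hone {x d : Om} (hxd : x < d) (hud : u d ≠ ⊥) (hvd : v d ≠ ⊥) :
      (upperIntegral (twoPt 0 (P d / P x) d d) u +
        upperIntegral (twoPt 0 (Q d / P x * (((d : ℝ) - x) / 2)) d d) v ≤ u x ∧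
        upperIntegral (twoPt 0 (Q d / Q x) d d) v ≤ v x) ↔
      ((P d : EReal) * u d + ((((d : ℝ) - x) / 2 : ℝ) : EReal) * (Q d * v d) ≤ P x * u x ∧
        (Q d : EReal) * v d ≤ Q x * v x) := by
    have hPd := hP.pos d
    have hPx := hP.pos x
    have hQd := hQ.pos d
    have hQx := hQ.pos x
    have hxd' : 0 ≤ (d : ℝ) - x := sub_nonneg.mpr (le_of_lt hxd)
    rw [upperIntegral_twoPt le_rfl (by positivity) hud hud,
      upperIntegral_twoPt le_rfl (by positivity) hvd hvd,
      upperIntegral_twoPt le_rfl (by positivity) hvd hvd]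
    have h1 := EReal.weighted_pair_le_iff (l := 0) (l' := 1) (n := 0) (n' := ((d : ℝ) - x) / 2)
      (p := P d) (p' := P d) (q := Q d) (q' := Q d) hPx (A := u d) (B := u d) (C := v d) (D := v d)
      (E := u x)
    have h2 := EReal.weighted_le_iff hQd hQd hQx (c := 0) (d := 1) (A := v d) (B := v d) (C := v x)
    simp only [mul_zero, mul_one, EReal.coe_zero, zero_mul, zero_add, EReal.coe_one, one_mul]
      at h1 h2 ⊢
    rw [h1, h2]
  have htwo {c d x : Om} (hc0 : 0 < (c : ℝ)) (hcx : c < x) (hxd : x < d) (huc : u c ≠ ⊥)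
      (hud : u d ≠ ⊥) (hvc : v c ≠ ⊥) (hvd : v d ≠ ⊥) :
      (upperIntegral (twoPt (P c / P x * lam scale₁ c d x) (P d / P x * lam scale₁ d c x) c d) u +
        upperIntegral (twoPt (Q c / P x * nu c d x) (Q d / P x * nu d c x) c d) v ≤ u x ∧
      upperIntegral (twoPt (Q c / Q x * lam scale₂ c d x) (Q d / Q x * lam scale₂ d c x) c d) v
        ≤ v x) ↔
      ((lam scale₁ c d x : EReal) * (P c * u c) + (lam scale₁ d c x : EReal) * (P d * u d) +
        ((nu c d x : EReal) * (Q c * v c) + (nu d c x : EReal) * (Q d * v d)) ≤ P x * u x ∧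
      (lam scale₂ c d x : EReal) * (Q c * v c) + (lam scale₂ d c x : EReal) * (Q d * v d)
        ≤ Q x * v x) := by
    have h1 := (isScale_scale₁.lam_left_pos hc0 hcx hxd).le
    have h2 := (isScale_scale₁.lam_right_pos hc0 hcx hxd).le
    have h3 := (isScale_scale₂.lam_left_pos hc0 hcx hxd).le
    have h4 := (isScale_scale₂.lam_right_pos hc0 hcx hxd).le
    have h5 := nu_left_nonneg hc0 hcx hxd
    have h6 := nu_right_nonneg hc0 hcx hxd
    have hPc := hP.pos c
    have hPd := hP.pos d
    have hPx := hP.pos x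
    have hQc := hQ.pos c
    have hQd := hQ.pos d
    have hQx := hQ.pos x
    rw [upperIntegral_twoPt (by positivity) (by positivity) huc hud,
      upperIntegral_twoPt (by positivity) (by positivity) hvc hvd,
      upperIntegral_twoPt (by positivity) (by positivity) hvc hvd,
      EReal.weighted_pair_le_iff hPx, EReal.weighted_le_iff hQc hQd hQx]
  constructor
  · intro h
    have honeP : ∀ x d : Om, x < d → Iic d ⊆ (U : Set Om) → _ := fun x d hxd hU => by
      have hfr := frontier_Iio_Om (Om.pos_of_lt hxd)
      have hdU : d ∈ U := hU self_mem_Iic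
      refine (hone hxd (h.ne_bot_fst d hdU) (h.ne_bot_snd d hdU)).mp
        (h.mean_le ⟨Iio d, isOpen_Iio⟩ (isPairRegular_Iio hP hQ (Om.pos_of_lt hxd)) ?_ x hxd _ _ _
          (isBiharmonicMeasures_of_Iio hP hQ hxd (by simp [hfr]) Subset.rfl))
      change closure (Iio d) ⊆ _
      rwa [closure_Iio_Om (Om.pos_of_lt hxd)]
    have htwoP : ∀ c x d : Om, 0 < (c : ℝ) → c < x → x < d → Icc c d ⊆ (U : Set Om) → _ :=
      fun c x d hc0 hcx hxd hU => by
      have hfr := frontier_Ioo_Om (hcx.trans hxd)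
      have hcU : c ∈ U := hU ⟨le_rfl, (hcx.trans hxd).le⟩
      have hdU : d ∈ U := hU ⟨(hcx.trans hxd).le, le_rfl⟩
      refine (htwo hc0 hcx hxd (h.ne_bot_fst c hcU) (h.ne_bot_fst d hdU) (h.ne_bot_snd c hcU)
        (h.ne_bot_snd d hdU)).mp
        (h.mean_le ⟨Ioo c d, isOpen_Ioo⟩ (isPairRegular_Ioo hP hQ hc0 (hcx.trans hxd)) ?_ x
          ⟨hcx, hxd⟩ _ _ _
          (isBiharmonicMeasures_of_Ioo hP hQ hc0 hcx hxd (by simp [hfr]) (by simp [hfr])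
            Subset.rfl))
      change closure (Ioo c d) ⊆ _
      rwa [closure_Ioo (hcx.trans hxd).ne]
    exact ⟨lsc_weight_mul hP h.lsc_fst,
      fun x hx => EReal.coe_mul_ne_bot (hP.pos x).le (h.ne_bot_fst x hx),
      ⟨lsc_weight_mul hQ h.lsc_snd,
        fun x hx => EReal.coe_mul_ne_bot (hQ.pos x).le (h.ne_bot_snd x hx),
        fun c x d h1 h2 h3 h4 => (htwoP c x d h1 h2 h3 h4).2,
        fun x d h1 h2 => (honeP x d h1 h2).2⟩,
      fun c x d h1 h2 h3 h4 => (htwoP c x d h1 h2 h3 h4).1, fun x d h1 h2 => (honeP x d h1 h2).1⟩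
  · intro h
    have hu : ∀ x ∈ U, u x ≠ ⊥ := fun x hx =>
      (EReal.coe_mul_ne_bot_iff (hP.pos x)).mp (h.ne_bot x hx)
    have hv : ∀ x ∈ U, v x ≠ ⊥ := fun x hx =>
      (EReal.coe_mul_ne_bot_iff (hQ.pos x)).mp (h.hyp.ne_bot x hx)
    refine ⟨(lsc_weight_mul_iff hP).mp h.lsc, (lsc_weight_mul_iff hQ).mp h.hyp.lsc, hu, hv,
      fun ω hω hωU x hx μ ν ρ hm => ?_⟩
    have hPx := hP.pos x
    have hQx := hQ.pos x
    rcases hω.component hP hQ hx with ⟨d, hxd, hd, hdω⟩ | ⟨c, d, hc0, hcx, hxd, hc, hd, hcd⟩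
    · have hPd := hP.pos d
      have hQd := hQ.pos d
      have hxd' : 0 ≤ (d : ℝ) - x := sub_nonneg.mpr (le_of_lt hxd)
      obtain ⟨rfl, rfl, rfl⟩ := eq_of_isBiharmonicMeasures hω hm le_rfl (by positivity) le_rfl
        (by positivity) le_rfl (by positivity) hd hd (isBiharmonicMeasures_of_Iio hP hQ hxd hd hdω)
      have hU : Iic d ⊆ (U : Set Om) := by
        rw [← closure_Iio_Om (Om.pos_of_lt hxd)]
        exact (closure_mono hdω).trans hωU
      have hdU : d ∈ U := hU self_mem_Iic
      exact (hone hxd (hu d hdU) (hv d hdU)).mpr ⟨h.one x d hxd hU, h.hyp.one x d hxd hU⟩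
    · have h1 := (isScale_scale₁.lam_left_pos hc0 hcx hxd).le
      have h2 := (isScale_scale₁.lam_right_pos hc0 hcx hxd).le
      have h3 := (isScale_scale₂.lam_left_pos hc0 hcx hxd).le
      have h4 := (isScale_scale₂.lam_right_pos hc0 hcx hxd).le
      have h5 := nu_left_nonneg hc0 hcx hxd
      have h6 := nu_right_nonneg hc0 hcx hxd
      have hPc := hP.pos c
      have hPd := hP.pos d
      have hQc := hQ.pos c
      have hQd := hQ.pos d
      obtain ⟨rfl, rfl, rfl⟩ := eq_of_isBiharmonicMeasures hω hm (by positivity) (by positivity)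
        (by positivity) (by positivity) (by positivity) (by positivity) hc hd
        (isBiharmonicMeasures_of_Ioo hP hQ hc0 hcx hxd hc hd hcd)
      have hU : Icc c d ⊆ (U : Set Om) := by
        rw [← closure_Ioo (hcx.trans hxd).ne]
        exact (closure_mono hcd).trans hωU
      have hcU : c ∈ U := hU ⟨le_rfl, (hcx.trans hxd).le⟩
      have hdU : d ∈ U := hU ⟨(hcx.trans hxd).le, le_rfl⟩
      exact (htwo hc0 hcx hxd (hu c hcU) (hu d hdU) (hv c hcU) (hv d hdU)).mpr
        ⟨h.two c x d hc0 hcx hxd hU, h.hyp.two c x d hc0 hcx hxd hU⟩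

end Pairs


/-! ### The associated harmonic spaces -/

section Associated

variable {s w P Q : Om → ℝ}

theorem toE_mul (w u : Om → ℝ) : (fun x => (w x : EReal) * toE u x) = toE fun x => w x * u x := by
  funext x
  simp [toE]

theorem Hyp.const {U : Set Om} (hs : IsScale s) (c : ℝ) : Hyp s U fun _ => (c : EReal) where
  lsc := continuousOn_const.lowerSemicontinuousOn
  ne_bot _ _ := EReal.coe_ne_bot _
  two a x b ha hax hxb _ := by
    rw [← EReal.coe_mul, ← EReal.coe_mul, ← EReal.coe_add, ← add_mul,
      hs.lam_add ha (hax.trans hxb), one_mul]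
  one _ _ _ _ := le_rfl

/-- The inequalities for u and -u together say that w u equals its interpolation between the ends of
every small interval, which is the local form of a section. This identifies the associated sheaves,
which are defined through hyperharmonic functions. -/
theorem mem_wSheaf_iff_hyp (hs : IsScale s) (hw : IsWeight w) {U : Opens Om} {u : Om → ℝ} :
    u ∈ wSheaf s w U ↔ Hyp s U (fun x => (w x : EReal) * toE u x) ∧
      Hyp s U fun x => (w x : EReal) * toE (-u) x := by
  constructor
  · have key : ∀ u ∈ wSheaf s w U, Hyp s U fun x => (w x : EReal) * toE u x := by
      intro u hu
      rw [toE_mul]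
      refine ⟨?_, fun _ _ => EReal.coe_ne_bot _, fun a x b ha hax hxb hU => ?_,
        fun x b hxb hU => ?_⟩
      · have : ContinuousOn (fun x => w x * u x) U :=
          hw.cont.continuousOn.mul fun x hx => (wSheaf_continuousAt hs hw hu hx).continuousWithinAt
        exact (continuous_coe_real_ereal.comp_continuousOn this).lowerSemicontinuousOn
      · obtain ⟨α, β, -, h⟩ := exists_coef_on hs hu ordConnected_Icc hU
        have hab := (hax.trans hxb).le
        simp only [toE]
        rw [h x ⟨hax.le, hxb.le⟩, h a ⟨le_rfl, hab⟩, h b ⟨hab, le_rfl⟩,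
          hs.interp ha (hax.trans hxb) x α β]
        push_cast
        exact le_rfl
      · obtain ⟨α, β, h0, h⟩ := exists_coef_on hs hu ordConnected_Iic hU
        simp only [toE]
        rw [h x hxb.le, h b self_mem_Iic, h0 zeroOm (zeroOm_le b) rfl]
        simp
    intro hu
    refine ⟨key u hu, key _ ?_⟩
    have h := (isFunctionSheaf_wSheaf hs hw).smul_mem U (-1) u hu
    rwa [show (fun x => -1 * u x) = -u from funext fun x => by simp] at h
  · rintro ⟨h1, h2⟩ x hx
    rw [toE_mul] at h1 h2
    rcases Om.eq_zero_or_pos x with rfl | hx0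
    · obtain ⟨b, hb, hbU⟩ := nhds_zeroOm_basis (U.isOpen.mem_nhds hx)
      refine ⟨w b * u b, 0, fun _ => rfl, ?_⟩
      filter_upwards [Iic_mem_nhds_zero hb] with y hy
      have e1 := EReal.coe_le_coe_iff.mp (h1.one y b hy hbU)
      have e2 := EReal.coe_le_coe_iff.mp (h2.one y b hy hbU)
      simp only [Pi.neg_apply] at e2
      linarith
    · obtain ⟨a, b, ha, hax, hxb, hU⟩ := nhds_pos_basis hx0 (U.isOpen.mem_nhds hx)
      obtain ⟨α, β, h⟩ := hs.exists_coef ha (hax.trans hxb) (w a * u a) (w b * u b)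
      refine ⟨α, β, fun h => absurd h hx0.ne', ?_⟩
      filter_upwards [Ioo_mem_nhds hax hxb] with y hy
      have e1 := h1.two a y b ha hy.1 hy.2 hU
      have e2 := h2.two a y b ha hy.1 hy.2 hU
      simp only [toE, ← EReal.coe_mul, ← EReal.coe_add, EReal.coe_le_coe_iff, Pi.neg_apply]
        at e1 e2
      rw [← h y]
      linarith

theorem hypPair_zero_iff {U : Set Om} {f : Om → EReal} :
    HypPair U f (fun _ => 0) ↔ Hyp scale₁ U f := by
  constructor
  · intro h
    refine ⟨h.lsc, h.ne_bot, fun a x b ha hax hxb hU => ?_, fun x b hxb hU => ?_⟩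
    · simpa using h.two a x b ha hax hxb hU
    · simpa using h.one x b hxb hU
  · intro h
    refine ⟨h.lsc, h.ne_bot, by simpa using Hyp.const isScale_scale₂ 0,
      fun a x b ha hax hxb hU => ?_, fun x b hxb hU => ?_⟩
    · simpa using h.two a x b ha hax hxb hU
    · simpa using h.one x b hxb hU

theorem hypPair_top_iff {U : Set Om} {g : Om → EReal} :
    HypPair U (fun _ => ⊤) g ↔ Hyp scale₂ U g :=
  ⟨fun h => h.hyp, fun h => ⟨continuousOn_const.lowerSemicontinuousOn, fun _ _ => by simp, h,
    fun _ _ _ _ _ _ _ => le_top, fun _ _ _ _ => le_top⟩⟩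

theorem mem_hyper₁_iff (hP : IsWeight P) (hQ : IsWeight Q) {U : Opens Om} {u : Om → EReal} :
    u ∈ hyper₁ (quotientSheaf exH P Q) U ↔ Hyp scale₁ U fun x => (P x : EReal) * u x := by
  rw [hyper₁, mem_ofPred_eq, isHyperharmonicPair_iff hP hQ, ← hypPair_zero_iff]
  simp

theorem mem_hyper₂_iff (hP : IsWeight P) (hQ : IsWeight Q) {U : Opens Om} {v : Om → EReal} :
    v ∈ hyper₂ (quotientSheaf exH P Q) U ↔ Hyp scale₂ U fun x => (Q x : EReal) * v x := by
  rw [hyper₂, mem_ofPred_eq, isHyperharmonicPair_iff hP hQ, ← hypPair_top_iff]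
  simp [EReal.coe_mul_top_of_pos (hP.pos _)]

theorem assoc₁_quotient (hP : IsWeight P) (hQ : IsWeight Q) :
    assoc₁ (quotientSheaf exH P Q) = wSheaf scale₁ P := by
  funext U
  ext u
  rw [assoc₁, mem_ofPred_eq, mem_hyper₁_iff hP hQ, mem_hyper₁_iff hP hQ,
    mem_wSheaf_iff_hyp isScale_scale₁ hP]

theorem assoc₂_quotient (hP : IsWeight P) (hQ : IsWeight Q) :
    assoc₂ (quotientSheaf exH P Q) = wSheaf scale₂ Q := by
  funext U
  ext u
  rw [assoc₂, mem_ofPred_eq, mem_hyper₂_iff hP hQ, mem_hyper₂_iff hP hQ,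
    mem_wSheaf_iff_hyp isScale_scale₂ hQ]

theorem isBiharmonicSpace_quotient (hP : IsWeight P) (hQ : IsWeight Q) :
    IsBiharmonicSpace (quotientSheaf exH P Q) where
  locallyCompact := inferInstance
  hausdorff := inferInstance
  countableBase := inferInstance
  sheaf := isPairSheaf_quotient hP hQ
  base := isTopologicalBasis_of_intervals (by rintro _ ⟨ω, rfl, -⟩; exact ω.isOpen)
    (fun _ hb => ⟨_, rfl, isPairRegular_Iio hP hQ hb⟩)
    (fun _ _ ha hab => ⟨_, rfl, isPairRegular_Ioo hP hQ ha hab⟩)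
  bauer₁ := assoc₁_quotient hP hQ ▸ isBauerHarmonicSpace_wSheaf isScale_scale₁ hP
  bauer₂ := assoc₂_quotient hP hQ ▸ isBauerHarmonicSpace_wSheaf isScale_scale₂ hQ

theorem isBrelotBiharmonicSpace_quotient (hP : IsWeight P) (hQ : IsWeight Q) :
    IsBrelotBiharmonicSpace (quotientSheaf exH P Q) :=
  ⟨isBiharmonicSpace_quotient hP hQ,
    assoc₁_quotient hP hQ ▸ isBrelotHarmonicSpace_wSheaf isScale_scale₁ hP,
    assoc₂_quotient hP hQ ▸ isBrelotHarmonicSpace_wSheaf isScale_scale₂ hQ⟩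

theorem isGreenBiharmonicSpace_quotient (hP : IsWeight P) (hQ : IsWeight Q) :
    IsGreenBiharmonicSpace (quotientSheaf exH P Q) :=
  ⟨isBiharmonicSpace_quotient hP hQ,
    assoc₁_quotient hP hQ ▸ isGreenHarmonicSpace_wSheaf isScale_scale₁ hP,
    assoc₂_quotient hP hQ ▸ isGreenHarmonicSpace_wSheaf isScale_scale₂ hQ⟩

theorem assoc₁_exH : assoc₁ exH = exH₁ := by
  rw [exH_eq_quotient, assoc₁_quotient isWeight_one isWeight_one, exH₁_eq]

theorem assoc₂_exH : assoc₂ exH = exH₂ := by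
  rw [exH_eq_quotient, assoc₂_quotient isWeight_one isWeight_one, exH₂_eq]

theorem isSymmetricGreen_wSheaf_one (hs : IsScale s) :
    IsSymmetricGreenHarmonicSpace (wSheaf s fun _ => 1) :=
  ⟨isGreenHarmonicSpace_wSheaf hs isWeight_one, green s,
    wGreen_one s ▸ isGreenFamily_wGreen hs isWeight_one, fun x y => green_comm s y x⟩

end Associated


/-! ### Real potentials on the unit interval -/

section RealPotential

variable {g : ℝ → ℝ}

/-- The kernel `p_t (x) t`. -/
def ker (x t : ℝ) : ℝ := t * (1 / max x t - 1)

/-- The potential `∫ p_t (x) g (t) t dt`. -/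
def potR (g : ℝ → ℝ) (x : ℝ) : ℝ := ∫ t in (0 : ℝ)..1, ker x t * g t

theorem ker_of_le {x t : ℝ} (h : t ≤ x) : ker x t = (1 / x - 1) * t := by
  rw [ker, max_eq_left h, mul_comm]

theorem ker_of_ge {x t : ℝ} (ht : 0 < t) (h : x ≤ t) : ker x t = 1 - t := by
  rw [ker, max_eq_right h]
  field_simp

theorem ker_nonneg {x t : ℝ} (hx1 : x < 1) (ht : 0 ≤ t) (ht1 : t ≤ 1) :
    0 ≤ ker x t := by
  rcases eq_or_lt_of_le ht with rfl | ht
  · simp [ker]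
  · have hm : 0 < max x t := lt_max_of_lt_right ht
    refine mul_nonneg ht.le ?_
    rw [sub_nonneg, le_div_iff₀ hm, one_mul]
    exact max_le hx1.le ht1

theorem ker_le_one {x t : ℝ} (ht : 0 ≤ t) : ker x t ≤ 1 := by
  rcases eq_or_lt_of_le ht with rfl | ht
  · simp [ker]
  · have hm : 0 < max x t := lt_max_of_lt_right ht
    have : t * (1 / max x t) ≤ 1 := by
      rw [mul_one_div, div_le_one hm]
      exact le_max_right _ _
    rw [ker]
    linarith

theorem ker_antitone {x d t : ℝ} (hxd : x ≤ d) (ht : 0 < t) : ker d t ≤ ker x t := by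
  have hm : 0 < max x t := lt_max_of_lt_right ht
  have := one_div_le_one_div_of_le hm (max_le_max_right t hxd)
  rw [ker, ker]
  gcongr

theorem intervalIntegrable_ker_mul (hg : ∀ a b, IntervalIntegrable g volume a b) {x : ℝ}
    (hx : 0 ≤ x) {a b : ℝ} (ha : 0 ≤ a) (hb : 0 ≤ b) :
    IntervalIntegrable (fun t => ker x t * g t) volume a b := by
  rcases eq_or_lt_of_le hx with rfl | hx
  · have h : IntervalIntegrable (fun t => (1 - t) * g t) volume a b :=
      (hg a b).continuousOn_mul (continuous_const.sub continuous_id).continuousOn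
    refine h.congr fun t ht => ?_
    have ht0 : 0 < t := (le_min ha hb).trans_lt ht.1
    simp only [ker_of_ge ht0 ht0.le]
  · refine (hg a b).continuousOn_mul (Continuous.continuousOn ?_)
    have : ∀ t : ℝ, max x t ≠ 0 := fun t => (lt_max_of_lt_left hx).ne'
    unfold ker
    fun_prop (disch := assumption)

/-- The product x t p_t(x) = min(x,t) (1 - max(x,t)) is the Green function of -z'' on ]0,1[, so x
times the potential solves -z'' = g with zero values at 0 and 1. -/
theorem mul_potR (hg : ∀ a b, IntervalIntegrable g volume a b) {x : ℝ} (hx : 0 < x)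
    (hx1 : x < 1) :
    x * potR g x = (1 - x) * (∫ t in (0 : ℝ)..x, t * g t) + x * ∫ t in x..1, (1 - t) * g t := by
  have h1 : ∫ t in (0 : ℝ)..x, ker x t * g t = (1 / x - 1) * ∫ t in (0 : ℝ)..x, t * g t := by
    rw [← intervalIntegral.integral_const_mul]
    refine intervalIntegral.integral_congr fun t ht => ?_
    rw [uIcc_of_le hx.le] at ht
    simp only [ker_of_le ht.2, mul_assoc]
  have h2 : ∫ t in x..1, ker x t * g t = ∫ t in x..1, (1 - t) * g t := by
    refine intervalIntegral.integral_congr fun t ht => ?_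
    rw [uIcc_of_le hx1.le] at ht
    simp only [ker_of_ge (hx.trans_le ht.1) ht.1]
  rw [potR, ← intervalIntegral.integral_add_adjacent_intervals
    (intervalIntegrable_ker_mul hg hx.le le_rfl hx.le)
    (intervalIntegrable_ker_mul hg hx.le hx.le zero_le_one), h1, h2]
  field_simp

theorem integral_affine_mul (hg : ∀ a b, IntervalIntegrable g volume a b) (p q a b : ℝ) :
    ∫ t in a..b, (p + q * t) * g t = p * (∫ t in a..b, g t) + q * ∫ t in a..b, t * g t := by
  rw [← intervalIntegral.integral_const_mul, ← intervalIntegral.integral_const_mul,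
    ← intervalIntegral.integral_add ((hg a b).const_mul p)
      ((show IntervalIntegrable (fun t => t * g t) volume a b from
        (hg a b).continuousOn_mul continuousOn_id).const_mul q)]
  refine intervalIntegral.integral_congr fun t _ => ?_
  ring

/-- On a subinterval, a solution of -z'' = g is the linear interpolation of its end values plus the
solution with zero end values. -/
theorem mul_potR_eq_tent (hg : ∀ a b, IntervalIntegrable g volume a b) {c x d : ℝ} (hc : 0 < c)
    (hcx : c < x) (hxd : x < d) (hd : d < 1) :
    x * potR g x = (d - x) / (d - c) * (c * potR g c) + (x - c) / (d - c) * (d * potR g d) +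
      tentInt c d x g := by
  have hg' : ∀ a b, IntervalIntegrable (fun t => t * g t) volume a b :=
    fun a b => (hg a b).continuousOn_mul continuousOn_id
  have e1 : ∀ a b, ∫ t in a..b, (1 - t) * g t =
      (∫ t in a..b, g t) - ∫ t in a..b, t * g t := by
    intro a b
    have := integral_affine_mul hg 1 (-1) a b
    simp only [neg_mul, one_mul, ← sub_eq_add_neg] at this
    exact this
  have e2 : ∫ t in c..x, (t - c) * g t = (∫ t in c..x, t * g t) - c * ∫ t in c..x, g t := by
    have := integral_affine_mul hg (-c) 1 c x
    simp only [one_mul, neg_add_eq_sub, neg_mul] at this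
    exact this
  have e3 : ∫ t in x..d, (d - t) * g t = d * (∫ t in x..d, g t) - ∫ t in x..d, t * g t := by
    have := integral_affine_mul hg d (-1) x d
    simp only [neg_mul, one_mul, ← sub_eq_add_neg] at this
    exact this
  rw [mul_potR hg hc (by linarith), mul_potR hg (hc.trans hcx) (by linarith),
    mul_potR hg (by linarith) hd, tentInt, e1, e1, e1, e2, e3,
    ← intervalIntegral.integral_add_adjacent_intervals (hg c x) (hg x 1),
    ← intervalIntegral.integral_add_adjacent_intervals (hg x d) (hg d 1),
    ← intervalIntegral.integral_add_adjacent_intervals (hg' c x) (hg' x 1),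
    ← intervalIntegral.integral_add_adjacent_intervals (hg' x d) (hg' d 1),
    ← intervalIntegral.integral_add_adjacent_intervals (hg' 0 x) (hg' x d),
    ← intervalIntegral.integral_add_adjacent_intervals (hg' 0 c) (hg' c x)]
  have : d - c ≠ 0 := by linarith
  field_simp
  ring

theorem intervalIntegrable_const_one : ∀ a b : ℝ,
    IntervalIntegrable (fun _ => (1 : ℝ)) volume a b := fun _ _ => intervalIntegrable_const

theorem potR_one {x : ℝ} (hx : 0 ≤ x) (hx1 : x < 1) : potR (fun _ => 1) x = (1 - x) / 2 := by
  have h : ∀ a b : ℝ, ∫ t in a..b, (1 - t) * (1 : ℝ) = (b - a) - (b ^ 2 - a ^ 2) / 2 := by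
    intro a b
    have := integral_affine_mul intervalIntegrable_const_one 1 (-1) a b
    simp only [neg_mul, one_mul, ← sub_eq_add_neg, mul_one, intervalIntegral.integral_const,
      integral_id, smul_eq_mul] at this ⊢
    exact this
  rcases eq_or_lt_of_le hx with rfl | hx
  · have : potR (fun _ => 1) 0 = ∫ t in (0 : ℝ)..1, (1 - t) * (1 : ℝ) := by
      refine intervalIntegral.integral_congr_ae (ae_of_all _ fun t ht => ?_)
      rw [uIoc_of_le zero_le_one] at ht
      rw [ker_of_ge ht.1 ht.1.le]
    rw [this, h]
    norm_num
  · have := mul_potR intervalIntegrable_const_one hx hx1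
    rw [h] at this
    simp only [mul_one, integral_id] at this
    refine mul_left_cancel₀ hx.ne' ?_
    rw [this]
    ring

theorem potR_nonneg {x : ℝ} (hx1 : x < 1) (h0 : ∀ t, 0 ≤ g t) : 0 ≤ potR g x :=
  intervalIntegral.integral_nonneg zero_le_one fun t ht =>
    mul_nonneg (ker_nonneg hx1 ht.1 ht.2) (h0 t)

theorem potR_le (hg : ∀ a b, IntervalIntegrable g volume a b) {x N : ℝ} (hx : 0 ≤ x)
    (hx1 : x < 1) (hN : ∀ t, g t ≤ N) : potR g x ≤ N * ((1 - x) / 2) := by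
  rw [← potR_one hx hx1, potR, potR, ← intervalIntegral.integral_const_mul]
  refine intervalIntegral.integral_mono_on zero_le_one
    (intervalIntegrable_ker_mul hg hx le_rfl zero_le_one)
    ((intervalIntegrable_ker_mul intervalIntegrable_const_one hx le_rfl zero_le_one).const_mul N)
    fun t ht => ?_
  have := mul_le_mul_of_nonneg_left (hN t) (ker_nonneg hx1 ht.1 ht.2)
  linarith

/-- The difference `ker x t - ker d t` is nonnegative and vanishes for t ≥ d, so only values of g on
]0, d] enter. There g is compared with the constant m, for which `potR_one` gives the term (d - x)/2
* m. -/
theorem potR_add_le (hg : ∀ a b, IntervalIntegrable g volume a b) {x d m : ℝ} (hx : 0 ≤ x)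
    (hxd : x < d) (hd : d < 1) (hm : ∀ t, 0 < t → t ≤ d → m ≤ g t) :
    potR g d + (d - x) / 2 * m ≤ potR g x := by
  have hd0 : 0 ≤ d := hx.trans hxd.le
  have i1 := intervalIntegrable_ker_mul hg hx le_rfl zero_le_one
  have i2 := intervalIntegrable_ker_mul hg hd0 le_rfl zero_le_one
  have j1 := intervalIntegrable_ker_mul intervalIntegrable_const_one hx le_rfl zero_le_one
  have j2 := intervalIntegrable_ker_mul intervalIntegrable_const_one hd0 le_rfl zero_le_one
  have h : 0 ≤ ∫ t in (0 : ℝ)..1, ((ker x t * g t - ker d t * g t) -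
      (ker x t * 1 - ker d t * 1) * m) := by
    refine intervalIntegral.integral_nonneg zero_le_one fun t ht => ?_
    have e : (ker x t * g t - ker d t * g t) - (ker x t * 1 - ker d t * 1) * m =
      (ker x t - ker d t) * (g t - m) := by ring
    rw [e]
    rcases eq_or_lt_of_le ht.1 with rfl | h0
    · simp [ker]
    rcases le_total t d with htd | htd
    · exact mul_nonneg (sub_nonneg.mpr (ker_antitone hxd.le h0)) (sub_nonneg.mpr (hm t h0 htd))
    · rw [ker_of_ge h0 htd, ker_of_ge h0 (hxd.le.trans htd)]
      simp
  rw [intervalIntegral.integral_sub (i1.sub i2) ((j1.sub j2).mul_const m),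
    intervalIntegral.integral_mul_const, intervalIntegral.integral_sub i1 i2,
    intervalIntegral.integral_sub j1 j2] at h
  have e1 := potR_one hx (hxd.trans hd)
  have e2 := potR_one hd0 hd
  rw [potR] at e1 e2
  rw [e1, e2] at h
  rw [potR, potR]
  linarith

theorem tentInt_mono {f : ℝ → ℝ} {c d x : ℝ} (hcx : c < x) (hxd : x < d)
    (hf : IntervalIntegrable f volume c d) (hg : IntervalIntegrable g volume c d)
    (h : ∀ t ∈ Icc c d, f t ≤ g t) : tentInt c d x f ≤ tentInt c d x g := by
  have hs1 : uIcc c x ⊆ uIcc c d := by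
    rw [uIcc_of_le hcx.le, uIcc_of_le (hcx.trans hxd).le]
    exact Icc_subset_Icc_right hxd.le
  have hs2 : uIcc x d ⊆ uIcc c d := by
    rw [uIcc_of_le hxd.le, uIcc_of_le (hcx.trans hxd).le]
    exact Icc_subset_Icc_left hcx.le
  have h3 : 0 ≤ (d - x) / (d - c) := div_nonneg (by linarith) (by linarith)
  have h4 : 0 ≤ (x - c) / (d - c) := div_nonneg (by linarith) (by linarith)
  have c1 : ContinuousOn (fun t : ℝ => t - c) (uIcc c x) := by fun_prop
  have c2 : ContinuousOn (fun t : ℝ => d - t) (uIcc x d) := by fun_prop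
  refine add_le_add (mul_le_mul_of_nonneg_left ?_ h3) (mul_le_mul_of_nonneg_left ?_ h4)
  · refine intervalIntegral.integral_mono_on hcx.le ((hf.mono_set hs1).continuousOn_mul c1)
      ((hg.mono_set hs1).continuousOn_mul c1) fun t ht => ?_
    exact mul_le_mul_of_nonneg_left (h t ⟨ht.1, ht.2.trans hxd.le⟩) (by linarith [ht.1])
  · refine intervalIntegral.integral_mono_on hxd.le ((hf.mono_set hs2).continuousOn_mul c2)
      ((hg.mono_set hs2).continuousOn_mul c2) fun t ht => ?_
    exact mul_le_mul_of_nonneg_left (h t ⟨hcx.le.trans ht.1, ht.2⟩) (by linarith [ht.2])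

theorem tentInt_const {c d x : ℝ} (hcd : c < d) (m : ℝ) :
    tentInt c d x (fun _ => m) = m * ((x - c) * (d - x) / 2) := by
  have h : d - c ≠ 0 := by linarith
  have e1 : ∫ t in c..x, (t - c) * m = m * ((x - c) ^ 2 / 2) := by
    rw [intervalIntegral.integral_mul_const, intervalIntegral.integral_sub
      intervalIntegral.intervalIntegrable_id intervalIntegrable_const, integral_id,
      intervalIntegral.integral_const, smul_eq_mul]
    ring
  have e2 : ∫ t in x..d, (d - t) * m = m * ((d - x) ^ 2 / 2) := by
    rw [intervalIntegral.integral_mul_const, intervalIntegral.integral_sub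
      intervalIntegrable_const intervalIntegral.intervalIntegrable_id, integral_id,
      intervalIntegral.integral_const, smul_eq_mul]
    ring
  rw [tentInt, e1, e2]
  field_simp
  ring

/-- Dominated convergence with a kernel between 0 and 1; the point 0 is included because 1 /
max(x,t) stays continuous in x for t > 0. -/
theorem continuous_potR (hg : Measurable g) {N : ℝ} (hN : ∀ t, |g t| ≤ N) :
    Continuous fun x : Om => potR g x := by
  refine intervalIntegral.continuous_of_dominated_interval (bound := fun _ => N) (fun x => ?_)
    (fun x => ae_of_all _ fun t ht => ?_) intervalIntegrable_const
    (ae_of_all _ fun t ht => ?_)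
  · have : Measurable fun t => ker x t * g t := by
      unfold ker
      fun_prop
    exact this.aestronglyMeasurable
  · rw [uIoc_of_le zero_le_one] at ht
    rw [norm_mul, Real.norm_eq_abs, Real.norm_eq_abs,
      abs_of_nonneg (ker_nonneg x.2.2 ht.1.le ht.2)]
    calc _ ≤ 1 * N := mul_le_mul (ker_le_one ht.1.le) (hN t) (abs_nonneg _) zero_le_one
      _ = N := one_mul N
  · rw [uIoc_of_le zero_le_one] at ht
    have : ∀ x : Om, max (x : ℝ) t ≠ 0 := fun x => (lt_max_of_lt_right ht.1).ne'
    unfold ker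
    fun_prop (disch := assumption)

end RealPotential


/-! ### Potentials of bounded functions -/

/-- The potential `∫ p_y (x) g (y) dμ(y)`. -/
def pot (g : Om → EReal) (x : Om) : ENNReal :=
  ∫⁻ y, (exGreen₁ y x).toENNReal * (g y).toENNReal ∂exμ

theorem Om.coe_max (x y : Om) : ((max x y : Om) : ℝ) = max (x : ℝ) y := by
  rcases le_total x y with h | h
  · rw [max_eq_right h, max_eq_right (show (x : ℝ) ≤ y from h)]
  · rw [max_eq_left h, max_eq_left (show (y : ℝ) ≤ x from h)]

/-- The density y of μ cancels the pole: at y = 0 both sides are 0, even for x = 0, since 0 * ∞ = 0.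
-/
theorem ofReal_mul_green₁ (x y : Om) :
    ENNReal.ofReal y * (exGreen₁ y x).toENNReal = ENNReal.ofReal (ker x y) := by
  rcases Om.eq_zero_or_pos y with rfl | hy
  · simp [zeroOm, ker]
  · rw [exGreen₁_eq, green_coe _ (max_pos_of_right hy x), EReal.toENNReal_of_ne_top (EReal.coe_ne_top _), EReal.toReal_coe,
      ← ENNReal.ofReal_mul hy.le, scale₁, Om.coe_max, ker]

theorem measurable_green₁ (x : Om) : Measurable fun y => (exGreen₁ y x).toENNReal := by
  rw [exGreen₁_eq]
  exact (continuous_green_left isScale_scale₁ x).measurable.ereal_toENNReal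

theorem lintegral_exμ {f : Om → ENNReal} (hf : Measurable f) :
    ∫⁻ y, f y ∂exμ =
      ∫⁻ y : Om, ENNReal.ofReal y * f y ∂(Measure.comap Subtype.val (volume : Measure ℝ)) := by
  rw [exμ, lintegral_withDensity_eq_lintegral_mul _ (by fun_prop) hf]
  rfl

theorem lintegral_comap_Om (f : ℝ → ENNReal) :
    ∫⁻ y : Om, f y ∂(Measure.comap Subtype.val (volume : Measure ℝ)) =
      ∫⁻ t in Ioc (0 : ℝ) 1, f t := by
  rw [lintegral_subtype_comap measurableSet_Ico, Measure.restrict_congr_set Ico_ae_eq_Ioc]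

section Bounded

variable {γ : Om → ℝ}

theorem extendOm_of_notMem (γ : Om → ℝ) {t : ℝ} (ht : t ∉ Ico (0 : ℝ) 1) : extendOm γ t = 0 :=
  Function.extend_apply' _ _ _ fun ⟨x, hx⟩ => ht (hx ▸ x.2)

theorem extendOm_of_mem (γ : Om → ℝ) {t : ℝ} (ht : t ∈ Ico (0 : ℝ) 1) :
    extendOm γ t = γ ⟨t, ht⟩ := extendOm_val γ ⟨t, ht⟩

theorem extendOm_nonneg (h0 : ∀ x, 0 ≤ γ x) (t : ℝ) : 0 ≤ extendOm γ t := by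
  by_cases ht : t ∈ Ico (0 : ℝ) 1
  · exact extendOm_of_mem γ ht ▸ h0 _
  · exact (extendOm_of_notMem γ ht).ge

theorem extendOm_le (h0 : ∀ x, 0 ≤ γ x) (ha : Antitone γ) (t : ℝ) :
    extendOm γ t ≤ γ zeroOm := by
  by_cases ht : t ∈ Ico (0 : ℝ) 1
  · exact extendOm_of_mem γ ht ▸ ha (zeroOm_le _)
  · exact (extendOm_of_notMem γ ht).trans_le (h0 _)

theorem abs_extendOm_le {N : ℝ} (hN : ∀ x, |γ x| ≤ N) (t : ℝ) : |extendOm γ t| ≤ N := by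
  by_cases ht : t ∈ Ico (0 : ℝ) 1
  · exact extendOm_of_mem γ ht ▸ hN _
  · rw [extendOm_of_notMem γ ht, abs_zero]
    exact (abs_nonneg _).trans (hN zeroOm)

theorem abs_le_of_antitone (h0 : ∀ x, 0 ≤ γ x) (ha : Antitone γ) (x : Om) : |γ x| ≤ γ zeroOm :=
  (abs_of_nonneg (h0 x)).trans_le (ha (zeroOm_le x))

theorem measurable_extendOm (hm : Measurable γ) : Measurable (extendOm γ) :=
  (MeasurableEmbedding.subtype_coe measurableSet_Ico).measurable_extend hm measurable_zero

theorem intervalIntegrable_extendOm_of_bounded (hm : Measurable γ) {N : ℝ}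
    (hN : ∀ x, |γ x| ≤ N) (a b : ℝ) : IntervalIntegrable (extendOm γ) volume a b :=
  (intervalIntegrable_const (c := N)).mono_fun' (measurable_extendOm hm).aestronglyMeasurable
    (ae_of_all _ fun t => abs_extendOm_le hN t)

theorem intervalIntegrable_extendOm (h0 : ∀ x, 0 ≤ γ x) (ha : Antitone γ) (a b : ℝ) :
    IntervalIntegrable (extendOm γ) volume a b :=
  intervalIntegrable_extendOm_of_bounded ha.measurable (abs_le_of_antitone h0 ha) a b

theorem continuous_potR_of_bounded (hm : Measurable γ) {N : ℝ} (hN : ∀ x, |γ x| ≤ N) :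
    Continuous fun x : Om => potR (extendOm γ) x :=
  continuous_potR (measurable_extendOm hm) (abs_extendOm_le hN)

theorem continuous_potR_of_antitone (h0 : ∀ x, 0 ≤ γ x) (ha : Antitone γ) :
    Continuous fun x : Om => potR (extendOm γ) x :=
  continuous_potR_of_bounded ha.measurable (abs_le_of_antitone h0 ha)

theorem pot_toE_of_bounded (h0 : ∀ x, 0 ≤ γ x) (hmeas : Measurable γ) {N : ℝ}
    (hN : ∀ x, |γ x| ≤ N) (x : Om) :
    pot (toE γ) x = ENNReal.ofReal (potR (extendOm γ) x) := by
  have e : ∀ y : Om, ENNReal.ofReal y * ((exGreen₁ y x).toENNReal * (toE γ y).toENNReal) =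
      ENNReal.ofReal (ker x y * extendOm γ y) := by
    intro y
    rw [← mul_assoc, ofReal_mul_green₁, toE, EReal.real_coe_toENNReal, extendOm_val,
      ENNReal.ofReal_mul (ker_nonneg x.2.2 y.2.1 y.2.2.le)]
  have hm : Measurable fun y => (exGreen₁ y x).toENNReal * (toE γ y).toENNReal :=
    (measurable_green₁ x).mul (hmeas.coe_real_ereal.ereal_toENNReal)
  rw [pot, lintegral_exμ hm]
  simp only [e]
  rw [lintegral_comap_Om fun t => ENNReal.ofReal (ker x t * extendOm γ t),
    ← ofReal_integral_eq_lintegral_ofReal, potR, intervalIntegral.integral_of_le zero_le_one]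
  · have := intervalIntegrable_ker_mul (intervalIntegrable_extendOm_of_bounded hmeas hN) x.2.1
      le_rfl zero_le_one
    rwa [intervalIntegrable_iff_integrableOn_Ioc_of_le zero_le_one] at this
  · refine (ae_restrict_iff' measurableSet_Ioc).mpr (ae_of_all _ fun t ht => ?_)
    exact mul_nonneg (ker_nonneg x.2.2 ht.1.le ht.2) (extendOm_nonneg h0 t)

theorem pot_toE (h0 : ∀ x, 0 ≤ γ x) (ha : Antitone γ) (x : Om) :
    pot (toE γ) x = ENNReal.ofReal (potR (extendOm γ) x) :=
  pot_toE_of_bounded h0 ha.measurable (abs_le_of_antitone h0 ha) x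

theorem antitone_of_hyp (hγ : Hyp scale₂ univ (toE γ)) : Antitone γ :=
  fun _ _ h => EReal.coe_le_coe_iff.mp (hγ.antitone h)

/-- A function concave in the scale 1/x² lies above its chord a/t² + b. -/
theorem le_extendOm_of_hyp (hγ : Hyp scale₂ univ (toE γ)) {c d : Om} (hc : 0 < (c : ℝ))
    (hcd : c < d) {a b : ℝ} (ha : a / (c : ℝ) ^ 2 + b = γ c) (hb : a / (d : ℝ) ^ 2 + b = γ d)
    {t : ℝ} (ht : t ∈ Icc (c : ℝ) d) : a / t ^ 2 + b ≤ extendOm γ t := by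
  have htI : t ∈ Ico (0 : ℝ) 1 := ⟨hc.le.trans ht.1, ht.2.trans_lt d.2.2⟩
  rw [extendOm_of_mem γ htI]
  rcases eq_or_lt_of_le ht.1 with rfl | h1
  · exact ha.le
  rcases eq_or_lt_of_le ht.2 with rfl | h2
  · exact hb.le
  have h := hγ.two c ⟨t, htI⟩ d hc h1 h2 (subset_univ _)
  simp only [toE, ← EReal.coe_mul, ← EReal.coe_add, EReal.coe_le_coe_iff] at h
  have hi := isScale_scale₂.interp hc hcd ⟨t, htI⟩ b a
  simp only [scale₂] at hi
  rw [← ha, ← hb] at h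
  have e : ∀ s : ℝ, a / s ^ 2 + b = b + a * (1 / s ^ 2) := fun s => by ring
  rw [e] at h ⊢
  rw [e] at h
  rw [hi]
  exact h

/-- On ]c, d[ the terms in `nu` are the zero-boundary solution for the chord of γ, which lies below
γ, so they are at most the one for γ. On [0, d[ one uses that γ is decreasing, hence at least γ(d).
-/
theorem hypPair_potR (h0 : ∀ x, 0 ≤ γ x) (hγ : Hyp scale₂ univ (toE γ)) :
    HypPair univ (toE fun x => potR (extendOm γ) x) (toE γ) where
  lsc := (continuous_coe_real_ereal.comp (continuous_potR_of_antitone h0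
    (antitone_of_hyp hγ))).continuousOn.lowerSemicontinuousOn
  ne_bot _ _ := EReal.coe_ne_bot _
  hyp := hγ
  two c x d hc hcx hxd _ := by
    have hcd := hcx.trans hxd
    have hx : 0 < (x : ℝ) := hc.trans hcx
    have hd : 0 < (d : ℝ) := hc.trans hcd
    have hint := intervalIntegrable_extendOm h0 (antitone_of_hyp hγ)
    simp only [toE, ← EReal.coe_mul, ← EReal.coe_add, EReal.coe_le_coe_iff]
    obtain ⟨b, a, hab⟩ := isScale_scale₂.exists_coef hc hcd (γ c) (γ d)
    obtain ⟨e1, e2, e3, e4⟩ := lam_self_left isScale_scale₂ hc hcd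
    have ha : a / (c : ℝ) ^ 2 + b = γ c := by
      have := hab c
      rw [e1, e2, scale₂] at this
      linear_combination -this
    have hb : a / (d : ℝ) ^ 2 + b = γ d := by
      have := hab d
      rw [e3, e4, scale₂] at this
      linear_combination -this
    have hnu := nu_eq_tentInt hc hcx hxd a b
    have ht : tentInt c d x (fun t => a / t ^ 2 + b) ≤ tentInt c d x (extendOm γ) := by
      refine tentInt_mono hcx hxd (ContinuousOn.intervalIntegrable ?_) (hint _ _)
        fun t ht => le_extendOm_of_hyp hγ hc hcd ha hb ht
      refine (continuousOn_div_sq a b).mono ?_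
      rw [uIcc_of_le (show (c : ℝ) ≤ d from hcd.le)]
      exact fun t ht => hc.trans_le ht.1
    have hZ := mul_potR_eq_tent hint hc hcx hxd d.2.2
    rw [ha, hb] at hnu
    refine le_of_mul_le_mul_left ?_ hx
    rw [hZ, ← mul_assoc _ (c : ℝ), ← mul_assoc _ (d : ℝ), ← lam_scale₁_left hc hcd hx,
      ← lam_scale₁_right hc hcd hx]
    linarith
  one x d hxd _ := by
    simp only [toE, ← EReal.coe_mul, ← EReal.coe_add, EReal.coe_le_coe_iff]
    refine potR_add_le (intervalIntegrable_extendOm h0 (antitone_of_hyp hγ)) x.2.1 hxd d.2.2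
      fun t ht htd => ?_
    rw [extendOm_of_mem γ ⟨ht.le, htd.trans_lt d.2.2⟩]
    exact antitone_of_hyp hγ htd

end Bounded


/-! ### The minimum principle -/

section Minimum

variable {γ : Om → ℝ}

/-- An estimate opposite to hyperharmonicity, obtained from γ ≤ γ(c) on [c, d]. It bounds the loss
in the minimum principle. -/
theorem potR_le_interp (h0 : ∀ x, 0 ≤ γ x) (ha : Antitone γ) {c x d : Om} (hc : 0 < (c : ℝ))
    (hcx : c < x) (hxd : x < d) :
    potR (extendOm γ) x ≤ lam scale₁ c d x * potR (extendOm γ) c +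
      lam scale₁ d c x * potR (extendOm γ) d + (nu c d x + nu d c x) * γ c := by
  have hcd := hcx.trans hxd
  have hx : 0 < (x : ℝ) := hc.trans hcx
  have hint := intervalIntegrable_extendOm h0 ha
  have ht : tentInt c d x (extendOm γ) ≤ tentInt c d x fun _ => γ c := by
    refine tentInt_mono hcx hxd (hint _ _) intervalIntegrable_const fun t ht => ?_
    rw [extendOm_of_mem γ ⟨hc.le.trans ht.1, ht.2.trans_lt d.2.2⟩]
    exact ha ht.1
  rw [tentInt_const hcd, ← nu_add hc hcx hxd] at ht
  refine le_of_mul_le_mul_left ?_ hx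
  have hZ := mul_potR_eq_tent hint hc hcx hxd d.2.2
  rw [← mul_assoc _ (c : ℝ), ← mul_assoc _ (d : ℝ), ← lam_scale₁_left hc hcd hx,
    ← lam_scale₁_right hc hcd hx] at hZ
  linarith

/-- The case γ = 1: the function (1 - x)/2 exceeds its interpolation by exactly `nu c d x + nu d c
x`, which makes it the strict perturbation of the minimum principle. -/
theorem one_sub_interp {c x d : Om} (hc : 0 < (c : ℝ)) (hcx : c < x) (hxd : x < d) :
    (1 - (x : ℝ)) / 2 = lam scale₁ c d x * ((1 - (c : ℝ)) / 2) +
      lam scale₁ d c x * ((1 - (d : ℝ)) / 2) + (nu c d x + nu d c x) := by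
  have hcd := hcx.trans hxd
  have hx : 0 < (x : ℝ) := hc.trans hcx
  refine mul_left_cancel₀ hx.ne' ?_
  have hZ := mul_potR_eq_tent intervalIntegrable_const_one hc hcx hxd d.2.2
  rw [← mul_assoc _ (c : ℝ), ← mul_assoc _ (d : ℝ), ← lam_scale₁_left hc hcd hx,
    ← lam_scale₁_right hc hcd hx, tentInt_const hcd, potR_one hx.le x.2.2, potR_one hc.le c.2.2,
    potR_one (hc.trans hcd).le d.2.2, one_mul, ← nu_add hc hcx hxd] at hZ
  linarith

theorem exists_right_of_hyp (hγ : Hyp scale₂ univ (toE γ)) (x : Om) {ε : ℝ} (hε : 0 < ε) :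
    ∃ d, x < d ∧ γ x - ε < γ d := by
  have h := hγ.lsc x (mem_univ x) ((γ x - ε : ℝ) : EReal)
    (EReal.coe_lt_coe_iff.mpr (by linarith))
  rw [nhdsWithin_univ] at h
  obtain ⟨d, hd, hs⟩ := exists_right_subset_of_mem_nhds h
  exact ⟨d, hd, EReal.coe_lt_coe_iff.mp (hs ⟨hd.le, le_rfl⟩)⟩

/-- By concavity and γ d ≥ 0, γ c is at most γ x divided by the interpolation weight of c, and this
weight tends to 1 as c tends to x. -/
theorem exists_left_of_hyp (h0 : ∀ x, 0 ≤ γ x) (hγ : Hyp scale₂ univ (toE γ)) {x d : Om}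
    (hx : 0 < (x : ℝ)) (hxd : x < d) {ε : ℝ} (hε : 0 < ε) :
    ∃ c : Om, 0 < (c : ℝ) ∧ c < x ∧ γ c < γ x + ε := by
  have hs := isScale_scale₂.anti x d hx hxd
  have hcont : ContinuousAt (fun c => γ x * ((scale₂ c - scale₂ d) / (scale₂ x - scale₂ d))) x :=
    (((isScale_scale₂.cont x hx).sub continuousAt_const).div_const _).const_mul _
  have hev := hcont.eventually_lt (continuousAt_const (y := γ x + ε)) (by
    rw [div_self (by linarith)]
    linarith)
  obtain ⟨c, b, hc, hcx, hxb, hsub⟩ := nhds_pos_basis hx hev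
  refine ⟨c, hc, hcx, lt_of_le_of_lt ?_ (hsub ⟨le_rfl, (hcx.trans hxb).le⟩)⟩
  have h2 := hγ.two c x d hc hcx hxd (subset_univ _)
  simp only [toE, ← EReal.coe_mul, ← EReal.coe_add, EReal.coe_le_coe_iff] at h2
  have hl := isScale_scale₂.lam_left_pos hc hcx hxd
  have hr := mul_nonneg (isScale_scale₂.lam_right_pos hc hcx hxd).le (h0 d)
  have hsc := isScale_scale₂.anti c x hc hcx
  have e : γ x * ((scale₂ c - scale₂ d) / (scale₂ x - scale₂ d)) = γ x / lam scale₂ c d x := by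
    rw [lam]
    have : scale₂ c - scale₂ d ≠ 0 := by linarith
    have : scale₂ x - scale₂ d ≠ 0 := by linarith
    field_simp
  rw [e, le_div_iff₀ hl]
  linarith

theorem EReal.coe_sub_le_of_le_add {p q : ℝ} {z : EReal} (h : (p : EReal) ≤ z + q) :
    ((p - q : ℝ) : EReal) ≤ z := by
  induction z with
  | bot => simp at h
  | top => exact le_top
  | coe z =>
    rw [← EReal.coe_add, EReal.coe_le_coe_iff] at h
    exact EReal.coe_le_coe_iff.mpr (by linarith)

/-- Let Z be the potential of γ. At x, the function f - Z is at least its interpolation from c and d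
minus (nu + nu') (γ(c) - γ(d)), while ε (1 - x)/2 contributes a gain ε (nu + nu'). Choosing c and d
so close to x that γ(c) - γ(d) < ε gives a strict inequality, so the perturbed difference has no
minimum at x. At x = 0 the interval [0, d[ plays this role. -/
theorem not_isMin_of_hypPair (h0 : ∀ x, 0 ≤ γ x) (hγ : Hyp scale₂ univ (toE γ)) {f : Om → EReal}
    (hf : HypPair univ f (toE γ)) {ε : ℝ} (hε : 0 < ε) {x : Om} {r : ℝ} (hx : f x = r)
    (hmin : ∀ y : Om, ((r + (-potR (extendOm γ) x + ε * ((1 - x) / 2)) -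
      (-potR (extendOm γ) y + ε * ((1 - y) / 2)) : ℝ) : EReal) ≤ f y) : False := by
  have ha := antitone_of_hyp hγ
  obtain ⟨d, hxd, hd⟩ := exists_right_of_hyp hγ x (half_pos hε)
  rcases Om.eq_zero_or_pos x with rfl | hx0
  · have h := (add_le_add_left (hmin d) _).trans (hf.one zeroOm d hxd (subset_univ _))
    rw [hx, toE, ← EReal.coe_mul, ← EReal.coe_add, EReal.coe_le_coe_iff] at h
    -- The bound `potR_add_le` applied to the nonnegative function γ(0) - γ, which yields the upper
    -- estimate needed here.
    have hR : potR (extendOm γ) (zeroOm : Om) ≤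
        potR (extendOm γ) d + (d : ℝ) / 2 * γ zeroOm := by
      have hd0 : (0 : ℝ) < d := hxd
      have hg : ∀ a b, IntervalIntegrable (fun t => γ zeroOm - extendOm γ t) volume a b :=
        fun a b => intervalIntegrable_const.sub (intervalIntegrable_extendOm h0 ha a b)
      have := potR_add_le (m := 0) hg le_rfl hd0 d.2.2 fun t _ _ =>
        sub_nonneg.mpr (extendOm_le h0 ha t)
      have e : ∀ y : Om, potR (fun t => γ zeroOm - extendOm γ t) y =
          γ zeroOm * ((1 - y) / 2) - potR (extendOm γ) y := by
        intro y
        rw [← potR_one y.2.1 y.2.2, potR, potR, potR, ← intervalIntegral.integral_const_mul,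
          ← intervalIntegral.integral_sub ((intervalIntegrable_ker_mul
            intervalIntegrable_const_one y.2.1 le_rfl zero_le_one).const_mul _)
          (intervalIntegrable_ker_mul (intervalIntegrable_extendOm h0 ha) y.2.1 le_rfl
            zero_le_one)]
        refine intervalIntegral.integral_congr fun t _ => ?_
        ring
      have hz : ((zeroOm : Om) : ℝ) = 0 := rfl
      have ez := e zeroOm
      rw [hz] at ez ⊢
      rw [e, ez] at this
      linarith
    have hd0 : (0 : ℝ) < d := hxd
    have hz : ((zeroOm : Om) : ℝ) = 0 := rfl
    rw [hz] at h hR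
    nlinarith
  · obtain ⟨c, hc, hcx, hcγ⟩ := exists_left_of_hyp h0 hγ hx0 hxd (half_pos hε)
    have h := hf.two c x d hc hcx hxd (subset_univ _)
    have hl := isScale_scale₁.lam_left_pos hc hcx hxd
    have hr := isScale_scale₁.lam_right_pos hc hcx hxd
    have hadd := isScale_scale₁.lam_add hc (hcx.trans hxd) x
    have h' := (add_le_add_left (add_le_add
      ((EReal.coe_mul_le_coe_mul_iff hl).mpr (hmin c))
      ((EReal.coe_mul_le_coe_mul_iff hr).mpr (hmin d))) _).trans h
    rw [hx, toE, toE] at h'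
    simp only [← EReal.coe_mul, ← EReal.coe_add, EReal.coe_le_coe_iff] at h'
    have hR := potR_le_interp h0 ha hc hcx hxd
    have hw := one_sub_interp hc hcx hxd
    have hn := nu_add hc hcx hxd
    have hnc := nu_left_nonneg hc hcx hxd
    have hnpos : 0 < nu c d x + nu d c x := by
      have h1 : (c : ℝ) < x := hcx
      have h2 : (x : ℝ) < d := hxd
      have : 0 < (x : ℝ) * (nu c d x + nu d c x) := by
        rw [hn]
        have := mul_pos (sub_pos.mpr h1) (sub_pos.mpr h2)
        positivity
      exact pos_of_mul_pos_right this hx0.le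
    have hγcd := ha (hcx.trans hxd).le
    have hlast : 0 < (nu c d x + nu d c x) * (γ d - γ c + ε) :=
      mul_pos hnpos (by linarith)
    have hnc' := mul_nonneg hnc (sub_nonneg.mpr hγcd)
    have e1 : lam scale₁ d c x = 1 - lam scale₁ c d x := by linarith
    rw [e1] at h' hR hw
    have hw' : ε * ((1 - (x : ℝ)) / 2) = ε * (lam scale₁ c d x * ((1 - (c : ℝ)) / 2) +
      (1 - lam scale₁ c d x) * ((1 - (d : ℝ)) / 2) + (nu c d x + nu d c x)) := by rw [← hw]
    linarith

/-- The potential is at most γ(0) (1 - x)/2, which tends to 0 at the end 1, and f ≥ 0. A negative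
value of f minus the potential would therefore produce an interior minimum of a perturbed lower
semicontinuous function, which `not_isMin_of_hypPair` excludes. -/
theorem potR_le_of_hypPair (h0 : ∀ x, 0 ≤ γ x) (hγ : Hyp scale₂ univ (toE γ)) {f : Om → EReal}
    (hf : HypPair univ f (toE γ)) (hf0 : ∀ x, 0 ≤ f x) (x : Om) :
    (potR (extendOm γ) x : EReal) ≤ f x := by
  have ha := antitone_of_hyp hγ
  by_contra! hlt
  obtain ⟨r, hr⟩ : ∃ r : ℝ, f x = r :=
    ⟨(f x).toReal, (EReal.coe_toReal (hlt.trans (EReal.coe_lt_top _)).ne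
      (hf.ne_bot x (mem_univ x))).symm⟩
  rw [hr, EReal.coe_lt_coe_iff] at hlt
  -- Half of the gap: after adding a perturbation of at most δ the value at `x` is still at most -δ.
  set δ := (potR (extendOm γ) x - r) / 2 with hδ
  have hδ0 : 0 < δ := by linarith
  set e : Om → ℝ := fun y => -potR (extendOm γ) y + δ * ((1 - y) / 2) with he
  have hcont : Continuous e := (continuous_potR_of_antitone h0 ha).neg.add (by fun_prop)
  -- Beyond `b` the potential is below δ, so the perturbed difference stays above -δ and a minimum
  -- on [0, b] is a minimum on Ω.
  obtain ⟨b, hxb, hb⟩ : ∃ b : Om, x < b ∧ γ zeroOm * ((1 - b) / 2) < δ := by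
    have hN := h0 zeroOm
    have h1 : max (x : ℝ) (1 - δ / (γ zeroOm + 1)) < 1 :=
      max_lt x.2.2 (by linarith [div_pos hδ0 (by linarith : 0 < γ zeroOm + 1)])
    obtain ⟨t, ht1, ht2⟩ := exists_between h1
    have hxt : (x : ℝ) < t := (le_max_left _ _).trans_lt ht1
    have hdt := (le_max_right (x : ℝ) _).trans_lt ht1
    refine ⟨⟨t, x.2.1.trans hxt.le, ht2⟩, hxt, ?_⟩
    have h3 : 1 - t < δ / (γ zeroOm + 1) := by linarith
    rw [lt_div_iff₀ (by linarith)] at h3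
    have : γ zeroOm * (1 - t) ≤ (1 - t) * (γ zeroOm + 1) := by nlinarith
    show γ zeroOm * ((1 - t) / 2) < δ
    linarith
  have hlsc : LowerSemicontinuousOn (fun y => f y + (e y : EReal)) (Icc zeroOm b) := by
    intro y _
    have h1 : LowerSemicontinuousWithinAt f (Icc zeroOm b) y :=
      (hf.lsc y (mem_univ y)).mono (subset_univ _)
    refine h1.add' ((continuous_coe_real_ereal.comp hcont).continuousWithinAt.lowerSemicontinuousWithinAt)
      ?_
    exact EReal.continuousAt_add (Or.inr (EReal.coe_ne_bot _)) (Or.inr (EReal.coe_ne_top _))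
  obtain ⟨z, hz, hzmin⟩ := hlsc.exists_isMinOn
    (⟨x, zeroOm_le x, hxb.le⟩ : (Icc zeroOm b).Nonempty) (isCompact_Icc_Om _ _)
  have hzx : f z + (e z : EReal) ≤ ((r + e x : ℝ) : EReal) := by
    have := hzmin (a := x) ⟨zeroOm_le x, hxb.le⟩
    simpa [hr] using this
  have hrx : r + e x ≤ -δ := by
    have h1 : (1 - (x : ℝ)) / 2 ≤ 1 := by linarith [x.2.1]
    have : δ * ((1 - (x : ℝ)) / 2) ≤ δ := mul_le_of_le_one_right hδ0.le h1
    simp only [he]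
    linarith
  obtain ⟨q, hq⟩ : ∃ q : ℝ, f z = q := by
    refine ⟨(f z).toReal, (EReal.coe_toReal (fun h => ?_) (hf.ne_bot z (mem_univ z))).symm⟩
    rw [h, EReal.top_add_coe, top_le_iff] at hzx
    exact EReal.coe_ne_top _ hzx
  rw [hq, ← EReal.coe_add, EReal.coe_le_coe_iff] at hzx
  refine not_isMin_of_hypPair h0 hγ hf hδ0 hq fun y : Om => ?_
  refine EReal.coe_sub_le_of_le_add (p := q + e z) (q := e y) ?_
  rcases le_total y b with hy | hy
  · have := hzmin (a := y) ⟨zeroOm_le y, hy⟩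
    simpa [hq] using this
  · have h1 : potR (extendOm γ) y ≤ γ zeroOm * ((1 - y) / 2) :=
      potR_le (intervalIntegrable_extendOm h0 ha) y.2.1 y.2.2 (extendOm_le h0 ha)
    have h2 : γ zeroOm * ((1 - (y : ℝ)) / 2) ≤ γ zeroOm * ((1 - b) / 2) :=
      mul_le_mul_of_nonneg_left (by linarith [show (b : ℝ) ≤ y from hy]) (h0 _)
    have h3 : 0 ≤ δ * ((1 - (y : ℝ)) / 2) := mul_nonneg hδ0.le (by linarith [y.2.2])
    have h4 : q + e z ≤ e y := by
      simp only [he] at hrx hzx ⊢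
      linarith
    calc ((q + e z : ℝ) : EReal) ≤ (e y : EReal) := EReal.coe_le_coe_iff.mpr h4
      _ = 0 + (e y : EReal) := (zero_add _).symm
      _ ≤ f y + e y := add_le_add_left (hf0 y) _

end Minimum


/-! ### The pure function of order 2 -/

section Pure

variable {P Q : Om → ℝ} {f g : Om → EReal}

theorem Hyp.min_const {s : Om → ℝ} (hs : IsScale s) {U : Set Om} (hg : Hyp s U g) (N : ℝ) :
    Hyp s U fun x => min (g x) N where
  lsc := hg.lsc.inf continuousOn_const.lowerSemicontinuousOn
  ne_bot x hx := by
    have := hg.ne_bot x hx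
    rcases min_choice (g x) (N : EReal) with h | h <;> rw [h]
    exacts [this, EReal.coe_ne_bot _]
  two a x b ha hax hxb hU := by
    have hl := (EReal.coe_nonneg.mpr (hs.lam_left_pos ha hax hxb).le)
    have hr := (EReal.coe_nonneg.mpr (hs.lam_right_pos ha hax hxb).le)
    refine le_min ((add_le_add (mul_le_mul_of_nonneg_left (min_le_left _ _) hl)
      (mul_le_mul_of_nonneg_left (min_le_left _ _) hr)).trans (hg.two a x b ha hax hxb hU)) ?_
    exact (add_le_add (mul_le_mul_of_nonneg_left (min_le_right _ _) hl)
      (mul_le_mul_of_nonneg_left (min_le_right _ _) hr)).trans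
      ((Hyp.const (U := U) hs N).two a x b ha hax hxb hU)
  one x b hxb hU := min_le_min_right _ (hg.one x b hxb hU)

/-- Truncation keeps hyperharmonicity and gives a bounded real function, to which the real integral
calculus applies. -/
theorem Hyp.exists_toE {s : Om → ℝ} (hs : IsScale s) (hg : Hyp s univ g) (h0 : ∀ x, 0 ≤ g x)
    (n : ℕ) : ∃ γ : Om → ℝ, (fun x => min (g x) ((n : ℝ) : EReal)) = toE γ ∧ (∀ x, 0 ≤ γ x) ∧
      Hyp s univ (toE γ) := by
  have h := hg.min_const hs n
  have hnn : ∀ x, 0 ≤ min (g x) ((n : ℝ) : EReal) := fun x =>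
    le_min (h0 x) (EReal.coe_nonneg.mpr n.cast_nonneg)
  have e : (fun x => min (g x) ((n : ℝ) : EReal)) =
      toE fun x => (min (g x) ((n : ℝ) : EReal)).toReal := by
    funext x
    exact (EReal.coe_toReal ((min_le_right _ _).trans_lt (EReal.coe_lt_top _)).ne
      (h.ne_bot x (mem_univ x))).symm
  exact ⟨_, e, fun x => EReal.toReal_nonneg (hnn x), e ▸ h⟩

theorem tendsto_min_natCast (z : EReal) :
    Tendsto (fun n : ℕ => min z ((n : ℝ) : EReal)) atTop (𝓝 z) := by
  have h : Tendsto (fun n : ℕ => ((n : ℝ) : EReal)) atTop (𝓝 ⊤) :=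
    EReal.tendsto_coe_nhds_top_iff.mpr tendsto_natCast_atTop_atTop
  simpa using (tendsto_const_nhds (x := z)).min h

theorem monotone_min_natCast (z : EReal) : Monotone fun n : ℕ => min z ((n : ℝ) : EReal) :=
  fun _ _ h => min_le_min_left _ (EReal.coe_le_coe_iff.mpr (Nat.cast_le.mpr h))

theorem iSup_toENNReal_min_natCast (z : EReal) :
    ⨆ n : ℕ, (min z ((n : ℝ) : EReal)).toENNReal = z.toENNReal :=
  iSup_eq_of_tendsto (fun _ _ h => EReal.toENNReal_le_toENNReal (monotone_min_natCast z h))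
    ((EReal.continuous_toENNReal.tendsto z).comp (tendsto_min_natCast z))

theorem pot_mono {g' : Om → EReal} (h : ∀ x, g x ≤ g' x) (x : Om) : pot g x ≤ pot g' x :=
  lintegral_mono fun y => mul_le_mul_right (EReal.toENNReal_le_toENNReal (h y)) _

theorem Hyp.measurable {s : Om → ℝ} (hg : Hyp s univ g) : Measurable g :=
  (lowerSemicontinuousOn_univ_iff.mp hg.lsc).measurable

theorem pot_eq_iSup (hg : Measurable g) (x : Om) :
    pot g x = ⨆ n : ℕ, pot (fun y => min (g y) ((n : ℝ) : EReal)) x := by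
  simp only [pot]
  rw [← lintegral_iSup]
  · simp only [← ENNReal.mul_iSup, iSup_toENNReal_min_natCast]
  · exact fun n => (measurable_green₁ x).mul (hg.min measurable_const).ereal_toENNReal
  · exact fun m n h y => mul_le_mul_right
      (EReal.toENNReal_le_toENNReal (monotone_min_natCast (g y) h)) _

/-- The coefficients of the second component are nonnegative, so a smaller second component weakens
the inequalities for the first. -/
theorem HypPair.mono {U : Set Om} {g' : Om → EReal} (h : HypPair U f g) (hg' : Hyp scale₂ U g')
    (hle : ∀ x, g' x ≤ g x) : HypPair U f g' where
  lsc := h.lsc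
  ne_bot := h.ne_bot
  hyp := hg'
  two c x d hc hcx hxd hU := by
    refine le_trans ?_ (h.two c x d hc hcx hxd hU)
    gcongr
    · exact EReal.coe_nonneg.mpr (nu_left_nonneg hc hcx hxd)
    · exact hle c
    · exact EReal.coe_nonneg.mpr (nu_right_nonneg hc hcx hxd)
    · exact hle d
  one x d hxd hU := by
    refine le_trans ?_ (h.one x d hxd hU)
    gcongr
    · exact EReal.coe_nonneg.mpr (by linarith [show (x : ℝ) < d from hxd])
    · exact hle d

theorem HypPair.hyp₁ {U : Set Om} (h : HypPair U f g) (h0 : ∀ x, 0 ≤ g x) : Hyp scale₁ U f :=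
  hypPair_zero_iff.mp (h.mono (by simpa using Hyp.const isScale_scale₂ 0) h0)

/-- Each truncation of g is still admissible with the same f, so the minimum principle applies to
it; monotone convergence then gives the bound for g. -/
theorem pot_le_of_hypPair (hf : HypPair univ f g) (hf0 : ∀ x, 0 ≤ f x) (h0 : ∀ x, 0 ≤ g x)
    (x : Om) : (pot g x : EReal) ≤ f x := by
  rw [← EReal.coe_toENNReal (hf0 x), EReal.coe_ennreal_le_coe_ennreal_iff,
    pot_eq_iSup hf.hyp.measurable]
  refine iSup_le fun n => ?_
  obtain ⟨γ, hγ, hγ0, hγh⟩ := hf.hyp.exists_toE isScale_scale₂ h0 n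
  rw [hγ, pot_toE hγ0 (antitone_of_hyp hγh), ← EReal.real_coe_toENNReal]
  refine EReal.toENNReal_le_toENNReal (potR_le_of_hypPair hγ0 hγh (hf.mono hγh fun y => ?_) hf0 x)
  rw [← hγ]
  exact min_le_left _ _

theorem EReal.tendsto_coe_mul {c : ℝ} (hc : 0 ≤ c) {u : ℕ → EReal} {z : EReal}
    (h : Tendsto u atTop (𝓝 z)) : Tendsto (fun n => (c : EReal) * u n) atTop (𝓝 (c * z)) := by
  rcases eq_or_lt_of_le hc with rfl | hc
  · simp
  · have h0 : (c : EReal) ≠ 0 := by exact_mod_cast hc.ne'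
    exact (EReal.continuousAt_mul (p := ((c : EReal), z)) (Or.inl h0) (Or.inl h0)
      (Or.inl (EReal.coe_ne_bot c)) (Or.inl (EReal.coe_ne_top c))).tendsto.comp
      (tendsto_const_nhds.prodMk_nhds h)

theorem EReal.tendsto_add {u v : ℕ → EReal} {y z : EReal} (hu : Tendsto u atTop (𝓝 y))
    (hv : Tendsto v atTop (𝓝 z)) (hy : y ≠ ⊥) (hz : z ≠ ⊥) :
    Tendsto (fun n => u n + v n) atTop (𝓝 (y + z)) :=
  (EReal.continuousAt_add (p := (y, z)) (Or.inr hz) (Or.inl hy)).tendsto.comp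
    (hu.prodMk_nhds hv)

/-- The truncated pairs are hyperharmonic by `hypPair_potR`. Their inequalities pass to the limit
because no term is -∞, which makes addition continuous along the sequences. -/
theorem hypPair_pot (hg : Hyp scale₂ univ g) (h0 : ∀ x, 0 ≤ g x) :
    HypPair univ (fun x => (pot g x : EReal)) g := by
  choose γ hγ hγ0 hγh using hg.exists_toE isScale_scale₂ h0
  have hpair : ∀ n : ℕ, HypPair univ
      (fun x => (pot (fun y => min (g y) ((n : ℝ) : EReal)) x : EReal))
      (fun y => min (g y) ((n : ℝ) : EReal)) := by
    intro n
    have e : (fun x => (pot (fun y => min (g y) ((n : ℝ) : EReal)) x : EReal)) =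
        toE fun x : Om => potR (extendOm (γ n)) x := by
      funext x
      rw [hγ, pot_toE (hγ0 n) (antitone_of_hyp (hγh n)), EReal.coe_ennreal_ofReal, toE,
        max_eq_left (potR_nonneg x.2.2 (extendOm_nonneg (hγ0 n)))]
    rw [e, hγ]
    exact hypPair_potR (hγ0 n) (hγh n)
  have hsup := pot_eq_iSup hg.measurable
  have hlim : ∀ x, Tendsto (fun n : ℕ =>
      (pot (fun y => min (g y) ((n : ℝ) : EReal)) x : EReal)) atTop (𝓝 (pot g x : EReal)) := by
    intro x
    refine (continuous_coe_ennreal_ereal.tendsto _).comp ?_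
    rw [hsup x]
    exact tendsto_atTop_iSup fun m n h => pot_mono (fun y => monotone_min_natCast (g y) h) x
  have hle : ∀ (n : ℕ) x, (pot (fun y => min (g y) ((n : ℝ) : EReal)) x : EReal) ≤ pot g x :=
    fun n x => EReal.coe_ennreal_le_coe_ennreal_iff.mpr (pot_mono (fun y => min_le_left _ _) x)
  have hb : ∀ x, (pot g x : EReal) ≠ ⊥ := fun x => EReal.coe_ennreal_ne_bot _
  have hgb : ∀ x, g x ≠ ⊥ := fun x => hg.ne_bot x (mem_univ x)
  refine ⟨?_, fun x _ => hb x, hg, fun c x d hc hcx hxd hU => ?_, fun x d hxd hU => ?_⟩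
  · have h1 : LowerSemicontinuous (pot g) := by
      rw [funext hsup]
      refine lowerSemicontinuous_iSup fun n => Continuous.lowerSemicontinuous ?_
      rw [hγ, funext (pot_toE (hγ0 n) (antitone_of_hyp (hγh n)))]
      exact ENNReal.continuous_ofReal.comp
        (continuous_potR_of_antitone (hγ0 n) (antitone_of_hyp (hγh n)))
    exact (continuous_coe_ennreal_ereal.comp_lowerSemicontinuous h1
      EReal.coe_ennreal_strictMono.monotone).lowerSemicontinuousOn _
  · have l1 := (isScale_scale₁.lam_left_pos hc hcx hxd).le
    have l2 := (isScale_scale₁.lam_right_pos hc hcx hxd).le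
    have n1 := nu_left_nonneg hc hcx hxd
    have n2 := nu_right_nonneg hc hcx hxd
    have b1 := EReal.coe_mul_ne_bot l1 (hb c)
    have b2 := EReal.coe_mul_ne_bot l2 (hb d)
    have b3 := EReal.coe_mul_ne_bot n1 (hgb c)
    have b4 := EReal.coe_mul_ne_bot n2 (hgb d)
    refine le_of_tendsto' (EReal.tendsto_add
      (EReal.tendsto_add (EReal.tendsto_coe_mul l1 (hlim c)) (EReal.tendsto_coe_mul l2 (hlim d))
        b1 b2)
      (EReal.tendsto_add (EReal.tendsto_coe_mul n1 (tendsto_min_natCast (g c)))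
        (EReal.tendsto_coe_mul n2 (tendsto_min_natCast (g d))) b3 b4) ?_ ?_)
      fun n => ((hpair n).two c x d hc hcx hxd hU).trans (hle n x)
    · exact fun h => (EReal.add_eq_bot_iff.mp h).elim b1 b2
    · exact fun h => (EReal.add_eq_bot_iff.mp h).elim b3 b4
  · have n1 : 0 ≤ ((d : ℝ) - x) / 2 := by linarith [show (x : ℝ) < d from hxd]
    exact le_of_tendsto' (EReal.tendsto_add (hlim d)
      (EReal.tendsto_coe_mul n1 (tendsto_min_natCast (g d))) (hb d)
      (EReal.coe_mul_ne_bot n1 (hgb d)))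
      fun n => ((hpair n).one x d hxd hU).trans (hle n x)

/-! ### Identification of the pure function -/

theorem lscReg_eq_self {X : Type*} [TopologicalSpace X] {u : X → EReal}
    (hu : LowerSemicontinuous u) : lscReg u = u := by
  funext x
  refine le_antisymm ?_ (lowerSemicontinuousAt_iff_le_liminf.mp (hu x))
  refine liminf_le_of_frequently_le' ?_
  exact (Filter.frequently_iff.mpr fun h => ⟨x, mem_of_mem_nhds h, le_rfl⟩)

/-- The right-hand side is admissible by `hypPair_pot` and lies below every admissible function by
`pot_le_of_hypPair`. The infimum is thus attained, and it is already lower semicontinuous. -/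
theorem pureFn_quotient (hP : IsWeight P) (hQ : IsWeight Q) {v : Om → EReal}
    (hv : Hyp scale₂ univ fun x => (Q x : EReal) * v x) (hv0 : ∀ x, 0 ≤ v x) :
    pureFn (quotientSheaf exH P Q) v =
      fun x => ((1 / P x : ℝ) : EReal) * (pot (fun x => (Q x : EReal) * v x) x : EReal) := by
  have hg0 : ∀ x, 0 ≤ (Q x : EReal) * v x := fun x =>
    mul_nonneg (EReal.coe_nonneg.mpr (hQ.pos x).le) (hv0 x)
  have hpair := hypPair_pot hv hg0
  have hPu : (fun x => (P x : EReal) * (((1 / P x : ℝ) : EReal) *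
      (pot (fun x => (Q x : EReal) * v x) x : EReal))) =
      fun x => (pot (fun x => (Q x : EReal) * v x) x : EReal) :=
    funext fun x => EReal.coe_mul_inv_cancel (hP.pos x).ne' _
  have hinf : (fun x => ⨅ u ∈ {u : Om → EReal | u ∈ hyper₁ (quotientSheaf exH P Q) ⊤ ∧
      (∀ z, 0 ≤ u z) ∧ IsHyperharmonicPair (quotientSheaf exH P Q) ⊤ u v}, u x) =
      fun x => ((1 / P x : ℝ) : EReal) * (pot (fun x => (Q x : EReal) * v x) x : EReal) := by
    funext x
    refine le_antisymm (iInf₂_le (f := fun (u : Om → EReal) _ => u x) (fun x => ((1 / P x : ℝ) : EReal) *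
      (pot (fun x => (Q x : EReal) * v x) x : EReal)) (show _ ∧ _ ∧ _ from
      ⟨?_, fun z => ?_, ?_⟩)) (le_iInf₂ fun u hu => ?_)
    · rw [mem_hyper₁_iff hP hQ, hPu]
      exact hpair.hyp₁ hg0
    · exact mul_nonneg (EReal.coe_nonneg.mpr (one_div_pos.mpr (hP.pos z)).le)
        (EReal.coe_ennreal_nonneg _)
    · rw [isHyperharmonicPair_iff hP hQ, hPu]
      exact hpair
    · have h := (isHyperharmonicPair_iff hP hQ).mp hu.2.2
      rw [← EReal.coe_mul_le_coe_mul_iff (hP.pos x), EReal.coe_mul_inv_cancel (hP.pos x).ne']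
      exact pot_le_of_hypPair h (fun z => mul_nonneg (EReal.coe_nonneg.mpr (hP.pos z).le)
        (hu.2.1 z)) hg0 x
  rw [pureFn, hinf, lscReg_eq_self]
  exact lowerSemicontinuousOn_univ_iff.mp (lsc_weight_mul hP.inv hpair.lsc)

end Pure


/-! ### Infinite potentials -/

section Infinite

variable {P Q : Om → ℝ} {g : Om → EReal}

theorem setLIntegral_inv_eq_top {k b : ℝ} (hk : 0 < k) (hb : 0 < b) :
    ∫⁻ t in Ioc (0 : ℝ) b, ENNReal.ofReal (k * t⁻¹) = ⊤ := by
  by_contra h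
  have hint := (lintegral_ofReal_ne_top_iff_integrable
    (by fun_prop : AEStronglyMeasurable (fun t : ℝ => k * t⁻¹) (volume.restrict (Ioc 0 b)))
    ((ae_restrict_iff' measurableSet_Ioc).mpr (ae_of_all _ fun t ht =>
      mul_nonneg hk.le (inv_nonneg.mpr ht.1.le)))).mp h
  have h2 : IntervalIntegrable (fun t : ℝ => t⁻¹) volume 0 b := by
    rw [intervalIntegrable_iff_integrableOn_Ioc_of_le hb.le]
    have := hint.const_mul k⁻¹
    simpa [IntegrableOn, ← mul_assoc, inv_mul_cancel₀ hk.ne'] using this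
  rcases intervalIntegrable_inv_iff.mp h2 with h3 | h3
  · exact hb.ne h3
  · exact h3 left_mem_uIcc

/-- After multiplication by the density y of μ the integrand dominates k/y, whose integral diverges
at 0. Both the infinite pure functions and the infinite adjoint kernel are instances. -/
theorem lintegral_exμ_eq_top {F : Om → ENNReal} (hF : Measurable F) {k : ℝ} (hk : 0 < k) {b : Om}
    (hb : 0 < (b : ℝ)) (h : ∀ y : Om, 0 < (y : ℝ) → y ≤ b →
      ENNReal.ofReal (k * (y : ℝ)⁻¹) ≤ ENNReal.ofReal y * F y) : ∫⁻ y, F y ∂exμ = ⊤ := by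
  rw [lintegral_exμ hF, ← top_le_iff, ← setLIntegral_inv_eq_top hk hb]
  have e : ∫⁻ t in Ioc (0 : ℝ) b, ENNReal.ofReal (k * t⁻¹) =
      ∫⁻ t in Ioc (0 : ℝ) 1, (Ioc (0 : ℝ) b).indicator (fun t => ENNReal.ofReal (k * t⁻¹)) t := by
    rw [setLIntegral_indicator measurableSet_Ioc,
      inter_eq_left.mpr (Ioc_subset_Ioc_right b.2.2.le)]
  rw [e, ← lintegral_comap_Om]
  refine lintegral_mono fun y => ?_
  by_cases hy : (y : ℝ) ∈ Ioc (0 : ℝ) b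
  · rw [indicator_of_mem hy]
    exact h y hy.1 hy.2
  · rw [indicator_of_notMem hy]
    exact zero_le

theorem pot_eq_top (hg : Measurable g) {k : ℝ} (hk : 0 < k) {b : Om} (hb : 0 < (b : ℝ))
    (h : ∀ y : Om, 0 < (y : ℝ) → y ≤ b → ((k / (y : ℝ) ^ 2 : ℝ) : EReal) ≤ g y) (x : Om) :
    pot g x = ⊤ := by
  -- The point `z` is positive even if x = 0, and p_y(x) ≥ p_y(z) = 1/z - 1 > 0 for y ≤ b, a lower
  -- bound independent of y.
  set z := max x b with hz
  have hz0 : 0 < (z : ℝ) := lt_of_lt_of_le hb (le_max_right x b : b ≤ z)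
  have hk' : 0 < 1 / (z : ℝ) - 1 := by
    rw [sub_pos, lt_div_iff₀ hz0, one_mul]
    exact z.2.2
  refine lintegral_exμ_eq_top ((measurable_green₁ x).mul hg.ereal_toENNReal)
    (mul_pos hk' hk) hb fun y hy hyb => ?_
  have h1 : ENNReal.ofReal (ker z y) ≤ ENNReal.ofReal y * (exGreen₁ y x).toENNReal := by
    rw [← ofReal_mul_green₁, exGreen₁_eq]
    gcongr
    exact EReal.toENNReal_le_toENNReal (green_antitone isScale_scale₁ y (le_max_left x b))
  have h2 : ENNReal.ofReal (k / (y : ℝ) ^ 2) ≤ (g y).toENNReal :=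
    EReal.toENNReal_le_toENNReal (h y hy hyb)
  rw [← mul_assoc]
  refine le_trans (le_of_eq ?_) (mul_le_mul' h1 h2)
  rw [ker_of_le (show (y : ℝ) ≤ z from hyb.trans (le_max_right x b)),
    ← ENNReal.ofReal_mul (mul_nonneg hk'.le hy.le)]
  congr 1
  field_simp

theorem exists_half : ∃ b : Om, (b : ℝ) = 1 / 2 := ⟨⟨1 / 2, by norm_num, by norm_num⟩, rfl⟩

theorem half_div_sq_le_green {y : Om} (hy : 0 < (y : ℝ)) (hy2 : (y : ℝ) ≤ 1 / 2) :
    (((1 / 2) / (y : ℝ) ^ 2 : ℝ) : EReal) ≤ green scale₂ zeroOm y := by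
  rw [green_of_ge _ hy (zeroOm_le y), EReal.coe_le_coe_iff, scale₂]
  have h1 : (y : ℝ) ^ 2 ≤ 1 / 4 := by nlinarith
  have h2 : 1 ≤ (1 / 2) / (y : ℝ) ^ 2 := by
    rw [le_div_iff₀ (by positivity)]
    linarith
  have h3 : 1 / (y : ℝ) ^ 2 = (1 / 2) / (y : ℝ) ^ 2 + (1 / 2) / (y : ℝ) ^ 2 := by ring
  linarith

theorem pot_green_eq_top {c : ℝ} (hc : 0 < c) (x : Om) :
    pot (fun y => (c : EReal) * green scale₂ zeroOm y) x = ⊤ := by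
  obtain ⟨b, hb⟩ := exists_half
  have hm : Measurable fun y => (c : EReal) * green scale₂ zeroOm y :=
    measurable_const.mul (continuous_green_right isScale_scale₂ zeroOm).measurable
  refine pot_eq_top hm (k := c * (1 / 2)) (by positivity) (b := b) (by rw [hb]; norm_num)
    (fun y hy hyb => ?_) x
  rw [mul_div_assoc, EReal.coe_mul]
  refine (EReal.coe_mul_le_coe_mul_iff hc).mpr (half_div_sq_le_green hy ?_)
  rw [← hb]
  exact hyb

/-- By proportionality Q v is a positive multiple of q_0, whose potential diverges. -/
theorem pureFn_eq_top_of_support (hP : IsWeight P) (hQ : IsWeight Q) {v : Om → EReal}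
    (hv : IsPotential (wSheaf scale₂ Q) v)
    (hs : harmonicSupport (wSheaf scale₂ Q) v = {zeroOm}) (x : Om) :
    pureFn (quotientSheaf exH P Q) v x = ⊤ := by
  obtain ⟨c, hc, h⟩ := eq_mul_green_of_support isScale_scale₂ hQ hv hs
  obtain ⟨hv1, hv0, -⟩ := (isPotential_wSheaf_iff isScale_scale₂ hQ).mp hv
  rw [pureFn_quotient hP hQ hv1 hv0, funext h]
  simp only
  rw [pot_green_eq_top hc]
  exact EReal.coe_mul_top_of_pos (one_div_pos.mpr (hP.pos x))

theorem not_isSuperharmonic_of_eq_top {𝓚 : Opens Om → Set (Om → ℝ)} {u : Om → EReal}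
    (h : ∀ x, u x = ⊤) : ¬ IsSuperharmonic 𝓚 ⊤ u := by
  rw [isSuperharmonic_iff_dense]
  rintro ⟨-, hd⟩
  obtain ⟨x, hx⟩ := hd.nonempty
  exact hx (h x)

theorem not_hasBiharmonicGreenKernel (hP : IsWeight P) (hQ : IsWeight Q) :
    ¬ HasBiharmonicGreenKernel (quotientSheaf exH P Q) := by
  rintro ⟨q, hq, h⟩
  rw [assoc₂_quotient hP hQ] at hq
  exact not_isSuperharmonic_of_eq_top (fun x => pureFn_eq_top_of_support hP hQ
    (hq.1 zeroOm).1 (hq.1 zeroOm).2 x) (h zeroOm)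

theorem pot_const {α : ℝ} (hα : 0 ≤ α) (x : Om) :
    pot (toE fun _ => α) x = ENNReal.ofReal (α * ((1 - x) / 2)) := by
  rw [pot_toE (fun _ => hα) antitone_const, ← potR_one x.2.1 x.2.2, potR, potR,
    ← intervalIntegral.integral_const_mul]
  congr 1
  refine intervalIntegral.integral_congr_ae ?_
  have : ∀ᵐ t : ℝ, t ≠ 1 := by simp [ae_iff]
  filter_upwards [this] with t ht1 ht
  rw [uIoc_of_le zero_le_one] at ht
  rw [extendOm_of_mem _ ⟨ht.1.le, lt_of_le_of_ne ht.2 ht1⟩]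
  ring

theorem mem_quotient_of_const (hP : IsWeight P) (hQ : IsWeight Q) (U : Opens Om) (α : ℝ) :
    ((fun x => α * ((1 - x) / 2) / P x, fun x => α / Q x) : (Om → ℝ) × (Om → ℝ)) ∈
      quotientSheaf exH P Q U := by
  rw [mem_quotientSheaf_iff hP hQ]
  refine fun x _ => ⟨0, α, α / 2, 0, fun _ => ⟨rfl, rfl⟩, Eventually.of_forall fun y => ⟨?_, ?_⟩⟩
  · rw [mul_div_cancel₀ _ (hP.pos y).ne', bihFun]
    ring
  · rw [mul_div_cancel₀ _ (hQ.pos y).ne']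
    ring

/-- Off 0 the function Q v is α + β/x² with β ≥ 0 by monotonicity. If β > 0, its potential is
infinite and the first component is nowhere finite. If β = 0, then Q v is the constant α and the
pure function is α (1 - x)/(2 P), so the pair is biharmonic on all of Ω and 0 is not in the support.
-/
theorem not_biharmonicSupport_eq_zero (hP : IsWeight P) (hQ : IsWeight Q) {u v : Om → EReal}
    (hpure : IsPurePair (quotientSheaf exH P Q) u v)
    (hpot : IsPairPotential (quotientSheaf exH P Q) u v) :
    biharmonicSupport (quotientSheaf exH P Q) u v ≠ {zeroOm} := by
  intro hsupp
  obtain ⟨hH, hnn, hu⟩ := hpure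
  have hpair := (isHyperharmonicPair_iff hP hQ).mp hH
  rw [Opens.coe_top] at hpair
  set g : Om → EReal := fun x => (Q x : EReal) * v x with hgdef
  have hanti : Antitone g := Hyp.antitone hpair.hyp
  have hsub : harmonicSupport (wSheaf scale₂ Q) v ⊆ {zeroOm} := by
    rw [← hsupp]
    rintro x hx U hxU ⟨a, ha, he⟩
    exact hx U hxU ⟨a.2, snd_mem_wSheaf hP hQ ha, fun z hz => (he z hz).2⟩
  obtain ⟨hm, he⟩ := toReal_mem_wSheaf_compl hsub (U := ⟨Ioi zeroOm, isOpen_Ioi⟩)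
    (lt_irrefl zeroOm)
  obtain ⟨α, β, -, hr⟩ := exists_coef_on isScale_scale₂ hm ordConnected_Ioi Subset.rfl
  have hfr : ∀ x, zeroOm < x → g x = ((α + β * scale₂ x : ℝ) : EReal) := fun x hx => by
    rw [← hr x hx, hgdef, EReal.coe_mul, ← he x hx]
  have hβ0 : 0 ≤ β := by
    obtain ⟨y₁, hy₁⟩ := Om.exists_gt zeroOm
    obtain ⟨y₂, hy₂⟩ := Om.exists_gt y₁
    have h1 := hanti hy₂.le
    rw [hfr y₁ hy₁, hfr y₂ (hy₁.trans hy₂), EReal.coe_le_coe_iff] at h1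
    have h2 := isScale_scale₂.anti y₁ y₂ (Om.pos_of_lt hy₁) hy₂
    by_contra hneg
    nlinarith
  rw [pureFn_quotient hP hQ hpair.hyp fun x => (hnn x).2, ← hgdef] at hu
  rcases eq_or_lt_of_le hβ0 with rfl | hβ
  · have hpos : ∀ x, zeroOm < x → g x = α := fun x hx => by
      rw [hfr x hx, zero_mul, add_zero]
    have hconst : g = toE fun _ => α := by
      funext x
      rcases Om.eq_zero_or_pos x with rfl | hx
      · obtain ⟨y, hy⟩ := Om.exists_gt zeroOm
        refine le_antisymm (not_lt.mp fun hlt => ?_) ((hpos y hy).ge.trans (hanti hy.le))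
        have := hpair.hyp.lsc zeroOm (mem_univ _) α hlt
        rw [nhdsWithin_univ] at this
        obtain ⟨b, hb, hs⟩ := exists_right_subset_of_mem_nhds this
        exact (show (α : EReal) < g b from hs ⟨hb.le, le_rfl⟩).ne' (hpos b hb)
      · exact hpos x hx
    have hα : 0 ≤ α := by
      have h0 : (0 : EReal) ≤ g zeroOm :=
        mul_nonneg (EReal.coe_nonneg.mpr (hQ.pos _).le) (hnn _).2
      rw [hconst] at h0
      exact EReal.coe_nonneg.mp h0
    have hmem : zeroOm ∈ biharmonicSupport (quotientSheaf exH P Q) u v := by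
      rw [hsupp]
      rfl
    refine hmem ⊤ trivial ⟨_, mem_quotient_of_const hP hQ ⊤ α, fun z _ => ⟨?_, ?_⟩⟩
    · rw [hu, hconst]
      simp only
      have h1z : 0 ≤ α * ((1 - (z : ℝ)) / 2) := mul_nonneg hα (by linarith [z.2.2])
      rw [pot_const hα, EReal.coe_ennreal_ofReal, max_eq_left h1z, ← EReal.coe_mul]
      congr 1
      ring
    · have hz : (Q z : EReal) * v z = (α : EReal) := congrFun hconst z
      rw [← EReal.coe_inv_mul_cancel (hQ.pos z).ne' (v z), hz, ← EReal.coe_mul]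
      congr 1
      ring
  · obtain ⟨x, hx⟩ := hpot.1.2.1.nonempty
    refine hx ?_
    -- This choice of `b` makes |α| y² at most β/2 on [0, b], so α + β/y² ≥ (β/2)/y² on ]0, b].
    obtain ⟨b, hb0, hb⟩ : ∃ b : Om, 0 < (b : ℝ) ∧ (|α| + 1) * (b : ℝ) ^ 2 ≤ β / 2 := by
      have h1 : ContinuousAt (fun b : Om => (|α| + 1) * (b : ℝ) ^ 2) zeroOm := by fun_prop
      have h2 := h1.eventually_lt (continuousAt_const (y := β / 2)) (by
        simp only [zeroOm]
        linarith)
      obtain ⟨b, hb, hs⟩ := nhds_zeroOm_basis h2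
      exact ⟨b, hb, (hs (self_mem_Iic (a := b))).le⟩
    have htop := pot_eq_top (Hyp.measurable hpair.hyp) (half_pos hβ) hb0 (fun y hy hyb => by
      rw [hfr y hy, EReal.coe_le_coe_iff, scale₂, div_le_iff₀ (by positivity)]
      have h3 : (y : ℝ) ^ 2 ≤ (b : ℝ) ^ 2 := pow_le_pow_left₀ hy.le hyb 2
      have h4 := neg_abs_le α
      have h5 : (α + β * (1 / (y : ℝ) ^ 2)) * (y : ℝ) ^ 2 = α * (y : ℝ) ^ 2 + β := by
        field_simp
      rw [h5]
      nlinarith [abs_nonneg α, sq_nonneg (y : ℝ)]) x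
    rw [hu]
    simp only
    rw [htop]
    exact EReal.coe_mul_top_of_pos (one_div_pos.mpr (hP.pos x))

end Infinite


/-! ### Potentials of pairs -/

section PairPotentials

variable {P Q : Om → ℝ}

theorem isHyperharmonicPair_exH_iff {u v : Om → EReal} :
    IsHyperharmonicPair exH ⊤ u v ↔ HypPair univ u v := by
  rw [exH_eq_quotient, isHyperharmonicPair_iff isWeight_one isWeight_one]
  simp

theorem exQ_eq : toE exQ = fun x => min (green scale₂ zeroOm x) ((1 : ℝ) : EReal) := by
  funext x
  rcases Om.eq_zero_or_pos x with rfl | hx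
  · rw [green_zero_zero, min_eq_right le_top, toE, exQ, if_pos (show (zeroOm : ℝ) = 0 from rfl)]
  · rw [green_of_ge _ hx (zeroOm_le x), toE, exQ, if_neg hx.ne', min_comm, scale₂]
    exact EReal.coe_strictMono.monotone.map_min

theorem continuous_exP : Continuous exP := by
  unfold exP
  fun_prop

theorem continuous_exQ : Continuous exQ := by
  have h : Continuous (toE exQ) := by
    rw [exQ_eq]
    exact (continuous_green_right isScale_scale₂ zeroOm).min continuous_const
  exact EReal.isEmbedding_coe.continuous_iff.mpr h

theorem exP_pos (x : Om) : 0 < exP x := by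
  rw [exP]
  linarith [x.2.2]

theorem exQ_pos (x : Om) : 0 < exQ x := by
  rcases Om.eq_zero_or_pos x with rfl | hx
  · rw [exQ, if_pos (show (zeroOm : ℝ) = 0 from rfl)]
    exact one_pos
  · rw [exQ, if_neg hx.ne']
    exact lt_min one_pos (sub_pos.mpr (isScale_scale₂.one_lt x hx))

theorem exP_eq (x : Om) : exP x = (1 - x) / 2 := by
  rw [exP]
  ring

theorem pot_one : (fun x => (pot (fun _ => 1) x : EReal)) = toE exP := by
  funext x
  rw [show (fun _ => 1 : Om → EReal) = toE fun _ => 1 from rfl, pot_const zero_le_one, one_mul,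
    ← exP_eq, EReal.coe_ennreal_ofReal, max_eq_left (exP_pos x).le, toE]

/-- A harmonic function on all of Ω is constant, so a majorant with arbitrarily small values forces
it to be 0. -/
theorem eq_zero_of_const_le {s : Om → ℝ} {h : Om → ℝ} (hh : h ∈ wSheaf s (fun _ => 1) ⊤)
    (hs : IsScale s) (h0 : ∀ x, 0 ≤ h x) {r : Om → ℝ} (hle : ∀ x, h x ≤ r x)
    (hr : ∀ ε : ℝ, 0 < ε → ∃ x, r x < ε) (x : Om) : h x = 0 := by
  obtain ⟨α, hα⟩ := coef_global hs hh
  simp only [one_mul] at hα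
  rw [hα]
  refine le_antisymm (le_of_forall_pos_le_add fun ε hε => ?_) (hα x ▸ h0 x)
  obtain ⟨y, hy⟩ := hr ε hε
  have := hle y
  rw [hα] at this
  linarith

theorem exists_exQ_lt {ε : ℝ} (hε : 0 < ε) : ∃ x, exQ x < ε := by
  obtain ⟨x, hx⟩ := exists_green_lt isScale_scale₂ zeroOm hε
  refine ⟨x, EReal.coe_lt_coe_iff.mp ?_⟩
  have : toE exQ x < ε := by
    rw [exQ_eq]
    exact (min_le_left _ _).trans_lt hx
  exact this

theorem exists_exP_lt {ε : ℝ} (hε : 0 < ε) : ∃ x, exP x < ε := by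
  have h1 : max 0 (1 - ε) < 1 := max_lt one_pos (by linarith)
  obtain ⟨t, ht1, ht2⟩ := exists_between h1
  refine ⟨⟨t, (le_max_left _ _).trans ht1.le, ht2⟩, ?_⟩
  have := (le_max_right (0 : ℝ) (1 - ε)).trans_lt ht1
  rw [exP_eq]
  show (1 - t) / 2 < ε
  linarith

/-- The pair (p, 1) is hyperharmonic because p is the potential of 1, and 1 may be replaced by the
smaller hyperharmonic function q. -/
theorem hypPair_exP_exQ : HypPair univ (toE exP) (toE exQ) := by
  have h1 : HypPair univ (toE exP) fun _ => 1 :=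
    pot_one ▸ hypPair_pot (Hyp.const isScale_scale₂ 1) fun _ => zero_le_one
  refine h1.mono ?_ fun x => ?_
  · rw [exQ_eq]
    exact (hyp_green isScale_scale₂ univ zeroOm).min_const isScale_scale₂ 1
  · rw [exQ_eq]
    exact min_le_right _ _

theorem isPairPotential_exP_exQ : IsPairPotential exH (toE exP) (toE exQ) := by
  refine ⟨⟨isHyperharmonicPair_exH_iff.mpr hypPair_exP_exQ, ?_, fun x =>
    ⟨EReal.coe_nonneg.mpr (exP_pos x).le, EReal.coe_nonneg.mpr (exQ_pos x).le⟩⟩, ?_⟩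
  · simp [toE]
  · intro h k hk h0 hle
    -- The second component must be treated first: once k = 0, `h` is a section of the first sheaf.
    have hk0 : ∀ x, k x = 0 := by
      rw [exH_eq_quotient] at hk
      exact eq_zero_of_const_le (snd_mem_wSheaf isWeight_one isWeight_one hk) isScale_scale₂
        (fun x => (h0 x).2) (fun x => EReal.coe_le_coe_iff.mp (hle x).2) fun ε => exists_exQ_lt
    have hh : h ∈ wSheaf scale₁ (fun _ => 1) ⊤ := by
      rw [← exH₁_eq, mem_exH₁_iff_exH, show (fun _ => (0 : ℝ)) = k from funext fun x => (hk0 x).symm]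
      exact hk
    exact fun x => ⟨eq_zero_of_const_le hh isScale_scale₁ (fun x => (h0 x).1)
      (fun x => EReal.coe_le_coe_iff.mp (hle x).1) (fun ε => exists_exP_lt) x, hk0 x⟩

/-- The inequality on [0, b[ reads P(x) ≥ P(b) + (b - x)/2 * Q(b), so positivity of Q alone makes P
a weight. -/
theorem pos_of_isPairPotential (hpot : IsPairPotential exH (toE P) (toE Q)) (hQ : ∀ x, 0 < Q x)
    (x : Om) : 0 < P x := by
  obtain ⟨b, hxb⟩ := Om.exists_gt x
  have h := (isHyperharmonicPair_exH_iff.mp hpot.1.1).one x b hxb (subset_univ _)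
  have hb := EReal.coe_nonneg.mp (hpot.1.2.2 b).1
  simp only [toE, ← EReal.coe_mul, ← EReal.coe_add, EReal.coe_le_coe_iff] at h
  have hxb' : (x : ℝ) < b := hxb
  have := mul_pos (half_pos (sub_pos.mpr hxb')) (hQ b)
  linarith

theorem isHyperharmonicPair_one (hP : IsWeight P) (hQ : IsWeight Q)
    (hpot : IsPairPotential exH (toE P) (toE Q)) :
    IsHyperharmonicPair (quotientSheaf exH P Q) ⊤ (fun _ => 1) fun _ => 1 := by
  rw [isHyperharmonicPair_iff hP hQ]
  simp only [mul_one]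
  exact isHyperharmonicPair_exH_iff.mp hpot.1.1

/-- The pair (1, 1) corresponds to (P, Q), and its biharmonic minorants, multiplied by P and Q, are
minorants of that potential. -/
theorem isStrong_quotient (hP : IsWeight P) (hQ : IsWeight Q)
    (hpot : IsPairPotential exH (toE P) (toE Q)) : IsStrong (quotientSheaf exH P Q) := by
  refine ⟨fun _ => 1, fun _ => 1, ⟨⟨isHyperharmonicPair_one hP hQ hpot, ?_, fun x =>
    ⟨zero_le_one, zero_le_one⟩⟩, fun h k hk h0 hle x => ?_⟩, fun x => ⟨zero_lt_one, zero_lt_one⟩⟩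
  · have : ∀ x : Om, (1 : EReal) ≠ ⊤ := fun _ => EReal.coe_ne_top 1
    simp [this zeroOm]
  · have hle' : ∀ x, h x ≤ 1 ∧ k x ≤ 1 := fun x =>
      ⟨EReal.coe_le_coe_iff.mp (hle x).1, EReal.coe_le_coe_iff.mp (hle x).2⟩
    have := hpot.2 _ _ hk.2.2 (fun x => ⟨mul_nonneg (hP.pos x).le (h0 x).1,
      mul_nonneg (hQ.pos x).le (h0 x).2⟩) (fun x =>
      ⟨EReal.coe_le_coe_iff.mpr (mul_le_of_le_one_right (hP.pos x).le (hle' x).1),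
        EReal.coe_le_coe_iff.mpr (mul_le_of_le_one_right (hQ.pos x).le (hle' x).2)⟩) x
    exact ⟨(mul_eq_zero.mp this.1).resolve_left (hP.pos x).ne',
      (mul_eq_zero.mp this.2).resolve_left (hQ.pos x).ne'⟩

end PairPotentials


/-! ### Measures are determined by their Green potentials -/

section Determined

variable {s : Om → ℝ} {m m' : Measure Om}

theorem green_toENNReal (s : Om → ℝ) {z : Om} (hz : 0 < (z : ℝ)) (y : Om) :
    (green s z y).toENNReal = ENNReal.ofReal (s (max y z) - 1) := by
  rw [green_coe _ (max_pos_of_right hz y)]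
  rfl

/-- With κ = s z - s z', the difference of the Green functions of poles z and z' lies between κ
times the indicator of [0, z] and κ times that of [0, z']. Equal finite potentials allow the
integrals to be compared and cancelled. -/
theorem measure_Iic_le_of_green (hs : IsScale s)
    (h : ∀ z : Om, 0 < (z : ℝ) →
      ∫⁻ y, (green s z y).toENNReal ∂m = ∫⁻ y, (green s z y).toENNReal ∂m' ∧
        ∫⁻ y, (green s z y).toENNReal ∂m ≠ ⊤) {z z' : Om} (hz : 0 < (z : ℝ)) (hzz : z < z') :
    m (Iic z) ≤ m' (Iic z') := by
  have hz' : 0 < (z' : ℝ) := Om.pos_of_lt hzz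
  have hanti := hs.anti z z' hz hzz
  have hpos : ∀ x : Om, 0 < (x : ℝ) → 0 ≤ s x - 1 := fun x hx => (sub_pos.mpr (hs.one_lt x hx)).le
  set κ := ENNReal.ofReal (s z - s z') with hκ
  have hm : ∀ z, Measurable fun y => (green s z y).toENNReal := fun z =>
    (continuous_green_right hs z).measurable.ereal_toENNReal
  have h1 : κ * m (Iic z) + ∫⁻ y, (green s z' y).toENNReal ∂m ≤
      ∫⁻ y, (green s z y).toENNReal ∂m := by
    rw [← lintegral_indicator_const measurableSet_Iic, ← lintegral_add_right _ (hm z')]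
    refine lintegral_mono fun y => ?_
    simp only
    rw [green_toENNReal s hz, green_toENNReal s hz']
    by_cases hy : y ∈ Iic z
    · rw [indicator_of_mem hy, max_eq_right (show y ≤ z from hy),
        max_eq_right (show y ≤ z' from le_trans hy hzz.le), hκ,
        ← ENNReal.ofReal_add (by linarith) (hpos z' hz')]
      exact ENNReal.ofReal_le_ofReal (by linarith)
    · rw [indicator_of_notMem hy, zero_add]
      refine ENNReal.ofReal_le_ofReal ?_
      linarith [hs.anti_le (max_pos_of_right hz y) (max_le_max_left y hzz.le)]
  have h2 : ∫⁻ y, (green s z y).toENNReal ∂m' ≤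
      κ * m' (Iic z') + ∫⁻ y, (green s z' y).toENNReal ∂m' := by
    rw [← lintegral_indicator_const measurableSet_Iic, ← lintegral_add_right _ (hm z')]
    refine lintegral_mono fun y => ?_
    simp only
    rw [green_toENNReal s hz, green_toENNReal s hz']
    by_cases hy : y ∈ Iic z'
    · rw [indicator_of_mem hy, max_eq_right (show y ≤ z' from hy), hκ,
        ← ENNReal.ofReal_add (by linarith) (hpos z' hz')]
      refine ENNReal.ofReal_le_ofReal ?_
      linarith [hs.anti_le hz (le_max_right y z)]
    · have hy' : z' < y := not_le.mp hy
      rw [indicator_of_notMem hy, zero_add, max_eq_left hy'.le, max_eq_left (hzz.trans hy').le]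
  have h3 : κ * m (Iic z) ≤ κ * m' (Iic z') := by
    have := h1.trans ((h z hz).1.trans_le h2)
    rw [← (h z' hz').1] at this
    exact (ENNReal.add_le_add_iff_right (h z' hz').2).mp this
  exact (ENNReal.mul_le_mul_iff_right (ENNReal.ofReal_pos.mpr (by linarith)).ne'
    ENNReal.ofReal_ne_top).mp h3

theorem measure_Iic_le_of_forall_lt [IsFiniteMeasure m']
    (h : ∀ z z' : Om, 0 < (z : ℝ) → z < z' → m (Iic z) ≤ m' (Iic z')) (z : Om) :
    m (Iic z) ≤ m' (Iic z) := by
  have hlim := tendsto_measure_biInter_gt (μ := m') (s := fun z : Om => Iic z) (a := z)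
    (fun _ _ => measurableSet_Iic.nullMeasurableSet) (fun _ _ _ hij => Iic_subset_Iic.mpr hij)
    ((Om.exists_gt z).imp fun r hr => ⟨hr, measure_ne_top _ _⟩)
  have e : ⋂ r, ⋂ (_ : r > z), Iic r = Iic z := by
    ext y
    simp only [mem_iInter, mem_Iic]
    exact ⟨fun h => le_of_forall_gt_imp_ge_of_dense h, fun h r hr => h.trans hr.le⟩
  rw [e] at hlim
  refine ge_of_tendsto hlim ?_
  filter_upwards [self_mem_nhdsWithin] with r hr
  obtain ⟨q, hq1, hq2⟩ := Om.exists_between (show z < r from hr)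
  exact (measure_mono (Iic_subset_Iic.mpr hq1.le)).trans (h q r (Om.pos_of_lt hq1) hq2)

/-- A finite measure is determined by its potentials. -/
theorem eq_of_green (hs : IsScale s) [IsFiniteMeasure m']
    (h : ∀ z : Om, 0 < (z : ℝ) →
      ∫⁻ y, (green s z y).toENNReal ∂m = ∫⁻ y, (green s z y).toENNReal ∂m' ∧
        ∫⁻ y, (green s z y).toENNReal ∂m ≠ ⊤) : m = m' := by
  have h' : ∀ z : Om, 0 < (z : ℝ) →
      ∫⁻ y, (green s z y).toENNReal ∂m' = ∫⁻ y, (green s z y).toENNReal ∂m ∧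
        ∫⁻ y, (green s z y).toENNReal ∂m' ≠ ⊤ := fun z hz =>
    ⟨(h z hz).1.symm, (h z hz).1 ▸ (h z hz).2⟩
  have h1 := measure_Iic_le_of_forall_lt fun z z' => measure_Iic_le_of_green hs h
  -- Finiteness of `m` is inherited from `m'` through the bound on initial segments, and is needed
  -- to exchange their roles.
  have : IsFiniteMeasure m := by
    refine ⟨lt_of_le_of_lt ?_ (measure_lt_top m' univ)⟩
    exact le_of_tendsto' (tendsto_measure_Iic_atTop m)
      fun z => (h1 z).trans (measure_mono (subset_univ _))
  have h2 := measure_Iic_le_of_forall_lt fun z z' => measure_Iic_le_of_green hs h'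
  exact Measure.ext_of_Iic m m' fun z => le_antisymm (h1 z) (h2 z)

end Determined

/-! ### The coupling kernel -/

section Coupling

instance : IsFiniteMeasure exμ := by
  refine ⟨lt_of_le_of_lt (b := 1) ?_ ENNReal.one_lt_top⟩
  rw [← lintegral_one, lintegral_exμ measurable_const]
  simp only [mul_one]
  rw [lintegral_comap_Om fun t => ENNReal.ofReal t]
  calc ∫⁻ t in Ioc (0 : ℝ) 1, ENNReal.ofReal t ≤ ∫⁻ t in Ioc (0 : ℝ) 1, 1 := by
        refine setLIntegral_mono measurable_const fun t ht => ?_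
        exact ENNReal.ofReal_one ▸ ENNReal.ofReal_le_ofReal ht.2
    _ = 1 := by simp

/-- The kernel `V f (x) = ∫ p_y (x) f (y) dμ(y)`. -/
def couplingKernel : Kernel Om Om :=
  (Kernel.const Om exμ).withDensity fun x y => (exGreen₁ y x).toENNReal

theorem lintegral_couplingKernel {f : Om → ENNReal} (hf : Measurable f) (x : Om) :
    ∫⁻ y, f y ∂(couplingKernel x) = ∫⁻ y, (exGreen₁ y x).toENNReal * f y ∂exμ := by
  have hm : Measurable (Function.uncurry fun x y => (exGreen₁ y x).toENNReal) :=
    (continuous_green isScale_scale₁).measurable.ereal_toENNReal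
  exact Kernel.lintegral_withDensity _ hm x hf

theorem lintegral_couplingKernel_eq_pot {g : Om → EReal} (hg : Measurable g) (x : Om) :
    ∫⁻ y, (g y).toENNReal ∂(couplingKernel x) = pot g x :=
  lintegral_couplingKernel hg.ereal_toENNReal x

theorem pureFn_exH {v : Om → EReal} (hv : Hyp scale₂ univ v) (hv0 : ∀ x, 0 ≤ v x) :
    pureFn exH v = fun x => (pot v x : EReal) := by
  have := pureFn_quotient (v := v) isWeight_one isWeight_one (by simpa using hv) hv0
  rw [exH_eq_quotient, this]
  simp

theorem mem_hyper₂_exH_iff {v : Om → EReal} : v ∈ hyper₂ exH ⊤ ↔ Hyp scale₂ univ v := by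
  rw [exH_eq_quotient, mem_hyper₂_iff isWeight_one isWeight_one]
  simp

/-- On an interval the inequalities involve only the values of γ there, so a sign on U suffices.
Applied to γ and -γ where γ = 0, this gives harmonicity of the potential off the support. -/
theorem hyp_potR {γ : Om → ℝ} (hm : Measurable γ) {N : ℝ} (hN : ∀ x, |γ x| ≤ N) {U : Set Om}
    (h0 : ∀ x ∈ U, 0 ≤ γ x) : Hyp scale₁ U (toE fun x : Om => potR (extendOm γ) x) where
  lsc := (continuous_coe_real_ereal.comp
    (continuous_potR_of_bounded hm hN)).continuousOn.lowerSemicontinuousOn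
  ne_bot _ _ := EReal.coe_ne_bot _
  two c x d hc hcx hxd hU := by
    have hx : 0 < (x : ℝ) := hc.trans hcx
    have hcd := hcx.trans hxd
    have hZ := mul_potR_eq_tent (intervalIntegrable_extendOm_of_bounded hm hN) hc hcx hxd d.2.2
    have ht : 0 ≤ tentInt c d x (extendOm γ) := tentInt_nonneg hcx hxd fun y hy => by
      rw [extendOm_of_mem γ ⟨hc.le.trans hy.1, hy.2.trans_lt d.2.2⟩]
      exact h0 _ (hU hy)
    simp only [toE, ← EReal.coe_mul, ← EReal.coe_add, EReal.coe_le_coe_iff]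
    refine le_of_mul_le_mul_left ?_ hx
    rw [hZ, ← mul_assoc _ (c : ℝ), ← mul_assoc _ (d : ℝ), ← lam_scale₁_left hc hcd hx,
      ← lam_scale₁_right hc hcd hx]
    linarith
  one x d hxd hU := by
    have := potR_add_le (m := 0) (intervalIntegrable_extendOm_of_bounded hm hN) x.2.1 hxd d.2.2
      fun t ht htd => by
        rw [extendOm_of_mem γ ⟨ht.le, htd.trans_lt d.2.2⟩]
        exact h0 _ (hU htd)
    simp only [toE, EReal.coe_le_coe_iff]
    linarith

theorem extendOm_neg (γ : Om → ℝ) (t : ℝ) : extendOm (-γ) t = -extendOm γ t := by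
  by_cases ht : t ∈ Ico (0 : ℝ) 1
  · rw [extendOm_of_mem _ ht, extendOm_of_mem _ ht, Pi.neg_apply]
  · rw [extendOm_of_notMem _ ht, extendOm_of_notMem _ ht, neg_zero]

theorem potR_extendOm_neg (γ : Om → ℝ) (x : ℝ) :
    potR (extendOm (-γ)) x = -potR (extendOm γ) x := by
  simp only [potR, extendOm_neg, mul_neg, intervalIntegral.integral_neg]

theorem potR_mem_wSheaf {γ : Om → ℝ} (hm : Measurable γ) {N : ℝ} (hN : ∀ x, |γ x| ≤ N)
    {U : Opens Om} (h0 : ∀ x ∈ U, γ x = 0) :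
    (fun x : Om => potR (extendOm γ) x) ∈ wSheaf scale₁ (fun _ => 1) U := by
  rw [mem_wSheaf_iff_hyp isScale_scale₁ isWeight_one]
  simp only [EReal.coe_one, one_mul]
  refine ⟨hyp_potR hm hN fun x hx => (h0 x hx).ge, ?_⟩
  have h := hyp_potR (γ := -γ) hm.neg (N := N) (by simpa using hN) (U := U) fun x hx => by
    simp [h0 x hx]
  simp only [potR_extendOm_neg] at h
  exact h

theorem isCouplingKernel_couplingKernel : IsCouplingKernel exH couplingKernel := by
  refine ⟨fun φ hφ hc h0 => ?_, fun v hv hv0 => ?_⟩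
  · obtain ⟨N, hN⟩ := hc.exists_bound_of_continuous hφ
    have hm := hφ.measurable
    have hN' : ∀ x, |φ x| ≤ N := hN
    have e : (fun x => ((∫⁻ y, ENNReal.ofReal (φ y) ∂(couplingKernel x) : ENNReal) : EReal)) =
        toE fun x : Om => potR (extendOm φ) x := by
      funext x
      rw [toE, ← max_eq_left (potR_nonneg x.2.2 (extendOm_nonneg h0)), ← EReal.coe_ennreal_ofReal,
        ← pot_toE_of_bounded h0 hm hN',
        ← lintegral_couplingKernel_eq_pot (g := toE φ) hm.coe_real_ereal]
      rfl
    rw [e, assoc₁_exH, exH₁_eq]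
    refine ⟨?_, fun U hU => ⟨_, potR_mem_wSheaf hm hN' fun x hx => ?_, fun x _ => rfl⟩⟩
    · rw [isPotential_wSheaf_iff isScale_scale₁ isWeight_one]
      simp only [EReal.coe_one, one_mul]
      refine ⟨hyp_potR hm hN' fun x _ => h0 x, fun x => EReal.coe_nonneg.mpr
        (potR_nonneg x.2.2 (extendOm_nonneg h0)), by simp [toE], fun ε hε => ?_⟩
      have hN0 : 0 ≤ N := (abs_nonneg _).trans (hN' zeroOm)
      -- The potential is at most N p, and p is arbitrarily small near 1; the denominator N + 1 also
      -- covers N = 0.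
      obtain ⟨x, hx⟩ := exists_exP_lt (show 0 < ε / (N + 1) by positivity)
      refine ⟨x, EReal.coe_lt_coe_iff.mpr ?_⟩
      have h1 := potR_le (intervalIntegrable_extendOm_of_bounded hm hN') x.2.1 x.2.2
        fun t => (le_abs_self _).trans (abs_extendOm_le hN' t)
      rw [← exP_eq] at h1
      rw [lt_div_iff₀ (by positivity)] at hx
      linarith [exP_pos x]
    · have : x ∈ (tsupport φ)ᶜ := hU ▸ hx
      exact image_eq_zero_of_notMem_tsupport this
  · have hv' := mem_hyper₂_exH_iff.mp hv
    rw [pureFn_exH hv' hv0]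
    funext x
    rw [lintegral_couplingKernel_eq_pot hv'.measurable]

theorem pureFn_exH_one_eq_pot :
    (pureFn exH fun _ => 1) = fun x => (pot (fun _ => 1) x : EReal) :=
  pureFn_exH (v := fun _ => 1) (Hyp.const isScale_scale₂ 1) fun _ => zero_le_one

theorem pureFn_exH_one : (pureFn exH fun _ => 1) = toE exP := by
  rw [pureFn_exH_one_eq_pot, pot_one]

theorem pot_ne_top_of_le {g : Om → EReal} {N : ℝ} (hN : 0 ≤ N) (h : ∀ x, g x ≤ N) (x : Om) :
    pot g x ≠ ⊤ := by
  refine ne_top_of_le_ne_top ?_ (pot_mono (g' := toE fun _ => N) h x)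
  rw [pot_const hN]
  exact ENNReal.ofReal_ne_top

/-- Test both kernels on the bounded hyperharmonic functions q_z with z > 0: both give the pure
function of q_z. For each x the two measures have the same finite Green potentials, hence coincide.
-/
theorem IsCouplingKernel.eq_couplingKernel {W : Kernel Om Om} (hW : IsCouplingKernel exH W) :
    W = couplingKernel := by
  have key : ∀ v : Om → EReal, Hyp scale₂ univ v → (∀ x, 0 ≤ v x) → ∀ x,
      ∫⁻ y, (v y).toENNReal ∂(W x) = pot v x := fun v hv hv0 x => by
    have := congrFun (hW.2 v (mem_hyper₂_exH_iff.mpr hv) hv0) x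
    rw [pureFn_exH hv hv0] at this
    exact (EReal.coe_ennreal_injective this).symm
  refine Kernel.ext fun x => ?_
  have hfin : IsFiniteMeasure (couplingKernel x) := by
    refine ⟨?_⟩
    have h1 := lintegral_couplingKernel_eq_pot (g := toE fun _ => 1) measurable_const x
    simp only [toE, EReal.real_coe_toENNReal, ENNReal.ofReal_one, lintegral_one] at h1
    rw [h1]
    exact (pot_ne_top_of_le zero_le_one (fun _ => le_rfl) x).lt_top
  refine eq_of_green isScale_scale₂ fun z hz => ?_
  have hg := hyp_green isScale_scale₂ univ z
  have hg0 := green_nonneg isScale_scale₂ z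
  rw [key _ hg hg0, lintegral_couplingKernel_eq_pot hg.measurable]
  refine ⟨rfl, pot_ne_top_of_le (N := scale₂ z - 1)
    (sub_pos.mpr (isScale_scale₂.one_lt z hz)).le (fun y => ?_) x⟩
  rw [← green_of_le scale₂ hz (zeroOm_le z)]
  exact green_antitone isScale_scale₂ z (zeroOm_le y)

/-! ### The representing measure and the adjoint kernel -/

theorem represents_exμ : Represents exGreen₁ exμ (pureFn exH fun _ => 1) := fun x => by
  rw [pureFn_exH_one_eq_pot]
  have h : (1 : EReal).toENNReal = 1 := ENNReal.ofReal_one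
  simp only [pot, h, mul_one]

/-- By the symmetry of p_y(x), a representation says that μ has the same potentials as y dy in the
first space; they are finite because they equal (1 - x)/2. -/
theorem eq_exμ_of_represents {μ : Measure Om}
    (hμ : Represents exGreen₁ μ (pureFn exH fun _ => 1)) : μ = exμ := by
  refine eq_of_green isScale_scale₁ fun z _ => ?_
  have h1 := hμ z
  have h2 := represents_exμ z
  rw [pureFn_exH_one] at h1 h2
  simp only [exGreen₁_eq, green_comm scale₁ _ z] at h1 h2
  refine ⟨EReal.coe_ennreal_injective (h1.symm.trans h2), fun h => ?_⟩
  rw [h] at h1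
  exact EReal.coe_ne_top _ h1

/-- Near 0 one has φ > φ(0)/2 and q_0(y) ≥ 1/(2 y²), so the integrand with the density y is at least
φ(0)/(4 y). -/
theorem adjointKernel_zero_eq_top {φ : Om → ℝ} (hφ : Continuous φ) (h0 : 0 < φ zeroOm) :
    adjointKernel exGreen₂ exμ (fun y => ENNReal.ofReal (φ y)) zeroOm = ⊤ := by
  have hev := (continuousAt_const (y := φ zeroOm / 2)).eventually_lt hφ.continuousAt
    (half_lt_self h0)
  obtain ⟨b, hb0, hb⟩ := nhds_zeroOm_basis hev
  obtain ⟨c, hc⟩ := exists_half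
  have hc0 : (0 : ℝ) < c := by rw [hc]; norm_num
  rw [exGreen₂_eq]
  refine lintegral_exμ_eq_top (b := min b c)
    ((continuous_green_right isScale_scale₂ zeroOm).measurable.ereal_toENNReal.mul
      hφ.measurable.ennreal_ofReal)
    (k := φ zeroOm / 4) (by positivity) (lt_min (α := Om) (a := zeroOm) hb0 hc0)
    fun y hy hyb => ?_
  have h1 := EReal.toENNReal_le_toENNReal (half_div_sq_le_green hy
    (hc ▸ (show (y : ℝ) ≤ c from hyb.trans (min_le_right b c))))
  have h2 : ENNReal.ofReal (φ zeroOm / 2) ≤ ENNReal.ofReal (φ y) :=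
    ENNReal.ofReal_le_ofReal (hb (hyb.trans (min_le_left b c))).le
  refine le_trans (le_of_eq ?_) (mul_le_mul' le_rfl (mul_le_mul' h1 h2))
  rw [EReal.real_coe_toENNReal, ← ENNReal.ofReal_mul (by positivity), ← ENNReal.ofReal_mul hy.le]
  congr 1
  field_simp
  ring

theorem not_adjointRegular : ¬ AdjointRegular exGreen₂ exμ := by
  intro h
  obtain ⟨c, hc⟩ := exists_half
  have hcont : Continuous fun y : Om => max 0 ((c : ℝ) - y) := by fun_prop
  have hsupp : HasCompactSupport fun y : Om => max 0 ((c : ℝ) - y) := by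
    refine HasCompactSupport.intro (isCompact_Icc_Om zeroOm c) fun y hy => ?_
    have : (c : ℝ) < y := not_le.mp fun hle => hy ⟨zeroOm_le y, hle⟩
    exact max_eq_left (by linarith)
  refine (h _ hcont hsupp fun y => le_max_left _ _).1 zeroOm (adjointKernel_zero_eq_top hcont ?_)
  rw [hc]
  exact lt_max_of_lt_right (by simp [zeroOm])

end Coupling

end Biharmonic

end

/-! ### The main theorem -/

open Biharmonic in
theorem mainTheorem10 :
    -- the biharmonic space and its associated harmonic spaces
    (IsBrelotBiharmonicSpace exH ∧ assoc₁ exH = exH₁ ∧ assoc₂ exH = exH₂) ∧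
    -- the space is strong, with an explicit continuous potential
    (Continuous exP ∧ Continuous exQ ∧ (∀ x, 0 < exP x ∧ 0 < exQ x) ∧
      IsPairPotential exH (toE exP) (toE exQ) ∧ IsStrong exH) ∧
    -- both harmonic spaces are symmetric Green spaces, with explicit Green kernels
    (IsGreenBiharmonicSpace exH ∧
      IsSymmetricGreenHarmonicSpace exH₁ ∧ IsSymmetricGreenHarmonicSpace exH₂ ∧
      IsGreenFamily exH₁ exGreen₁ ∧ IsGreenFamily exH₂ exGreen₂ ∧
      (∀ x y, exGreen₁ y x = exGreen₁ x y) ∧ (∀ x y, exGreen₂ y x = exGreen₂ x y) ∧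
      Continuous (fun z : Om × Om => exGreen₁ z.2 z.1) ∧
      Continuous (fun z : Om × Om => exGreen₂ z.2 z.1)) ∧
    -- the pure function of order 2 associated with a potential of support {0} is +∞
    ((∀ v : Om → EReal, IsPotential exH₂ v → harmonicSupport exH₂ v = {zeroOm} →
        (∀ x, pureFn exH v x = ⊤) ∧ ¬ IsSuperharmonic exH₁ ⊤ (pureFn exH v)) ∧
      (∀ x, pureFn exH (exGreen₂ zeroOm) x = ⊤) ∧
      (¬ ∃ u v : Om → EReal, IsPurePair exH u v ∧ IsPairPotential exH u v ∧
        biharmonicSupport exH u v = {zeroOm}) ∧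
      ¬ HasBiharmonicGreenKernel exH) ∧
    -- the same after division by a continuous potential, where (1, 1) is hyperharmonic
    (∀ P Q : Om → ℝ, Continuous P → Continuous Q → IsPairPotential exH (toE P) (toE Q) →
      (∀ x, 0 < Q x) →
      IsGreenBiharmonicSpace (quotientSheaf exH P Q) ∧ IsStrong (quotientSheaf exH P Q) ∧
      IsHyperharmonicPair (quotientSheaf exH P Q) ⊤ (fun _ => 1) (fun _ => 1) ∧
      (∃ q, IsGreenFamily (assoc₂ (quotientSheaf exH P Q)) q) ∧
      (∀ v : Om → EReal, IsPotential (assoc₂ (quotientSheaf exH P Q)) v →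
        harmonicSupport (assoc₂ (quotientSheaf exH P Q)) v = {zeroOm} →
        (∀ x, pureFn (quotientSheaf exH P Q) v x = ⊤) ∧
        ¬ IsSuperharmonic (assoc₁ (quotientSheaf exH P Q)) ⊤
          (pureFn (quotientSheaf exH P Q) v)) ∧
      (¬ ∃ u v : Om → EReal, IsPurePair (quotientSheaf exH P Q) u v ∧
        IsPairPotential (quotientSheaf exH P Q) u v ∧
        biharmonicSupport (quotientSheaf exH P Q) u v = {zeroOm}) ∧
      ¬ HasBiharmonicGreenKernel (quotientSheaf exH P Q)) ∧
    -- the coupling kernel, the representing measure and the adjoint kernel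
    ((∃ V : ProbabilityTheory.Kernel Om Om, IsCouplingKernel exH V ∧
        (∀ W : ProbabilityTheory.Kernel Om Om, IsCouplingKernel exH W → W = V) ∧
        (∀ (f : Om → ENNReal) (x : Om), Measurable f →
          ∫⁻ y, f y ∂(V x) = ∫⁻ y, (exGreen₁ y x).toENNReal * f y ∂exμ)) ∧
      pureFn exH (fun _ => 1) = toE exP ∧
      MeasureTheory.IsLocallyFiniteMeasure exμ ∧
      Represents exGreen₁ exμ (pureFn exH fun _ => 1) ∧
      (∀ μ : MeasureTheory.Measure Om, MeasureTheory.IsLocallyFiniteMeasure μ →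
        Represents exGreen₁ μ (pureFn exH fun _ => 1) → μ = exμ) ∧
      (∀ φ : Om → ℝ, Continuous φ → HasCompactSupport φ → (∀ x, 0 ≤ φ x) → 0 < φ zeroOm →
        adjointKernel exGreen₂ exμ (fun y => ENNReal.ofReal (φ y)) zeroOm = ⊤) ∧
      ¬ AdjointRegular exGreen₂ exμ) := by
  have hquot := exH_eq_quotient
  have h1 := isWeight_one
  refine ⟨⟨?_, assoc₁_exH, assoc₂_exH⟩,
    ⟨continuous_exP, continuous_exQ, fun x => ⟨exP_pos x, exQ_pos x⟩, isPairPotential_exP_exQ,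
      _, _, isPairPotential_exP_exQ,
      fun x => ⟨EReal.coe_pos.mpr (exP_pos x), EReal.coe_pos.mpr (exQ_pos x)⟩⟩,
    ⟨?_, exH₁_eq ▸ isSymmetricGreen_wSheaf_one isScale_scale₁,
      exH₂_eq ▸ isSymmetricGreen_wSheaf_one isScale_scale₂, ?_, ?_, ?_, ?_, ?_, ?_⟩,
    ⟨?_, ?_, ?_, ?_⟩, ?_,
    ⟨couplingKernel, isCouplingKernel_couplingKernel, fun W hW => hW.eq_couplingKernel,
      fun f x hf => lintegral_couplingKernel hf x⟩,
    pureFn_exH_one, inferInstance, represents_exμ, fun μ _ hμ => eq_exμ_of_represents hμ,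
    fun φ hφ _ _ h0 => adjointKernel_zero_eq_top hφ h0, not_adjointRegular⟩
  · exact hquot ▸ isBrelotBiharmonicSpace_quotient h1 h1
  · exact hquot ▸ isGreenBiharmonicSpace_quotient h1 h1
  · rw [exH₁_eq, exGreen₁_eq, ← wGreen_one]
    exact isGreenFamily_wGreen isScale_scale₁ h1
  · rw [exH₂_eq, exGreen₂_eq, ← wGreen_one]
    exact isGreenFamily_wGreen isScale_scale₂ h1
  · exact fun x y => green_comm scale₁ y x
  · rw [exGreen₂_eq]
    exact fun x y => green_comm scale₂ y x
  · exact continuous_green isScale_scale₁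
  · rw [exGreen₂_eq]
    exact continuous_green isScale_scale₂
  · intro v hv hs
    rw [exH₂_eq] at hv hs
    rw [hquot]
    have h := pureFn_eq_top_of_support h1 h1 hv hs
    exact ⟨h, not_isSuperharmonic_of_eq_top h⟩
  · rw [hquot, exGreen₂_eq, ← wGreen_one]
    exact pureFn_eq_top_of_support h1 h1 (isPotential_wGreen isScale_scale₂ h1 zeroOm)
      (harmonicSupport_wGreen isScale_scale₂ h1 zeroOm)
  · rw [hquot]
    rintro ⟨u, v, hpure, hpot, hs⟩
    exact not_biharmonicSupport_eq_zero h1 h1 hpure hpot hs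
  · exact hquot ▸ not_hasBiharmonicGreenKernel h1 h1
  · intro P Q hPc hQc hpot hQ0
    have hP : IsWeight P := ⟨hPc, pos_of_isPairPotential hpot hQ0⟩
    have hQ : IsWeight Q := ⟨hQc, hQ0⟩
    rw [assoc₂_quotient hP hQ]
    refine ⟨isGreenBiharmonicSpace_quotient hP hQ, isStrong_quotient hP hQ hpot,
      isHyperharmonicPair_one hP hQ hpot, ⟨_, isGreenFamily_wGreen isScale_scale₂ hQ⟩,
      fun v hv hs => ?_, ?_, not_hasBiharmonicGreenKernel hP hQ⟩
    · have h := pureFn_eq_top_of_support hP hQ hv hs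
      exact ⟨h, not_isSuperharmonic_of_eq_top h⟩
    · rintro ⟨u, v, hpure, hpot', hs⟩
      exact not_biharmonicSupport_eq_zero hP hQ hpure hpot' hs
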